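/- **Theorem (cellularity of the Okada algebra).** Let $N\ge 0$ be an integer, $K$ a field, and $X=(x_1,\dots,x_{N-1})$, $Y=(y_1,\dots,y_{N-2})$ arbitrary sequences in $K$. Let $O_N(X,Y)$ be the unital associative $K$-algebra with generators $E_1,\dots,E_{N-1}$ and relations $E_i^2=x_iE_i$ for $1\le i\le N-1$, $E_iE_j=E_jE_i$ for $|i-j|\ge 2$, and $E_{i+1}E_iE_{i+1}=y_iE_{i+1}$ for $1\le i\le N-2$. *Diagrams.* An Okada arc-diagram of rank $N$ is a non-crossing perfect matching of the nodes $1<2<\dots<N<\overline N<\dots<\overline 2<\overline 1$ (with $|a|=|\overline a|=a$) with a label $h$ on each arc $\{a,b\}$ such that $1\le h(\{a,b\})\le \min(|a|,|b|)$, $h(\{a,b\})\equiv\min(|a|,|b|) \pmod 2$, and $h(\{a,b\})>h(\{c,d\})$ whenever $c<a<b<d$. An arc $\{a,\overline b\}$ is called propagating. The composition $[C\circ D]$ merges the right nodes $\overline a$ of $C$ with the left nodes $a$ of $D$, concatenates the arcs, deletes the loops, and labels each resulting arc by the minimum of the labels of its fragments. The identity diagram has the arcs $\{a,\overline a\}$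 with label $a$ for all $a$; the elementary diagram $G_i$ ($1\le i<N$) has the arcs $\{i,i+1\}$ and $\{\overline i,\overline{i+1}\}$ with label $i$, and $\{j,\overline j\}$ with label $j$ for $j\ne i,i+1$. The mirror $D^\star$ exchanges left and right. *Identification of diagrams with elements of the algebra.* For $\sigma\in S_N$ put $c_i=\#\{j<i:\sigma^{-1}(j)>\sigma^{-1}(i)\}$ and $E_\sigma=\prod_{i=1}^N E_{i-1}E_{i-2}\cdots E_{i-c_i}$ (factors ordered by increasing $i$). Every Okada arc-diagram $D$ is the composition of the elementary diagrams along the word of $E_\sigma$ for exactly one $\sigma\in S_N$, and $D$ is identified with the element $E_\sigma\in O_N(X,Y)$. *Half diagrams.* An Okada half arc-diagram of rank $N$ consists of labelled full arcs $\{a,b\}$ and labelled half arcs at $a$ (propagating arcs, with a free end) such that each node of $\{1,\dots,N\}$ is on exactly one of them, full arcs do not cross, no half arc starts at a node strictly between the two ends of a full arc; labels are $\ge 1$, are at most and have the same parity as the smallest node of their arc, and strictly increase when passing from an arc to an arc nested in it, where an arc is nested in a half arc at $c$ if all its nodes are $>c$. Its propagating label set is the set of labels of its half arcs. For half diagrams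 $L,R$ with the same propagating label set, $L\bowtie R$ is the unique Okada arc-diagram with left half $L$ and with right half (read through the mirror) $R$: it is obtained by joining the half arcs of $L$ and $R$ with equal labels. *The poset.* A Fibonacci set of rank $N$ is a set $S=\{s_1<\dots<s_k\}\subseteq\{1,\dots,N\}$ with $k\equiv N$ and $s_l\equiv l \pmod 2$ for all $l$. For Fibonacci sets $S=\{s_1<\dots<s_k\}$ and $T=\{t_1<\dots<t_\ell\}$ of rank $N$, the dominance order is: $S\preceq T$ if and only if $k\le \ell$ and $s_{k-i}\le t_{\ell-i}$ for $0\le i<k$. *Claim.* $O_N(X,Y)$ is a finite-dimensional cellular algebra in the sense of Graham and Lehrer, with cell poset $\Lambda_N$ the set of Fibonacci sets of rank $N$ under dominance, index sets $M_S$ ($S\in\Lambda_N$) the set of half diagrams of rank $N$ with propagating label set $S$, cellular basis $C^S_{L,R}=L\bowtie R$ ($L,R\in M_S$), and anti-involution the mirror map. That is: 1. each $M_S$ is finite, and $(S,L,R)\mapsto C^S_{L,R}$ is injective with image a $K$-basis of $O_N(X,Y)$; 2. there is a $K$-linear map $\star:O_N(X,Y)\to O_N(X,Y)$ with $(ab)^\star=b^\star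 a^\star$, $(a^\star)^\star=a$, $(C^S_{L,R})^\star=C^S_{R,L}$, and which sends each diagram $D$ to its mirror $D^\star$; 3. for all $S\in\Lambda_N$ and $a\in O_N(X,Y)$ there are scalars $r_a(L',L)\in K$ ($L,L'\in M_S$) such that for all $L,R\in M_S$ $$a\,C^S_{L,R}-\sum_{L'\in M_S} r_a(L',L)\,C^S_{L',R}\ \in\ \operatorname{span}_K\{C^T_{P,Q}: T\prec S,\ P,Q\in M_T\}.$$ -/

import Mathlib

namespace Okada

/-! ### Fibonacci sets and the dominance order -/

/-- `S = {s_1 < ... < s_k} ⊆ {1, ..., N}` is a Fibonacci set of rank `N` if `k ≡ N` and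
`s_l ≡ l` modulo `2`. The enumeration `orderEmbOfFin` is indexed from `0`, so that
`s_l` is its value at `l - 1`. -/
def IsFibonacciSet (N : ℕ) (S : Finset ℕ) : Prop :=
  S ⊆ Finset.Icc 1 N ∧ S.card % 2 = N % 2 ∧
    ∀ i : Fin S.card, (S.orderEmbOfFin rfl i) % 2 = (i.val + 1) % 2

/-- The set of Fibonacci sets of rank `N`. -/
def FibSet (N : ℕ) : Type := {S : Finset ℕ // IsFibonacciSet N S}

/-- Dominance: `S = {s_1 < ... < s_k}` is dominated by `T = {t_1 < ... < t_l}` if `k ≤ l` and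
`s_{k-i} ≤ t_{l-i}` for `0 ≤ i < k`. -/
def Dominated (S T : Finset ℕ) : Prop :=
  ∃ h : S.card ≤ T.card, ∀ i : Fin S.card,
    S.orderEmbOfFin rfl (Fin.rev i) ≤ T.orderEmbOfFin rfl (Fin.rev (Fin.castLE h i))

theorem Dominated.refl (S : Finset ℕ) : Dominated S S :=
  ⟨le_rfl, fun _ => le_rfl⟩

theorem Dominated.trans {S T U : Finset ℕ} (h₁ : Dominated S T) (h₂ : Dominated T U) :
    Dominated S U := by
  obtain ⟨c₁, h₁⟩ := h₁
  obtain ⟨c₂, h₂⟩ := h₂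
  exact ⟨c₁.trans c₂, fun i => (h₁ i).trans (h₂ (Fin.castLE c₁ i))⟩

theorem Dominated.antisymm {S T : Finset ℕ} (h₁ : Dominated S T) (h₂ : Dominated T S) :
    S = T := by
  obtain ⟨c₁, h₁⟩ := h₁
  obtain ⟨c₂, h₂⟩ := h₂
  have hc : S.card = T.card := le_antisymm c₁ c₂
  have key : ∀ i : Fin S.card,
      S.orderEmbOfFin rfl i = T.orderEmbOfFin rfl (Fin.cast hc i) := by
    intro i
    apply le_antisymm
    · have := h₁ (Fin.rev i)
      rw [Fin.rev_rev] at this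
      refine this.trans (le_of_eq (congrArg _ ?_))
      ext; simp [Fin.val_rev]; omega
    · have := h₂ (Fin.cast hc (Fin.rev i))
      refine le_trans (le_of_eq (congrArg _ ?_)) (this.trans (le_of_eq (congrArg _ ?_)))
      · ext; simp [Fin.val_rev]; omega
      · ext; simp [Fin.val_rev]; omega
  have hS := Finset.range_orderEmbOfFin S rfl
  have hT := Finset.range_orderEmbOfFin T rfl
  apply Finset.coe_injective
  rw [← hS, ← hT]
  ext x
  constructor
  · rintro ⟨i, rfl⟩
    exact ⟨_, (key i).symm⟩
  · rintro ⟨i, rfl⟩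
    exact ⟨Fin.cast hc.symm i, key _⟩

/-- The poset of Fibonacci sets of rank `N` under the dominance order. -/
instance (N : ℕ) : PartialOrder (FibSet N) where
  le S T := Dominated S.1 T.1
  le_refl S := Dominated.refl S.1
  le_trans _ _ _ h₁ h₂ := h₁.trans h₂
  le_antisymm _ _ h₁ h₂ := Subtype.ext (h₁.antisymm h₂)

/-! ### Okada arc-diagrams and half arc-diagrams -/

/-- The `2N` boundary nodes: `Sum.inl a` is the left node with number `a + 1`, and `Sum.inr a`
is the right (overlined) node with number `a + 1`. -/
abbrev Node (N : ℕ) : Type := Fin N ⊕ Fin N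

/-- The absolute value `1, ..., N` of a node. -/
def Node.abs {N : ℕ} : Node N → ℕ
  | Sum.inl a => a.val + 1
  | Sum.inr a => a.val + 1

/-- The position (from `1` to `2N`) of a node in the total order
`1 < 2 < ... < N < N̄ < ... < 2̄ < 1̄`. -/
def Node.pos {N : ℕ} : Node N → ℕ
  | Sum.inl a => a.val + 1
  | Sum.inr a => 2 * N - a.val

/-- An Okada arc-diagram of rank `N`: a non-crossing perfect matching of the nodes, given by the
fixed-point-free involution `mate`, with a height label on each arc. The label of the arc
`{u, mate u}` is `height u = height (mate u)`. -/
@[ext]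
structure ArcDiagram (N : ℕ) where
  mate : Node N → Node N
  height : Node N → ℕ
  mate_mate : ∀ u, mate (mate u) = u
  mate_ne : ∀ u, mate u ≠ u
  noncrossing : ∀ u v,
    ¬ (u.pos < v.pos ∧ v.pos < (mate u).pos ∧ (mate u).pos < (mate v).pos)
  height_mate : ∀ u, height (mate u) = height u
  one_le_height : ∀ u, 1 ≤ height u
  height_le : ∀ u, height u ≤ min u.abs (mate u).abs
  height_parity : ∀ u, height u % 2 = min u.abs (mate u).abs % 2
  height_nested : ∀ u v, v.pos < u.pos → u.pos < (mate u).pos → (mate u).pos < (mate v).pos →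
    height v < height u

/-- An Okada half arc-diagram of rank `N` on the nodes `1, ..., N` (node number `a + 1` is
`a : Fin N`). A full arc joins `a` and `mate a ≠ a`; the nodes with `mate a = a` are the ends of
the half arcs (propagating arcs), whose other end is free. A half arc cannot start below a full
arc, and all the arcs above a half arc are nested in it. -/
@[ext]
structure HalfDiagram (N : ℕ) where
  mate : Fin N → Fin N
  height : Fin N → ℕ
  mate_mate : ∀ a, mate (mate a) = a
  noncrossing : ∀ a b, ¬ (a < b ∧ b < mate a ∧ mate a < mate b)
  noncrossing_half : ∀ a c, mate c = c → ¬ (a < c ∧ c < mate a)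
  height_mate : ∀ a, height (mate a) = height a
  one_le_height : ∀ a, 1 ≤ height a
  height_le : ∀ a, height a ≤ min a.val (mate a).val + 1
  height_parity : ∀ a, height a % 2 = (min a.val (mate a).val + 1) % 2
  height_nested : ∀ a c, c < a → a < mate a → mate a < mate c → height c < height a
  height_nested_half : ∀ a c, mate c = c → c < a → height c < height a

/-- The propagating label set: the labels of the propagating arcs. -/
def HalfDiagram.propLab {N : ℕ} (H : HalfDiagram N) : Finset ℕ :=
  (Finset.univ.filter fun a => H.mate a = a).image H.height

/-- The half diagrams of rank `N` with propagating label set `S`. -/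
def HalfDiagramWith {N : ℕ} (S : FibSet N) : Type :=
  {H : HalfDiagram N // H.propLab = S.1}

/-- Propagating arcs of a half diagram with the same label are equal. -/
theorem HalfDiagram.half_unique {N : ℕ} (H : HalfDiagram N) {a b : Fin N}
    (ha : H.mate a = a) (hb : H.mate b = b) (h : H.height a = H.height b) : a = b := by
  rcases lt_trichotomy a b with hab | hab | hab
  · have := H.height_nested_half b a ha hab; omega
  · exact hab
  · have := H.height_nested_half a b hb hab; omega

theorem HalfDiagram.exists_partner {N : ℕ} {L R : HalfDiagram N} (h : L.propLab = R.propLab)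
    {a : Fin N} (ha : L.mate a = a) : ∃ b, R.mate b = b ∧ R.height b = L.height a := by
  have : L.height a ∈ R.propLab := by
    rw [← h]
    exact Finset.mem_image.2 ⟨a, by simpa using ha, rfl⟩
  obtain ⟨b, hb, hb'⟩ := Finset.mem_image.1 this
  exact ⟨b, by simpa using hb, hb'⟩

open Classical in
/-- The node of `R` at the propagating arc with the same label as the propagating arc of `L`
at `a`. -/
noncomputable def HalfDiagram.partner {N : ℕ} (L R : HalfDiagram N) (a : Fin N) : Fin N :=
  if h : ∃ b, R.mate b = b ∧ R.height b = L.height a then h.choose else a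

theorem HalfDiagram.partner_spec {N : ℕ} {L R : HalfDiagram N} (h : L.propLab = R.propLab)
    {a : Fin N} (ha : L.mate a = a) :
    R.mate (L.partner R a) = L.partner R a ∧ R.height (L.partner R a) = L.height a := by
  have := HalfDiagram.exists_partner h ha
  rw [HalfDiagram.partner, dif_pos this]
  exact this.choose_spec

/-- The matching of the glued diagram `L ⋈ R`: full arcs of `L` and of `R` are kept on the left
and on the right, and the propagating arcs with equal labels are joined. -/
noncomputable def glueMate {N : ℕ} (L R : HalfDiagram N) : Node N → Node N
  | Sum.inl a => if L.mate a = a then Sum.inr (L.partner R a) else Sum.inl (L.mate a)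
  | Sum.inr b => if R.mate b = b then Sum.inl (R.partner L b) else Sum.inr (R.mate b)

/-- The labels of the glued diagram `L ⋈ R`. -/
def glueHeight {N : ℕ} (L R : HalfDiagram N) : Node N → ℕ
  | Sum.inl a => L.height a
  | Sum.inr b => R.height b

theorem glueMate_inl_half {N : ℕ} {L : HalfDiagram N} (R : HalfDiagram N) {a : Fin N}
    (ha : L.mate a = a) : glueMate L R (Sum.inl a) = Sum.inr (L.partner R a) := by
  simp [glueMate, ha]

theorem glueMate_inl_full {N : ℕ} {L : HalfDiagram N} (R : HalfDiagram N) {a : Fin N}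
    (ha : L.mate a ≠ a) : glueMate L R (Sum.inl a) = Sum.inl (L.mate a) := by
  simp [glueMate, ha]

theorem glueMate_inr_half {N : ℕ} (L : HalfDiagram N) {R : HalfDiagram N} {a : Fin N}
    (ha : R.mate a = a) : glueMate L R (Sum.inr a) = Sum.inl (R.partner L a) := by
  simp [glueMate, ha]

theorem glueMate_inr_full {N : ℕ} (L : HalfDiagram N) {R : HalfDiagram N} {a : Fin N}
    (ha : R.mate a ≠ a) : glueMate L R (Sum.inr a) = Sum.inr (R.mate a) := by
  simp [glueMate, ha]

/-- The glued diagram `L ⋈ R`: the unique Okada arc-diagram with left half `L` and right half `R`,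
for half diagrams `L` and `R` with the same propagating label set. -/
noncomputable def glue {N : ℕ} (L R : HalfDiagram N) (h : L.propLab = R.propLab) :
    ArcDiagram N where
  mate := glueMate L R
  height := glueHeight L R
  mate_mate := by
    rintro (a | a)
    · by_cases ha : L.mate a = a
      · obtain ⟨p, q⟩ := HalfDiagram.partner_spec h ha
        obtain ⟨p', q'⟩ := HalfDiagram.partner_spec h.symm p
        rw [glueMate_inl_half R ha, glueMate_inr_half L p,
          L.half_unique p' ha (q'.trans q)]
      · have ha' : L.mate (L.mate a) ≠ L.mate a := by rw [L.mate_mate]; exact Ne.symm ha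
        rw [glueMate_inl_full R ha, glueMate_inl_full R ha', L.mate_mate]
    · by_cases ha : R.mate a = a
      · obtain ⟨p, q⟩ := HalfDiagram.partner_spec h.symm ha
        obtain ⟨p', q'⟩ := HalfDiagram.partner_spec h p
        rw [glueMate_inr_half L ha, glueMate_inl_half R p,
          R.half_unique p' ha (q'.trans q)]
      · have ha' : R.mate (R.mate a) ≠ R.mate a := by rw [R.mate_mate]; exact Ne.symm ha
        rw [glueMate_inr_full L ha, glueMate_inr_full L ha', R.mate_mate]
  mate_ne := by
    rintro (a | a) e
    · by_cases ha : L.mate a = a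
      · rw [glueMate_inl_half R ha] at e; cases e
      · rw [glueMate_inl_full R ha] at e; exact ha (Sum.inl.inj e)
    · by_cases ha : R.mate a = a
      · rw [glueMate_inr_half L ha] at e; cases e
      · rw [glueMate_inr_full L ha] at e; exact ha (Sum.inr.inj e)
  noncrossing := by
    rintro (a | a) (b | b) ⟨h1, h2, h3⟩
    · by_cases ha : L.mate a = a <;> by_cases hb : L.mate b = b
      · obtain ⟨p, q⟩ := HalfDiagram.partner_spec h ha
        obtain ⟨p', q'⟩ := HalfDiagram.partner_spec h hb
        rw [glueMate_inl_half R ha, glueMate_inl_half R hb] at h3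
        simp only [Node.pos] at h1 h3
        have l1 := L.height_nested_half b a ha (by rw [Fin.lt_def]; omega)
        have l2 := R.height_nested_half (L.partner R a) (L.partner R b) p'
          (by rw [Fin.lt_def]; omega)
        omega
      · rw [glueMate_inl_half R ha, glueMate_inl_full R hb] at h3
        simp only [Node.pos] at h3
        omega
      · rw [glueMate_inl_full R ha] at h2
        simp only [Node.pos] at h1 h2
        exact L.noncrossing_half a b hb ⟨by rw [Fin.lt_def]; omega, by rw [Fin.lt_def]; omega⟩
      · rw [glueMate_inl_full R ha] at h2 h3
        rw [glueMate_inl_full R hb] at h3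
        simp only [Node.pos] at h1 h2 h3
        exact L.noncrossing a b ⟨by rw [Fin.lt_def]; omega, by rw [Fin.lt_def]; omega,
          by rw [Fin.lt_def]; omega⟩
    · by_cases ha : L.mate a = a <;> by_cases hb : R.mate b = b
      · rw [glueMate_inl_half R ha, glueMate_inr_half L hb] at h3
        simp only [Node.pos] at h3
        omega
      · obtain ⟨p, q⟩ := HalfDiagram.partner_spec h ha
        rw [glueMate_inl_half R ha] at h2 h3
        rw [glueMate_inr_full L hb] at h3
        simp only [Node.pos] at h2 h3
        refine R.noncrossing_half (R.mate b) (L.partner R a) p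
          ⟨by rw [Fin.lt_def]; omega, ?_⟩
        rw [R.mate_mate, Fin.lt_def]; omega
      · rw [glueMate_inl_full R ha] at h2
        simp only [Node.pos] at h2
        omega
      · rw [glueMate_inl_full R ha] at h2
        simp only [Node.pos] at h2
        omega
    · simp only [Node.pos] at h1
      omega
    · by_cases ha : R.mate a = a
      · rw [glueMate_inr_half L ha] at h2
        simp only [Node.pos] at h2
        omega
      · by_cases hb : R.mate b = b
        · rw [glueMate_inr_full L ha, glueMate_inr_half L hb] at h3
          simp only [Node.pos] at h3
          omega
        · rw [glueMate_inr_full L ha] at h2 h3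
          rw [glueMate_inr_full L hb] at h3
          simp only [Node.pos] at h1 h2 h3
          refine R.noncrossing (R.mate b) (R.mate a) ⟨by rw [Fin.lt_def]; omega, ?_, ?_⟩
          · rw [R.mate_mate, Fin.lt_def]; omega
          · rw [R.mate_mate, R.mate_mate, Fin.lt_def]; omega
  height_mate := by
    rintro (a | a)
    · by_cases ha : L.mate a = a
      · rw [glueMate_inl_half R ha]; exact (HalfDiagram.partner_spec h ha).2
      · rw [glueMate_inl_full R ha]; exact L.height_mate a
    · by_cases ha : R.mate a = a
      · rw [glueMate_inr_half L ha]; exact (HalfDiagram.partner_spec h.symm ha).2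
      · rw [glueMate_inr_full L ha]; exact R.height_mate a
  one_le_height := by
    rintro (a | a)
    · exact L.one_le_height a
    · exact R.one_le_height a
  height_le := by
    rintro (a | a)
    · have l := L.height_le a
      by_cases ha : L.mate a = a
      · obtain ⟨p, q⟩ := HalfDiagram.partner_spec h ha
        have r := R.height_le (L.partner R a)
        rw [glueMate_inl_half R ha]
        rw [ha] at l
        rw [p] at r
        simp only [glueHeight, Node.abs]
        omega
      · rw [glueMate_inl_full R ha]
        simp only [glueHeight, Node.abs]
        omega
    · have l := R.height_le a
      by_cases ha : R.mate a = a
      · obtain ⟨p, q⟩ := HalfDiagram.partner_spec h.symm ha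
        have r := L.height_le (R.partner L a)
        rw [glueMate_inr_half L ha]
        rw [ha] at l
        rw [p] at r
        simp only [glueHeight, Node.abs]
        omega
      · rw [glueMate_inr_full L ha]
        simp only [glueHeight, Node.abs]
        omega
  height_parity := by
    rintro (a | a)
    · have l := L.height_parity a
      by_cases ha : L.mate a = a
      · obtain ⟨p, q⟩ := HalfDiagram.partner_spec h ha
        have r := R.height_parity (L.partner R a)
        rw [glueMate_inl_half R ha]
        rw [ha] at l
        rw [p] at r
        simp only [glueHeight, Node.abs]
        omega
      · rw [glueMate_inl_full R ha]
        simp only [glueHeight, Node.abs]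
        omega
    · have l := R.height_parity a
      by_cases ha : R.mate a = a
      · obtain ⟨p, q⟩ := HalfDiagram.partner_spec h.symm ha
        have r := L.height_parity (R.partner L a)
        rw [glueMate_inr_half L ha]
        rw [ha] at l
        rw [p] at r
        simp only [glueHeight, Node.abs]
        omega
      · rw [glueMate_inr_full L ha]
        simp only [glueHeight, Node.abs]
        omega
  height_nested := by
    rintro (a | a) (c | c) h1 h2 h3
    · by_cases hc : L.mate c = c
      · simp only [Node.pos] at h1
        exact L.height_nested_half a c hc (by rw [Fin.lt_def]; omega)
      · rw [glueMate_inl_full R hc] at h3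
        by_cases ha : L.mate a = a
        · rw [glueMate_inl_half R ha] at h3
          simp only [Node.pos] at h3
          omega
        · rw [glueMate_inl_full R ha] at h2 h3
          simp only [Node.pos] at h1 h2 h3
          exact L.height_nested a c (by rw [Fin.lt_def]; omega) (by rw [Fin.lt_def]; omega)
            (by rw [Fin.lt_def]; omega)
    · simp only [Node.pos] at h1
      omega
    · by_cases ha : R.mate a = a
      · rw [glueMate_inr_half L ha] at h2
        simp only [Node.pos] at h2
        omega
      · rw [glueMate_inr_full L ha] at h2 h3
        by_cases hc : L.mate c = c
        · obtain ⟨p, q⟩ := HalfDiagram.partner_spec h hc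
          rw [glueMate_inl_half R hc] at h3
          simp only [Node.pos] at h2 h3
          have := R.height_nested_half a (L.partner R c) p (by rw [Fin.lt_def]; omega)
          simp only [glueHeight]
          omega
        · rw [glueMate_inl_full R hc] at h3
          simp only [Node.pos] at h3
          omega
    · by_cases ha : R.mate a = a
      · rw [glueMate_inr_half L ha] at h2
        simp only [Node.pos] at h2
        omega
      · rw [glueMate_inr_full L ha] at h2 h3
        by_cases hc : R.mate c = c
        · rw [glueMate_inr_half L hc] at h3
          simp only [Node.pos] at h3
          omega
        · rw [glueMate_inr_full L hc] at h3
          simp only [Node.pos] at h1 h2 h3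
          have := R.height_nested (R.mate a) (R.mate c) (by rw [Fin.lt_def]; omega)
            (by rw [R.mate_mate, Fin.lt_def]; omega)
            (by rw [R.mate_mate, R.mate_mate, Fin.lt_def]; omega)
          rw [R.height_mate, R.height_mate] at this
          exact this

theorem Node.abs_swap {N : ℕ} (u : Node N) : Node.abs u.swap = u.abs := by
  cases u <;> rfl

theorem Node.pos_swap {N : ℕ} (u : Node N) : Node.pos u.swap + u.pos = 2 * N + 1 := by
  rcases u with a | a <;> simp only [Sum.swap_inl, Sum.swap_inr, Node.pos] <;> omega

/-- The mirror `D⋆` of an Okada arc-diagram, obtained by exchanging left and right. -/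
def ArcDiagram.mirror {N : ℕ} (D : ArcDiagram N) : ArcDiagram N where
  mate u := (D.mate u.swap).swap
  height u := D.height u.swap
  mate_mate u := by simp [D.mate_mate]
  mate_ne u h := D.mate_ne u.swap (by rw [← Sum.swap_swap (D.mate u.swap), h])
  noncrossing := by
    rintro u v ⟨h1, h2, h3⟩
    have e1 := Node.pos_swap u
    have e2 := Node.pos_swap v
    have e3 := Node.pos_swap (D.mate u.swap)
    have e4 := Node.pos_swap (D.mate v.swap)
    refine D.noncrossing (D.mate v.swap) (D.mate u.swap) ⟨by omega, ?_, ?_⟩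
    · rw [D.mate_mate]; omega
    · rw [D.mate_mate, D.mate_mate]; omega
  height_mate u := by simp [D.height_mate]
  one_le_height u := D.one_le_height _
  height_le u := by
    have := D.height_le u.swap
    rwa [Node.abs_swap, ← Node.abs_swap (D.mate u.swap)] at this
  height_parity u := by
    have := D.height_parity u.swap
    rwa [Node.abs_swap, ← Node.abs_swap (D.mate u.swap)] at this
  height_nested := by
    intro u v h1 h2 h3
    have e1 := Node.pos_swap u
    have e2 := Node.pos_swap v
    have e3 := Node.pos_swap (D.mate u.swap)
    have e4 := Node.pos_swap (D.mate v.swap)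
    have := D.height_nested (D.mate u.swap) (D.mate v.swap) (by omega)
      (by rw [D.mate_mate]; omega) (by rw [D.mate_mate, D.mate_mate]; omega)
    rwa [D.height_mate, D.height_mate] at this

/-! ### Composition of diagrams -/

/-- The indices `1, ..., N - 1` of the generators. -/
abbrev GenIdx (N : ℕ) : Type := {i : ℕ // 1 ≤ i ∧ i < N}

/-- The identity diagram: the arcs `{a, ā}` with label `a`. -/
def ArcDiagram.id (N : ℕ) : ArcDiagram N where
  mate u := u.swap
  height u := u.abs
  mate_mate u := by simp
  mate_ne u := by cases u <;> simp
  noncrossing := by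
    rintro u v ⟨h1, h2, h3⟩
    have e1 := Node.pos_swap u
    have e2 := Node.pos_swap v
    omega
  height_mate u := by cases u <;> simp [Node.abs]
  one_le_height u := by cases u <;> simp [Node.abs]
  height_le u := by cases u <;> simp [Node.abs]
  height_parity u := by cases u <;> simp [Node.abs]
  height_nested := by
    rintro (a | a) (c | c) h1 h2 h3 <;>
      simp only [Node.pos, Node.abs, Sum.swap_inl, Sum.swap_inr] at * <;> omega

/-- The transposition of the consecutive numbers `i` and `i + 1` (in `1, ..., N`). -/
def elemSwap {N : ℕ} (i : GenIdx N) (a : Fin N) : Fin N :=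
  if a.val + 1 = i.1 then ⟨i.1, i.2.2⟩
  else if a.val = i.1 then ⟨i.1 - 1, by have := i.2; omega⟩
  else a

/-- The matching of the elementary diagram `G_i`. -/
def elemMate {N : ℕ} (i : GenIdx N) : Node N → Node N
  | Sum.inl a => if a.val + 1 = i.1 ∨ a.val = i.1 then Sum.inl (elemSwap i a) else Sum.inr a
  | Sum.inr a => if a.val + 1 = i.1 ∨ a.val = i.1 then Sum.inr (elemSwap i a) else Sum.inl a

/-- The arcs of the elementary diagram, case by case. -/
theorem elemMate_cases {N : ℕ} (i : GenIdx N) (u : Node N) :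
    (u.abs = i.1 ∧ (elemMate i u).abs = i.1 + 1 ∧ (elemMate i u).isLeft = u.isLeft) ∨
    (u.abs = i.1 + 1 ∧ (elemMate i u).abs = i.1 ∧ (elemMate i u).isLeft = u.isLeft) ∨
    (u.abs ≠ i.1 ∧ u.abs ≠ i.1 + 1 ∧ (elemMate i u).abs = u.abs ∧
      (elemMate i u).isLeft = !u.isLeft) := by
  have hi := i.2
  rcases u with a | a
  all_goals
    by_cases h1 : a.val + 1 = i.1
    · left; simp [elemMate, elemSwap, Node.abs, h1]
    · by_cases h2 : a.val = i.1
      · right; left; simp [elemMate, elemSwap, Node.abs, h2]; omega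
      · right; right; simp [elemMate, Node.abs, h1, h2]

theorem Node.pos_cases {N : ℕ} (u : Node N) : 1 ≤ u.abs ∧ u.abs ≤ N ∧
    ((u.isLeft = true ∧ u.pos = u.abs) ∨ (u.isLeft = false ∧ u.pos + u.abs = 2 * N + 1)) := by
  rcases u with a | a
  · simp [Node.abs, Node.pos]
  · simp [Node.abs, Node.pos]
    omega

theorem Node.ext_abs {N : ℕ} {u v : Node N} (h : u.abs = v.abs) (h' : u.isLeft = v.isLeft) :
    u = v := by
  rcases u with a | a <;> rcases v with b | b <;> simp_all [Node.abs, Fin.ext_iff]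

/-- The elementary diagram `G_i`: the arcs `{i, i+1}` and its mirror with label `i`, and the arcs
`{j, j̄}` with label `j` for `j ≠ i, i + 1`. -/
def ArcDiagram.elem {N : ℕ} (i : GenIdx N) : ArcDiagram N where
  mate := elemMate i
  height u := if u.abs = i.1 + 1 then i.1 else u.abs
  mate_mate u := by
    have h1 := elemMate_cases i u
    have h2 := elemMate_cases i (elemMate i u)
    apply Node.ext_abs
    · grind
    · grind
  mate_ne u h := by
    have h1 := elemMate_cases i u
    rw [h] at h1
    grind
  noncrossing := by
    rintro u v ⟨h1, h2, h3⟩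
    have a1 := elemMate_cases i u
    have a2 := elemMate_cases i v
    have b1 := Node.pos_cases u
    have b2 := Node.pos_cases v
    have b3 := Node.pos_cases (elemMate i u)
    have b4 := Node.pos_cases (elemMate i v)
    grind
  height_mate u := by
    have h1 := elemMate_cases i u
    grind
  one_le_height u := by
    have := Node.pos_cases u
    have := i.2
    grind
  height_le u := by
    have h1 := elemMate_cases i u
    grind
  height_parity u := by
    have h1 := elemMate_cases i u
    grind
  height_nested := by
    intro u v h1 h2 h3
    have a1 := elemMate_cases i u
    have a2 := elemMate_cases i v
    have b1 := Node.pos_cases u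
    have b2 := Node.pos_cases v
    have b3 := Node.pos_cases (elemMate i u)
    have b4 := Node.pos_cases (elemMate i v)
    grind

/-- Nodes of the concatenation of two diagrams, in a left, a middle and a right column
(`0`, `1` and `2`). -/
abbrev CNode (N : ℕ) : Type := Fin 3 × Fin N

/-- Nodes of the first diagram: its right boundary is the middle column. -/
def firstNode {N : ℕ} : Node N → CNode N
  | Sum.inl a => (0, a)
  | Sum.inr a => (1, a)

/-- Nodes of the second diagram: its left boundary is the middle column. -/
def secondNode {N : ℕ} : Node N → CNode N
  | Sum.inl a => (1, a)
  | Sum.inr a => (2, a)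

/-- Nodes of the composition: the outer columns. -/
def outerNode {N : ℕ} : Node N → CNode N
  | Sum.inl a => (0, a)
  | Sum.inr a => (2, a)

/-- `p` and `q` are the ends of an arc of `C` or of `D` in the concatenation. -/
def ArcStep {N : ℕ} (C D : ArcDiagram N) (p q : CNode N) : Prop :=
  (∃ u, p = firstNode u ∧ q = firstNode (C.mate u)) ∨
    (∃ u, p = secondNode u ∧ q = secondNode (D.mate u))

/-- `p` and `q` lie on the same concatenated arc. -/
def Joined {N : ℕ} (C D : ArcDiagram N) : CNode N → CNode N → Prop :=
  Relation.ReflTransGen (ArcStep C D)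

/-- `E = [C ∘ D]`: the arcs of `E` are the arcs of the concatenation that end on the outer
boundary (so that loops are removed), and the label of an arc is the minimum of the labels
of the arc fragments of `C` and `D` which comprise it. -/
def IsComposition {N : ℕ} (C D E : ArcDiagram N) : Prop :=
  (∀ u, Joined C D (outerNode u) (outerNode (E.mate u))) ∧
    ∀ u, IsLeast
      ({h | ∃ v, Joined C D (outerNode u) (firstNode v) ∧ h = C.height v} ∪
        {h | ∃ v, Joined C D (outerNode u) (secondNode v) ∧ h = D.height v})
      (E.height u)

/-- `D` is the composition `[G_{i_1} ∘ (G_{i_2} ∘ (... ∘ G_{i_l}))]` of elementary diagrams along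
the word `i_1 i_2 ... i_l`. -/
inductive IsWordDiagram {N : ℕ} : List (GenIdx N) → ArcDiagram N → Prop
  | nil : IsWordDiagram [] (ArcDiagram.id N)
  | cons (i : GenIdx N) (w : List (GenIdx N)) (D E : ArcDiagram N) :
      IsWordDiagram w D → IsComposition (ArcDiagram.elem i) D E → IsWordDiagram (i :: w) E

/-! ### The Okada algebra and its basis -/

section Algebra

variable (K : Type*) [Field K] (N : ℕ) (X Y : ℕ → K)

/-- The defining relations of the Okada algebra on the free algebra with generators
`E_1, ..., E_{N-1}`. Only the values `X i` for `1 ≤ i ≤ N - 1` and `Y i` for `1 ≤ i ≤ N - 2`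
are used. -/
inductive OkadaRel : FreeAlgebra K (GenIdx N) → FreeAlgebra K (GenIdx N) → Prop
  | idem (i : GenIdx N) :
      OkadaRel (FreeAlgebra.ι K i * FreeAlgebra.ι K i) (X i.1 • FreeAlgebra.ι K i)
  | comm (i j : GenIdx N) (h : i.1 + 2 ≤ j.1 ∨ j.1 + 2 ≤ i.1) :
      OkadaRel (FreeAlgebra.ι K i * FreeAlgebra.ι K j) (FreeAlgebra.ι K j * FreeAlgebra.ι K i)
  | succ (i j : GenIdx N) (h : j.1 = i.1 + 1) :
      OkadaRel (FreeAlgebra.ι K j * FreeAlgebra.ι K i * FreeAlgebra.ι K j)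
        (Y i.1 • FreeAlgebra.ι K j)

/-- The Okada algebra `O_N(X, Y)`. -/
abbrev OkadaAlgebra : Type _ := RingQuot (OkadaRel K N X Y)

end Algebra

/-- The entry of the code of `σ` at `i`: the number of `j < i` with `σ⁻¹ j > σ⁻¹ i`. -/
def codeAt {N : ℕ} (σ : Equiv.Perm (Fin N)) (i : Fin N) : ℕ :=
  (Finset.univ.filter fun j : Fin N => j < i ∧ σ⁻¹ i < σ⁻¹ j).card

theorem codeAt_le {N : ℕ} (σ : Equiv.Perm (Fin N)) (i : Fin N) : codeAt σ i ≤ i.val := by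
  calc codeAt σ i ≤ (Finset.Iio i).card := by
        apply Finset.card_le_card
        intro j hj
        simp only [Finset.mem_filter] at hj
        exact Finset.mem_Iio.2 hj.2.1
    _ = i.val := Fin.card_Iio i

/-- The factor `(i-1), (i-2), ..., (i-c_i)` of the word of `σ`; here `i : Fin N` has
number `i + 1`. -/
def codeBlock {N : ℕ} (σ : Equiv.Perm (Fin N)) (i : Fin N) : List (GenIdx N) :=
  List.ofFn fun t : Fin (codeAt σ i) =>
    (⟨i.val - t.val, by have := codeAt_le σ i; have := t.2; have := i.2; omega⟩ : GenIdx N)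

/-- The word `∏_{i=1}^N (i-1)(i-2)...(i-c_i)` of `σ`, where `(c_1, ..., c_N)` is the code of `σ`. -/
def permWord {N : ℕ} (σ : Equiv.Perm (Fin N)) : List (GenIdx N) :=
  (List.finRange N).flatMap (codeBlock σ)

/-- The element `E_σ` of the Okada algebra. -/
def permElt {K : Type*} [Field K] {N : ℕ} (X Y : ℕ → K) (σ : Equiv.Perm (Fin N)) :
    OkadaAlgebra K N X Y :=
  ((permWord σ).map fun i => RingQuot.mkAlgHom K (OkadaRel K N X Y) (FreeAlgebra.ι K i)).prod

open Classical in
/-- The element of `O_N(X, Y)` identified with the arc-diagram `D`: it is `E_σ`, where `σ` is the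
(unique) permutation for which the composition of elementary diagrams along the word of `σ`
is `D`. -/
noncomputable def diagramElt {K : Type*} [Field K] {N : ℕ} (X Y : ℕ → K) (D : ArcDiagram N) :
    OkadaAlgebra K N X Y :=
  if h : ∃ σ : Equiv.Perm (Fin N), IsWordDiagram (permWord σ) D then permElt X Y h.choose else 0

/-! ### Cellular algebras -/

/-- `(Λ, M, C, star)` is a cell datum, in the sense of Graham and Lehrer, of the
finite-dimensional associative unital algebra `A`. -/
structure IsCellDatum {K A Λ : Type*} [CommRing K] [Ring A] [Algebra K A] [PartialOrder Λ]
    (M : Λ → Type*) (C : ∀ S : Λ, M S → M S → A) (star : A →ₗ[K] A) : Prop where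
  finite_dimensional : Module.Finite K A
  finite_index : ∀ S, Finite (M S)
  injective : Function.Injective fun p : (Σ S : Λ, M S × M S) => C p.1 p.2.1 p.2.2
  linearIndependent : LinearIndependent K fun p : (Σ S : Λ, M S × M S) => C p.1 p.2.1 p.2.2
  span_eq_top :
    Submodule.span K (Set.range fun p : (Σ S : Λ, M S × M S) => C p.1 p.2.1 p.2.2) = ⊤
  star_mul : ∀ a b, star (a * b) = star b * star a
  star_star : ∀ a, star (star a) = a
  star_basis : ∀ (S : Λ) (L R : M S), star (C S L R) = C S R L
  mul_basis : ∀ (S : Λ) (a : A), ∃ r : M S → M S → K, ∀ L R : M S,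
    a * C S L R - ∑ᶠ L' : M S, r L' L • C S L' R ∈
      Submodule.span K {c : A | ∃ T : Λ, T < S ∧ ∃ P Q : M T, c = C T P Q}

end Okada

/-! The algebra is compared with a candidate for its regular representation. Composition with G_i is
a local surgery `act i`: the nodes i and i+1 are joined by an arc with label i, and their former
mates are joined by an arc whose label is the minimum of the two old ones. On the free module over
all diagrams, E_i is made to send D to `weight X Y i D` times `act i D`. If {i, i+1} is an arc of D
with label h, a loop disappears and the weight is x_h y_{h+1} y_{h+3} ⋯ y_{i-1}; otherwise, with m
the larger of the labels at i and i+1, the weight is y_m y_{m+2} ⋯ y_{i-1}. Parity of the labels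
makes these products end at the right index (`act_arc_parity`). The surgeries satisfy the relations
without coefficients (`act_act_self`, `act_comm`, `act_act_act`), the weights supply the
coefficients (`weight_act_self`, `weight_comm`, `weight_braid`), so the algebra acts (`rep`), and
`vec a` is the result of applying `a` to the identity diagram.

Length is measured by `htSum`, the sum of the labels over all nodes. One generator lowers it by at
most 2, and when it lowers it by 2 the weight is 1. Hence `vec` sends a reduced word to its diagram
with coefficient 1 (`vec_wordProd_of_isReduced`).

Three facts then show that diagrams and permutations correspond and give a basis. The words of the
E_σ are reduced with pairwise different diagrams, because a length-lowering surgery can be undone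
(`act_injOn`, `towerAct_injective`). The E_σ span the algebra, by rewriting words to a normal form
(`mul_mem_towerSpan`). Every diagram comes from some reduced word, by repeatedly cutting an arc {i,
i+1} (`exists_reduced_word`); by spanning, its vector is a combination of the diagrams of the E_σ,
so the diagram is one of these. Consequently `vec` is injective and E_i D = weight · [G_i ∘ D] holds
inside the algebra (`gen_mul_diagramElt`).

The relations are invariant under reversal of words, which gives the anti-involution. It sends a
reduced word to the reversed word, which is again reduced and belongs to the mirrored diagram.

For cellularity, G_i operates on the left side only. The new left half and the weight depend on the
old left half alone (`leftHalf_act_congr`, `weight_congr`). The right half either survives or has a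
propagating arc closed off or lowered, and then the propagating label set drops strictly in
dominance (`propLab_act`). This settles the generators; general elements follow because coefficient
matrices multiply. -/

namespace Okada

/-! ### Joining two ends of a labelled matching -/

section Join

variable {α : Type*} [DecidableEq α]

/-- Join the ends `p` and `q` to each other, and their former mates to each other. -/
def joinMate (m : α → α) (p q u : α) : α :=
  if u = p then q else if u = q then p else
    if u = m p then m q else if u = m q then m p else m u

/-- The labels after joining `p` and `q` with the label `l`. -/
def joinHeight (m : α → α) (h : α → ℕ) (p q : α) (l : ℕ) (u : α) : ℕ :=
  if u = p then l else if u = q then l else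
    if u = m p then min (h p) (h q) else if u = m q then min (h p) (h q) else h u

theorem joinMate_cases (m : α → α) (p q u : α) :
    (u = p ∧ joinMate m p q u = q) ∨ (u ≠ p ∧ u = q ∧ joinMate m p q u = p) ∨
    (u ≠ p ∧ u ≠ q ∧ u = m p ∧ joinMate m p q u = m q) ∨
    (u ≠ p ∧ u ≠ q ∧ u ≠ m p ∧ u = m q ∧ joinMate m p q u = m p) ∨
    (u ≠ p ∧ u ≠ q ∧ u ≠ m p ∧ u ≠ m q ∧ joinMate m p q u = m u) := by
  unfold joinMate
  split_ifs <;> simp_all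

theorem joinHeight_cases (m : α → α) (h : α → ℕ) (p q : α) (l : ℕ) (u : α) :
    ((u = p ∨ u = q) ∧ joinHeight m h p q l u = l) ∨
    (u ≠ p ∧ u ≠ q ∧ (u = m p ∨ u = m q) ∧ joinHeight m h p q l u = min (h p) (h q)) ∨
    (u ≠ p ∧ u ≠ q ∧ u ≠ m p ∧ u ≠ m q ∧ joinHeight m h p q l u = h u) := by
  unfold joinHeight
  split_ifs <;> simp_all

theorem join_cases (m : α → α) (h : α → ℕ) (p q : α) (l : ℕ) (u : α) :
    (u = p ∧ joinMate m p q u = q ∧ joinHeight m h p q l u = l) ∨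
    (u = q ∧ u ≠ p ∧ joinMate m p q u = p ∧ joinHeight m h p q l u = l) ∨
    (u = m p ∧ u ≠ p ∧ u ≠ q ∧ joinMate m p q u = m q ∧
      joinHeight m h p q l u = min (h p) (h q)) ∨
    (u = m q ∧ u ≠ p ∧ u ≠ q ∧ u ≠ m p ∧ joinMate m p q u = m p ∧
      joinHeight m h p q l u = min (h p) (h q)) ∨
    (u ≠ p ∧ u ≠ q ∧ u ≠ m p ∧ u ≠ m q ∧ joinMate m p q u = m u ∧
      joinHeight m h p q l u = h u) := by
  unfold joinMate joinHeight
  split_ifs <;> simp_all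

theorem joinMate_involutive {m : α → α} (hm : ∀ u, m (m u) = u) (hne : ∀ u, m u ≠ u) {p q : α} (u : α) :
    joinMate m p q (joinMate m p q u) = u := by
  have := hm u
  have := hne u
  have := hm p
  have := hne p
  have := hm q
  have := hne q
  have := joinMate_cases m p q u
  have := joinMate_cases m p q (joinMate m p q u)
  grind

theorem joinMate_ne {m : α → α} (hm : ∀ u, m (m u) = u) (hne : ∀ u, m u ≠ u) {p q : α}
    (hpq : p ≠ q) (u : α) : joinMate m p q u ≠ u := by
  have := hm p
  have := hne p
  have := hm q
  have := hne q
  have := hne u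
  have := joinMate_cases m p q u
  grind

theorem joinHeight_mate {m : α → α} {h : α → ℕ} (hm : ∀ u, m (m u) = u) (hne : ∀ u, m u ≠ u)
    (hh : ∀ u, h (m u) = h u) {p q : α} {l : ℕ} (u : α) :
    joinHeight m h p q l (joinMate m p q u) = joinHeight m h p q l u := by
  have := hm p
  have := hne p
  have := hm q
  have := hne q
  have := hm u
  have := hne u
  have := hh u
  have := joinMate_cases m p q u
  have := joinHeight_cases m h p q l u
  have := joinHeight_cases m h p q l (joinMate m p q u)
  grind

/-- Serves both for two distant generators (`act_comm`) and for a left against a right composition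
(`act_mirror_act_mirror`). The four ends have to be distinct, but `m` may match them with one
another. -/
theorem joinMate_comm {m : α → α} (hm : ∀ u, m (m u) = u) (hne : ∀ u, m u ≠ u) {p q r s : α}
    (hpr : p ≠ r) (hps : p ≠ s) (hqr : q ≠ r) (hqs : q ≠ s) (hpq : p ≠ q) (hrs : r ≠ s) (u : α) :
    joinMate (joinMate m p q) r s u = joinMate (joinMate m r s) p q u := by
  have := hm p
  have := hne p
  have := hm q
  have := hne q
  have := hm r
  have := hne r
  have := hm s
  have := hne s
  have := hm u
  have := hne u
  have := joinMate_cases m p q u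
  have := joinMate_cases m p q r
  have := joinMate_cases m p q s
  have := joinMate_cases m r s u
  have := joinMate_cases m r s p
  have := joinMate_cases m r s q
  rcases joinMate_cases (joinMate m p q) r s u with h | h | h | h | h <;>
  rcases joinMate_cases (joinMate m r s) p q u with h' | h' | h' | h' | h' <;>
  grind

/-- Merging arcs takes minima over their fragments, and the order in which a path is put together
does not affect its minimum. -/
theorem joinHeight_comm {m : α → α} {h : α → ℕ} (hm : ∀ u, m (m u) = u) (hne : ∀ u, m u ≠ u)
    (hh : ∀ u, h (m u) = h u) {p q r s : α} {k l : ℕ}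
    (hpr : p ≠ r) (hps : p ≠ s) (hqr : q ≠ r) (hqs : q ≠ s) (hpq : p ≠ q) (hrs : r ≠ s) (u : α) :
    joinHeight (joinMate m p q) (joinHeight m h p q k) r s l u =
      joinHeight (joinMate m r s) (joinHeight m h r s l) p q k u := by
  have := hm p
  have := hne p
  have := hm q
  have := hne q
  have := hm r
  have := hne r
  have := hm s
  have := hne s
  have := hh p
  have := hh q
  have := hh r
  have := hh s
  have := joinMate_cases m p q r
  have := joinMate_cases m p q s
  have := joinMate_cases m r s p
  have := joinMate_cases m r s q
  have := joinHeight_cases m h p q k u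
  have := joinHeight_cases m h p q k r
  have := joinHeight_cases m h p q k s
  have := joinHeight_cases m h r s l u
  have := joinHeight_cases m h r s l p
  have := joinHeight_cases m h r s l q
  rcases joinHeight_cases (joinMate m p q) (joinHeight m h p q k) r s l u with h1 | h1 | h1 <;>
  rcases joinHeight_cases (joinMate m r s) (joinHeight m h r s l) p q k u with h2 | h2 | h2 <;>
  grind

theorem joinMate_map {β : Type*} [DecidableEq β] (e : α ≃ β) (m : α → α) (p q : α) (u : β) :
    e (joinMate m p q (e.symm u)) = joinMate (fun v => e (m (e.symm v))) (e p) (e q) u := by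
  unfold joinMate
  simp only [Equiv.symm_apply_eq, Equiv.symm_apply_apply]
  split_ifs <;> rfl

theorem joinHeight_map {β : Type*} [DecidableEq β] (e : α ≃ β) (m : α → α) (h : α → ℕ) (p q : α)
    (l : ℕ) (u : β) :
    joinHeight m h p q l (e.symm u) =
      joinHeight (fun v => e (m (e.symm v))) (fun v => h (e.symm v)) (e p) (e q) l u := by
  unfold joinHeight
  simp only [Equiv.symm_apply_eq, Equiv.symm_apply_apply]

end Join

end Okada

namespace Okada

/-! ### Positions of the nodes of an arc-diagram -/

theorem Node.pos_injective {N : ℕ} : Function.Injective (Node.pos : Node N → ℕ) := by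
  intro u v h
  have hu := Node.pos_cases u
  have hv := Node.pos_cases v
  apply Node.ext_abs
  · omega
  · rcases hu.2.2 with hu' | hu' <;> rcases hv.2.2 with hv' | hv' <;>
      first | omega | rw [hu'.1, hv'.1]

theorem Node.pos_ne {N : ℕ} {u v : Node N} (h : u ≠ v) : u.pos ≠ v.pos :=
  fun e => h (Node.pos_injective e)

theorem Node.pos_abs {N : ℕ} (u : Node N) : 1 ≤ u.pos ∧ u.pos ≤ 2 * N ∧
    ((u.pos ≤ N ∧ u.abs = u.pos) ∨ (N < u.pos ∧ u.abs + u.pos = 2 * N + 1)) := by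
  have := Node.pos_cases u
  omega

theorem Node.exists_pos {N k : ℕ} (h1 : 1 ≤ k) (h2 : k ≤ 2 * N) : ∃ u : Node N, u.pos = k := by
  by_cases h : k ≤ N
  · exact ⟨Sum.inl ⟨k - 1, by omega⟩, by simp only [Node.pos]; omega⟩
  · exact ⟨Sum.inr ⟨2 * N - k, by omega⟩, by simp only [Node.pos]; omega⟩

/-- Modulo 2 the ones of a pair cancel. -/
theorem even_card_of_involution {α : Type*} [DecidableEq α] (s : Finset α) (m : α → α)
    (hs : ∀ v ∈ s, m v ∈ s) (hm : ∀ v ∈ s, m (m v) = v) (hne : ∀ v ∈ s, m v ≠ v) :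
    Even s.card := by
  have : ∑ _v ∈ s, (1 : ZMod 2) = 0 :=
    Finset.sum_involution (fun v _ => m v) (fun _ _ => by decide) (fun v hv _ => hne v hv)
      (fun v hv => hs v hv) (fun v hv => hm v hv)
  rw [Finset.sum_const, nsmul_eq_mul, mul_one] at this
  exact (ZMod.natCast_eq_zero_iff_even).1 this

namespace ArcDiagram

variable {N : ℕ}

theorem mate_pos_ne (D : ArcDiagram N) (u : Node N) : (D.mate u).pos ≠ u.pos :=
  Node.pos_ne (D.mate_ne u)

theorem mate_injective (D : ArcDiagram N) : Function.Injective D.mate :=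
  Function.LeftInverse.injective D.mate_mate

/-- An arc which starts strictly below another arc also ends there. -/
theorem inside (D : ArcDiagram N) {u v : Node N} (h1 : u.pos < v.pos)
    (h2 : v.pos < (D.mate u).pos) :
    u.pos < (D.mate v).pos ∧ (D.mate v).pos < (D.mate u).pos := by
  have hne : D.mate v ≠ u := by
    rintro rfl
    rw [D.mate_mate] at h2
    omega
  have hne' : D.mate v ≠ D.mate u := fun e => by
    have := D.mate_injective e
    subst this
    omega
  have := Node.pos_ne hne
  have := Node.pos_ne hne'
  have c1 := D.noncrossing u v
  have c2 := D.noncrossing (D.mate v) u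
  rw [D.mate_mate] at c2
  omega

/-- The inequalities between the ends of two different arcs. -/
theorem arcs_cases (D : ArcDiagram N) {u v : Node N} (h : v ≠ u) (h' : v ≠ D.mate u) :
    v.pos ≠ u.pos ∧ v.pos ≠ (D.mate u).pos ∧ (D.mate v).pos ≠ u.pos ∧
    (D.mate v).pos ≠ (D.mate u).pos ∧
    (u.pos < v.pos ∧ v.pos < (D.mate u).pos →
      u.pos < (D.mate v).pos ∧ (D.mate v).pos < (D.mate u).pos) ∧
    ((D.mate u).pos < v.pos ∧ v.pos < u.pos →
      (D.mate u).pos < (D.mate v).pos ∧ (D.mate v).pos < u.pos) ∧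
    (u.pos < (D.mate v).pos ∧ (D.mate v).pos < (D.mate u).pos →
      u.pos < v.pos ∧ v.pos < (D.mate u).pos) ∧
    ((D.mate u).pos < (D.mate v).pos ∧ (D.mate v).pos < u.pos →
      (D.mate u).pos < v.pos ∧ v.pos < u.pos) := by
  refine ⟨Node.pos_ne h, Node.pos_ne h', Node.pos_ne ?_, Node.pos_ne ?_, ?_, ?_, ?_, ?_⟩
  · exact fun e => h' (by rw [← e, D.mate_mate])
  · exact fun e => h (D.mate_injective e)
  · exact fun ⟨a, b⟩ => D.inside a b
  · rintro ⟨a, b⟩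
    rw [← D.mate_mate u] at b
    have := D.inside a b
    rwa [D.mate_mate] at this
  · rintro ⟨a, b⟩
    have := D.inside a b
    rwa [D.mate_mate] at this
  · rintro ⟨a, b⟩
    rw [← D.mate_mate u] at b
    have := D.inside a b
    rwa [D.mate_mate, D.mate_mate] at this

theorem nested_lt (D : ArcDiagram N) {u v : Node N} (h1 : v.pos < u.pos)
    (h2 : u.pos < (D.mate v).pos) : D.height v < D.height u := by
  have h3 := D.inside h1 h2
  rcases lt_or_gt_of_ne (D.mate_pos_ne u) with h | h
  · have := D.height_nested (D.mate u) v h3.1 (by rwa [D.mate_mate]) (by rwa [D.mate_mate])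
    rwa [D.height_mate] at this
  · exact D.height_nested u v h1 h h3.2

/-- The labels of two different arcs which are nested. -/
theorem nested_cases (D : ArcDiagram N) (u v : Node N) :
    (v.pos < u.pos ∧ u.pos < (D.mate v).pos → D.height v < D.height u) ∧
    ((D.mate v).pos < u.pos ∧ u.pos < v.pos → D.height v < D.height u) := by
  refine ⟨fun ⟨a, b⟩ => D.nested_lt a b, fun ⟨a, b⟩ => ?_⟩
  have := D.nested_lt (v := D.mate v) a (by rwa [D.mate_mate])
  rwa [D.height_mate] at this

/-- An interval of positions which is a union of arcs has an even number of nodes. -/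
theorem even_of_closed (D : ArcDiagram N) {s t : ℕ} (hst : s < t) (ht : t ≤ 2 * N + 1)
    (h : ∀ u, s < u.pos → u.pos < t → s < (D.mate u).pos ∧ (D.mate u).pos < t) :
    (s + t) % 2 = 1 := by
  set S := Finset.univ.filter fun v : Node N => s < v.pos ∧ v.pos < t with hS
  have hev : Even S.card := by
    refine even_card_of_involution S D.mate (fun v hv => ?_) (fun v _ => D.mate_mate v)
      (fun v _ => D.mate_ne v)
    rw [hS, Finset.mem_filter] at hv ⊢
    exact ⟨Finset.mem_univ _, h v hv.2.1 hv.2.2⟩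
  have hcard : S.card = t - s - 1 := by
    rw [← Nat.card_Ioo, ← Finset.card_image_of_injective S Node.pos_injective]
    congr 1
    ext k
    simp only [Finset.mem_image, hS, Finset.mem_filter, Finset.mem_univ, true_and,
      Finset.mem_Ioo]
    constructor
    · rintro ⟨v, hv, rfl⟩
      exact hv
    · intro hk
      obtain ⟨v, rfl⟩ := Node.exists_pos (N := N) (k := k) (by omega) (by omega)
      exact ⟨v, hk, rfl⟩
  have := Nat.even_iff.1 hev
  omega

/-- The ends of an arc have positions of different parity. -/
theorem mate_parity (D : ArcDiagram N) (u : Node N) :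
    (u.pos + (D.mate u).pos) % 2 = 1 := by
  wlog h : u.pos < (D.mate u).pos generalizing u
  · have := this (D.mate u) (by rw [D.mate_mate]; have := D.mate_pos_ne u; omega)
    rw [D.mate_mate] at this
    omega
  exact D.even_of_closed h (by have := Node.pos_abs (D.mate u); omega) fun v => D.inside

end ArcDiagram

/-! ### Left composition with an elementary diagram -/

/-- The left node with number `i`. -/
def GenIdx.lo {N : ℕ} (i : GenIdx N) : Node N := Sum.inl ⟨i.1 - 1, by have := i.2; omega⟩

/-- The left node with number `i + 1`. -/
def GenIdx.hi {N : ℕ} (i : GenIdx N) : Node N := Sum.inl ⟨i.1, i.2.2⟩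

theorem GenIdx.pos_lo {N : ℕ} (i : GenIdx N) : (GenIdx.lo i).pos = i.1 := by
  have := i.2
  simp only [GenIdx.lo, Node.pos]; omega

theorem GenIdx.pos_hi {N : ℕ} (i : GenIdx N) : (GenIdx.hi i).pos = i.1 + 1 := by
  simp only [GenIdx.hi, Node.pos]

theorem GenIdx.lo_ne_hi {N : ℕ} (i : GenIdx N) : GenIdx.lo i ≠ GenIdx.hi i := fun e => by
  have := congrArg Node.pos e
  rw [GenIdx.pos_lo, GenIdx.pos_hi] at this
  omega

namespace ArcDiagram

variable {N : ℕ}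

theorem act_height_le (D : ArcDiagram N) (i : GenIdx N) (u : Node N) :
    joinHeight D.mate D.height (GenIdx.lo i) (GenIdx.hi i) i.1 u ≤ u.abs := by
  have l1 := GenIdx.pos_lo i
  have l2 := GenIdx.pos_hi i
  have hi := i.2
  have a1 := Node.pos_abs u
  have b1 := D.height_le (D.mate (GenIdx.lo i))
  have b2 := D.height_le (D.mate (GenIdx.hi i))
  have b3 := D.height_le u
  rw [D.height_mate] at b1 b2
  rcases joinHeight_cases D.mate D.height (GenIdx.lo i) (GenIdx.hi i) i.1 u with
    ⟨rfl | rfl, h⟩ | ⟨_, _, rfl | rfl, h⟩ | ⟨_, _, _, _, h⟩ <;> omega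

theorem height_le_pos (D : ArcDiagram N) (u : Node N) : D.height u ≤ u.pos ∧
    D.height u ≤ (D.mate u).pos := by
  have := D.height_le u
  have := Node.pos_abs u
  have := Node.pos_abs (D.mate u)
  omega

/-- The arc joining the former mates has the minimal label of its two fragments. An old arc around
it encloses both fragments, so its label is smaller than both; an old arc below it lies under at
least one fragment, so its label exceeds the minimum. An arc around {i, i+1} starts before i, which
bounds its label by i-1. -/
theorem act_height_nested (D : ArcDiagram N) (i : GenIdx N) (u v : Node N) (h1 : v.pos < u.pos)
    (h2 : u.pos < (joinMate D.mate (GenIdx.lo i) (GenIdx.hi i) u).pos)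
    (h3 : (joinMate D.mate (GenIdx.lo i) (GenIdx.hi i) u).pos <
      (joinMate D.mate (GenIdx.lo i) (GenIdx.hi i) v).pos) :
    joinHeight D.mate D.height (GenIdx.lo i) (GenIdx.hi i) i.1 v <
      joinHeight D.mate D.height (GenIdx.lo i) (GenIdx.hi i) i.1 u := by
  have l1 := GenIdx.pos_lo i
  have l2 := GenIdx.pos_hi i
  have l3 := GenIdx.lo_ne_hi i
  set p := GenIdx.lo i
  set q := GenIdx.hi i
  have hp := D.mate_mate p
  have hq := D.mate_mate q
  by_cases hpq : D.mate p = q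
  · have hpq' : D.mate q = p := by rw [← hpq, hp]
    rcases join_cases D.mate D.height p q i.1 v with
      ⟨rfl, hv, hv'⟩ | ⟨rfl, _, hv, hv'⟩ | ⟨rfl, _, _, hv, hv'⟩ | ⟨rfl, _, _, _, hv, hv'⟩ |
      ⟨v1, v2, v3, v4, hv, hv'⟩
    · rw [hv] at h3; omega
    · rw [hv] at h3; omega
    · contradiction
    · contradiction
    rw [hv] at h3
    rw [hv']
    have := D.height_le_pos v
    rcases join_cases D.mate D.height p q i.1 u with
      ⟨rfl, hu, hu'⟩ | ⟨rfl, _, hu, hu'⟩ | ⟨rfl, _, _, hu, hu'⟩ | ⟨rfl, _, _, _, hu, hu'⟩ |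
      ⟨u1, u2, u3, u4, hu, hu'⟩
    · rw [hu] at h2 h3; omega
    · rw [hu] at h2 h3; omega
    · contradiction
    · contradiction
    · rw [hu] at h2 h3
      rw [hu']
      exact D.height_nested u v h1 h2 h3
  · have f := D.arcs_cases (Ne.symm l3) (Ne.symm hpq)
    have b1 := D.height_le_pos p
    have b2 := D.height_le_pos q
    rcases join_cases D.mate D.height p q i.1 v with
      ⟨rfl, hv, hv'⟩ | ⟨rfl, _, hv, hv'⟩ | ⟨rfl, _, _, hv, hv'⟩ | ⟨rfl, _, _, _, hv, hv'⟩ |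
      ⟨v1, v2, v3, v4, hv, hv'⟩ <;> rw [hv] at h3 <;> rw [hv']
    · omega
    · omega
    · rcases join_cases D.mate D.height p q i.1 u with
        ⟨rfl, hu, hu'⟩ | ⟨rfl, _, hu, hu'⟩ | ⟨rfl, _, _, hu, hu'⟩ | ⟨rfl, _, _, _, hu, hu'⟩ |
        ⟨u1, u2, u3, u4, hu, hu'⟩ <;> rw [hu] at h2 h3 <;> rw [hu']
      · omega
      · omega
      · omega
      · omega
      · have n3 := D.nested_cases u p
        have n4 := D.nested_cases u q
        have g1 := Node.pos_ne u1
        have g2 := Node.pos_ne u2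
        omega
    · rcases join_cases D.mate D.height p q i.1 u with
        ⟨rfl, hu, hu'⟩ | ⟨rfl, _, hu, hu'⟩ | ⟨rfl, _, _, hu, hu'⟩ | ⟨rfl, _, _, _, hu, hu'⟩ |
        ⟨u1, u2, u3, u4, hu, hu'⟩ <;> rw [hu] at h2 h3 <;> rw [hu']
      · omega
      · omega
      · omega
      · omega
      · have n3 := D.nested_cases u p
        have n4 := D.nested_cases u q
        have g1 := Node.pos_ne u1
        have g2 := Node.pos_ne u2
        omega
    · have b3 := D.height_le_pos v
      rcases join_cases D.mate D.height p q i.1 u with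
        ⟨rfl, hu, hu'⟩ | ⟨rfl, _, hu, hu'⟩ | ⟨rfl, _, _, hu, hu'⟩ | ⟨rfl, _, _, _, hu, hu'⟩ |
        ⟨u1, u2, u3, u4, hu, hu'⟩ <;> rw [hu] at h2 h3 <;> rw [hu']
      · omega
      · omega
      · have n5 := D.nested_cases p v
        have n6 := D.nested_cases q v
        have g1 := D.arcs_cases v1 v3
        have g2 := D.arcs_cases v2 v4
        omega
      · have n5 := D.nested_cases p v
        have n6 := D.nested_cases q v
        have g1 := D.arcs_cases v1 v3
        have g2 := D.arcs_cases v2 v4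
        omega
      · exact D.height_nested u v h1 h2 h3

-- The ends of an arc have positions of opposite parity, so the parity of the label at i is fixed by
-- the side to which its arc goes, and likewise for i+1. If the arcs leave to different sides, both
-- labels are ≡ i+1; if to the same side, one arc encloses the other, and the inner one has the
-- larger label, ≡ i+1. The first conclusion makes the merged arc legal, the second makes the
-- product in `weight` start at an index of the right parity.
set_option maxHeartbeats 1000000 in
theorem act_arc_parity (D : ArcDiagram N) (i : GenIdx N)
    (h : D.mate (GenIdx.lo i) ≠ GenIdx.hi i) :
    min (D.height (GenIdx.lo i)) (D.height (GenIdx.hi i)) % 2 =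
      min (D.mate (GenIdx.lo i)).abs (D.mate (GenIdx.hi i)).abs % 2 ∧
    max (D.height (GenIdx.lo i)) (D.height (GenIdx.hi i)) % 2 = (i.1 + 1) % 2 := by
  have l1 := GenIdx.pos_lo i
  have l2 := GenIdx.pos_hi i
  have l3 := GenIdx.lo_ne_hi i
  set p := GenIdx.lo i
  set q := GenIdx.hi i
  have hi := i.2
  have p1 := D.height_parity p
  have p2 := D.height_parity q
  have m1 := D.mate_parity p
  have m2 := D.mate_parity q
  obtain ⟨f1, f2, f3, f4, f5, f6, f7, f8⟩ := D.arcs_cases (u := p) (v := q) l3.symm h.symm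
  have n1 := D.nested_cases p q
  have n2 := D.nested_cases q p
  have e1 : p.abs = i.1 := by have := Node.pos_abs p; omega
  have e2 : q.abs = i.1 + 1 := by have := Node.pos_abs q; omega
  rw [e1] at p1
  rw [e2] at p2
  obtain ⟨a1, a2, a3⟩ := Node.pos_abs (D.mate p)
  obtain ⟨a4, a5, a6⟩ := Node.pos_abs (D.mate q)
  have c1 : ((D.mate p).pos < i.1 ∧ D.height p % 2 = (i.1 + 1) % 2) ∨
      (i.1 + 1 < (D.mate p).pos ∧ D.height p % 2 = i.1 % 2) := by
    clear n1 n2 f4 f5 f6 f7 f8 a6 p2 m2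
    have := D.mate_pos_ne p
    omega
  have c2 : ((D.mate q).pos < i.1 ∧ D.height q % 2 = i.1 % 2) ∨
      (i.1 + 1 < (D.mate q).pos ∧ D.height q % 2 = (i.1 + 1) % 2) := by
    clear n1 n2 f4 f5 f6 f7 f8 a3 p1 m1 c1
    have := D.mate_pos_ne q
    omega
  clear p1 p2
  rcases c1 with ⟨c1, d1⟩ | ⟨c1, d1⟩ <;> rcases c2 with ⟨c2, d2⟩ | ⟨c2, d2⟩
  · have hpq : D.height q < D.height p := n1.2 ⟨by omega, by omega⟩
    have hba : (D.mate q).pos < (D.mate p).pos := by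
      by_contra hc
      have := f8 ⟨by omega, by omega⟩
      omega
    rw [min_eq_right hpq.le, max_eq_left hpq.le]
    clear n1 n2 f4 f5 f6 f7 f8
    rcases a3 with a3 | a3 <;> rcases a6 with a6 | a6 <;> omega
  · clear n1 n2 f1 f2 f3 f4 f5 f6 f7 f8
    have e3 : (D.mate p).abs = (D.mate p).pos := by omega
    have e4 : min (D.mate p).abs (D.mate q).abs % 2 = (i.1 + 1) % 2 := by
      rcases a6 with a6 | a6
      · rw [min_eq_left (by omega)]
        omega
      · rcases min_choice (D.mate p).abs (D.mate q).abs with h | h <;> rw [h] <;> omega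
    rw [e4]
    rcases min_choice (D.height p) (D.height q) with h | h <;>
    rcases max_choice (D.height p) (D.height q) with h' | h' <;> rw [h, h']
    · exact ⟨d1, d1⟩
    · exact ⟨d1, d2⟩
    · exact ⟨d2, d1⟩
    · exact ⟨d2, d2⟩
  -- Here i goes right and i+1 goes left, which would be a crossing.
  · have := f5 ⟨by omega, by omega⟩
    omega
  · have hpq : D.height p < D.height q := n2.1 ⟨by omega, by omega⟩
    have hba : (D.mate q).pos < (D.mate p).pos := by
      have := f5 ⟨by omega, by omega⟩
      omega
    rw [min_eq_left hpq.le, max_eq_right hpq.le]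
    clear n1 n2 f4 f5 f6 f7 f8
    rcases a3 with a3 | a3 <;> rcases a6 with a6 | a6 <;> omega

/-- The composition of the elementary diagram `G_i` and the diagram `D`. -/
def act (i : GenIdx N) (D : ArcDiagram N) : ArcDiagram N where
  mate := joinMate D.mate (GenIdx.lo i) (GenIdx.hi i)
  height := joinHeight D.mate D.height (GenIdx.lo i) (GenIdx.hi i) i.1
  mate_mate := joinMate_involutive D.mate_mate D.mate_ne
  mate_ne := joinMate_ne D.mate_mate D.mate_ne (GenIdx.lo_ne_hi i)
  noncrossing := by
    rintro u v ⟨h1, h2, h3⟩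
    have l1 := GenIdx.pos_lo i
    have l2 := GenIdx.pos_hi i
    have l3 := GenIdx.lo_ne_hi i
    set p := GenIdx.lo i
    set q := GenIdx.hi i
    have hp := D.mate_mate p
    have hq := D.mate_mate q
    by_cases hpq : D.mate p = q
    · have hpq' : D.mate q = p := by rw [← hpq, hp]
      rcases join_cases D.mate D.height p q i.1 u with
        ⟨rfl, hu, _⟩ | ⟨rfl, _, hu, _⟩ | ⟨rfl, _, _, hu, _⟩ | ⟨rfl, _, _, _, hu, _⟩ |
        ⟨u1, u2, u3, u4, hu, _⟩ <;> rw [hu] at h2 h3 <;>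
      rcases join_cases D.mate D.height p q i.1 v with
        ⟨rfl, hv, _⟩ | ⟨rfl, _, hv, _⟩ | ⟨rfl, _, _, hv, _⟩ | ⟨rfl, _, _, _, hv, _⟩ |
        ⟨v1, v2, v3, v4, hv, _⟩ <;> rw [hv] at h3 <;>
      first
      | omega
      | exact absurd hpq ‹_›
      | exact absurd hpq' ‹_›
      | exact D.noncrossing u v ⟨h1, h2, h3⟩
    · have f := D.arcs_cases (Ne.symm l3) (Ne.symm hpq)
      rcases join_cases D.mate D.height p q i.1 u with
        ⟨rfl, hu, _⟩ | ⟨rfl, _, hu, _⟩ | ⟨rfl, _, _, hu, _⟩ | ⟨rfl, _, _, _, hu, _⟩ |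
        ⟨u1, u2, u3, u4, hu, _⟩ <;> rw [hu] at h2 h3 <;>
      rcases join_cases D.mate D.height p q i.1 v with
        ⟨rfl, hv, _⟩ | ⟨rfl, _, hv, _⟩ | ⟨rfl, _, _, hv, _⟩ | ⟨rfl, _, _, _, hv, _⟩ |
        ⟨v1, v2, v3, v4, hv, _⟩ <;> rw [hv] at h3 <;>
      first
      | omega
      | (have g1 := D.arcs_cases u1 u3
         have g2 := D.arcs_cases u2 u4
         first
         | omega
         | exact D.noncrossing u v ⟨h1, h2, h3⟩)
      | (have g1 := D.arcs_cases v1 v3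
         have g2 := D.arcs_cases v2 v4
         omega)
  height_mate := joinHeight_mate D.mate_mate D.mate_ne D.height_mate
  one_le_height u := by
    have := i.2
    have := D.one_le_height u
    have := D.one_le_height (GenIdx.lo i)
    have := D.one_le_height (GenIdx.hi i)
    rcases joinHeight_cases D.mate D.height (GenIdx.lo i) (GenIdx.hi i) i.1 u with
      h | h | h <;> omega
  height_le u := by
    refine le_min (act_height_le D i u) ?_
    rw [← joinHeight_mate D.mate_mate D.mate_ne D.height_mate]
    exact act_height_le D i _
  height_parity u := by
    have l1 := GenIdx.pos_lo i
    have l2 := GenIdx.pos_hi i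
    have l3 := GenIdx.lo_ne_hi i
    rcases join_cases D.mate D.height (GenIdx.lo i) (GenIdx.hi i) i.1 u with
      ⟨rfl, hu, hu'⟩ | ⟨rfl, _, hu, hu'⟩ | ⟨rfl, u1, u2, hu, hu'⟩ | ⟨rfl, u1, u2, u3, hu, hu'⟩ |
      ⟨u1, u2, u3, u4, hu, hu'⟩ <;> rw [hu, hu']
    · have a1 := Node.pos_abs (GenIdx.lo i)
      have a2 := Node.pos_abs (GenIdx.hi i)
      omega
    · have a1 := Node.pos_abs (GenIdx.lo i)
      have a2 := Node.pos_abs (GenIdx.hi i)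
      omega
    · exact (act_arc_parity D i u2).1
    · rw [min_comm (D.mate _).abs]
      exact (act_arc_parity D i fun e => u1 (by rw [← e, D.mate_mate])).1
    · exact D.height_parity u
  height_nested := act_height_nested D i

end ArcDiagram

end Okada

namespace Okada

/-! ### Composition along words -/

theorem GenIdx.lo_abs {N : ℕ} (i : GenIdx N) : (GenIdx.lo i).abs = i.1 := by
  have := i.2
  simp only [GenIdx.lo, Node.abs]; omega

theorem GenIdx.hi_abs {N : ℕ} (i : GenIdx N) : (GenIdx.hi i).abs = i.1 + 1 := rfl

namespace ArcDiagram

variable {N : ℕ}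

theorem joined_symm {C D : ArcDiagram N} {p q : CNode N} (h : Joined C D p q) :
    Joined C D q p := by
  have : Std.Symm (ArcStep C D) := by
    constructor
    rintro p q (⟨u, rfl, rfl⟩ | ⟨u, rfl, rfl⟩)
    · exact Or.inl ⟨C.mate u, rfl, by rw [C.mate_mate]⟩
    · exact Or.inr ⟨D.mate u, rfl, by rw [D.mate_mate]⟩
  exact Relation.ReflTransGen.stdSymm.symm _ _ h

theorem elem_mate_lo (i : GenIdx N) : (elem i).mate (GenIdx.lo i) = GenIdx.hi i := by
  have := i.2
  have h : i.1 - 1 + 1 = i.1 := by omega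
  simp [elem, elemMate, GenIdx.lo, GenIdx.hi, elemSwap, h]

theorem elem_mate_hi (i : GenIdx N) : (elem i).mate (GenIdx.hi i) = GenIdx.lo i := by
  rw [← elem_mate_lo, (elem i).mate_mate]

theorem elem_mate_swap (i : GenIdx N) (u : Node N) :
    (elem i).mate u.swap = ((elem i).mate u).swap := by
  rcases u with u | u <;> simp only [elem, elemMate, Sum.swap_inl, Sum.swap_inr] <;>
    split_ifs <;> rfl

theorem elem_mate_inl (i : GenIdx N) {a : Fin N} (h1 : Sum.inl a ≠ GenIdx.lo i)
    (h2 : Sum.inl a ≠ GenIdx.hi i) : (elem i).mate (Sum.inl a) = Sum.inr a := by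
  have h1' : a.val + 1 ≠ i.1 := fun e => h1 (by simp [GenIdx.lo, Fin.ext_iff]; omega)
  have h2' : a.val ≠ i.1 := fun e => h2 (by simp [GenIdx.hi, Fin.ext_iff]; omega)
  simp [elem, elemMate, h1', h2']

theorem elem_mate_inr (i : GenIdx N) {a : Fin N} (h1 : Sum.inl a ≠ GenIdx.lo i)
    (h2 : Sum.inl a ≠ GenIdx.hi i) : (elem i).mate (Sum.inr a) = Sum.inl a := by
  rw [← elem_mate_inl i h1 h2, (elem i).mate_mate]

theorem elem_height (i : GenIdx N) (u : Node N) :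
    (elem i).height u = if u.abs = i.1 + 1 then i.1 else u.abs := rfl

theorem act_mate_lo (i : GenIdx N) (D : ArcDiagram N) :
    (act i D).mate (GenIdx.lo i) = GenIdx.hi i := by
  simp [act, joinMate]

theorem act_mate_hi (i : GenIdx N) (D : ArcDiagram N) :
    (act i D).mate (GenIdx.hi i) = GenIdx.lo i := by
  rw [← act_mate_lo i D, (act i D).mate_mate]

theorem act_cases (i : GenIdx N) (D : ArcDiagram N) (u : Node N) :
    (u = GenIdx.lo i ∧ (act i D).mate u = GenIdx.hi i ∧ (act i D).height u = i.1) ∨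
    (u = GenIdx.hi i ∧ u ≠ GenIdx.lo i ∧ (act i D).mate u = GenIdx.lo i ∧
      (act i D).height u = i.1) ∨
    (u = D.mate (GenIdx.lo i) ∧ u ≠ GenIdx.lo i ∧ u ≠ GenIdx.hi i ∧
      (act i D).mate u = D.mate (GenIdx.hi i) ∧
      (act i D).height u = min (D.height (GenIdx.lo i)) (D.height (GenIdx.hi i))) ∨
    (u = D.mate (GenIdx.hi i) ∧ u ≠ GenIdx.lo i ∧ u ≠ GenIdx.hi i ∧
      u ≠ D.mate (GenIdx.lo i) ∧ (act i D).mate u = D.mate (GenIdx.lo i) ∧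
      (act i D).height u = min (D.height (GenIdx.lo i)) (D.height (GenIdx.hi i))) ∨
    (u ≠ GenIdx.lo i ∧ u ≠ GenIdx.hi i ∧ u ≠ D.mate (GenIdx.lo i) ∧
      u ≠ D.mate (GenIdx.hi i) ∧ (act i D).mate u = D.mate u ∧
      (act i D).height u = D.height u) :=
  join_cases D.mate D.height (GenIdx.lo i) (GenIdx.hi i) i.1 u

/-- The end of the arc of `[G_i ∘ D]` which contains a node of the concatenation, or its other
end; nothing for the nodes of a loop. -/
def owner (i : GenIdx N) (D : ArcDiagram N) (p : CNode N) : Option (Node N) :=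
  if p.1 = 0 then some (Sum.inl p.2) else if p.1 = 2 then some (Sum.inr p.2) else
    if Sum.inl p.2 = GenIdx.lo i then
      if D.mate (GenIdx.lo i) = GenIdx.hi i then none else some (D.mate (GenIdx.lo i))
    else if Sum.inl p.2 = GenIdx.hi i then
      if D.mate (GenIdx.lo i) = GenIdx.hi i then none else some (D.mate (GenIdx.hi i))
    else some (Sum.inl p.2)

theorem owner_outer (i : GenIdx N) (D : ArcDiagram N) (u : Node N) :
    owner i D (outerNode u) = some u := by
  cases u <;> simp [owner, outerNode]

theorem owner_second (i : GenIdx N) (D : ArcDiagram N) (u : Node N) :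
    (u = GenIdx.lo i ∧ D.mate (GenIdx.lo i) = GenIdx.hi i ∧ owner i D (secondNode u) = none) ∨
    (u = GenIdx.lo i ∧ D.mate (GenIdx.lo i) ≠ GenIdx.hi i ∧
      owner i D (secondNode u) = some (D.mate (GenIdx.lo i))) ∨
    (u = GenIdx.hi i ∧ D.mate (GenIdx.lo i) = GenIdx.hi i ∧ owner i D (secondNode u) = none) ∨
    (u = GenIdx.hi i ∧ D.mate (GenIdx.lo i) ≠ GenIdx.hi i ∧
      owner i D (secondNode u) = some (D.mate (GenIdx.hi i))) ∨
    (u ≠ GenIdx.lo i ∧ u ≠ GenIdx.hi i ∧ owner i D (secondNode u) = some u) := by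
  have := GenIdx.lo_ne_hi i
  rcases u with a | a
  · have h12 : ¬ (1 : Fin 3) = 2 := by decide
    simp only [owner, secondNode, one_ne_zero, if_false, h12]
    by_cases h1 : Sum.inl a = GenIdx.lo i <;> by_cases h2 : Sum.inl a = GenIdx.hi i <;>
      by_cases h3 : D.mate (GenIdx.lo i) = GenIdx.hi i <;> simp_all
  · right; right; right; right
    simp [owner, secondNode, GenIdx.lo, GenIdx.hi]

/-- `p` and `q` belong to the same arc of `[G_i ∘ D]`, or both to loops. -/
def SameOwner (i : GenIdx N) (D : ArcDiagram N) (p q : CNode N) : Prop :=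
  (owner i D p = none ∧ owner i D q = none) ∨
    ∃ v w, owner i D p = some v ∧ owner i D q = some w ∧ (w = v ∨ w = (act i D).mate v)

theorem sameOwner_second (i : GenIdx N) (D : ArcDiagram N) (u : Node N) :
    SameOwner i D (secondNode u) (secondNode (D.mate u)) := by
  have h1 := owner_second i D u
  have h2 := owner_second i D (D.mate u)
  have h3 := GenIdx.lo_ne_hi i
  have h4 := D.mate_mate u
  have h5 := D.mate_mate (GenIdx.lo i)
  have h6 := D.mate_mate (GenIdx.hi i)
  have h7 := joinMate_cases D.mate (GenIdx.lo i) (GenIdx.hi i) u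
  have h8 := D.mate_ne u
  unfold SameOwner
  simp only [act]
  rcases h1 with h1 | h1 | h1 | h1 | h1 <;> rcases h2 with h2 | h2 | h2 | h2 | h2 <;> grind

theorem sameOwner_first (i : GenIdx N) (D : ArcDiagram N) (u : Node N) :
    SameOwner i D (firstNode u) (firstNode ((elem i).mate u)) := by
  have hlo : (act i D).mate (GenIdx.lo i) = GenIdx.hi i := act_mate_lo i D
  have hhi : (act i D).mate (GenIdx.hi i) = GenIdx.lo i := by rw [← hlo, (act i D).mate_mate]
  have h3 := GenIdx.lo_ne_hi i
  have outer : SameOwner i D (outerNode (GenIdx.lo i)) (outerNode (GenIdx.hi i)) :=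
    Or.inr ⟨_, _, owner_outer i D _, owner_outer i D _, Or.inr hlo.symm⟩
  have inner : SameOwner i D (secondNode (GenIdx.lo i)) (secondNode (GenIdx.hi i)) := by
    have h1 := owner_second i D (GenIdx.lo i)
    have h2 := owner_second i D (GenIdx.hi i)
    have h7 := joinMate_cases D.mate (GenIdx.lo i) (GenIdx.hi i) (D.mate (GenIdx.lo i))
    have h8 := D.mate_ne (GenIdx.lo i)
    unfold SameOwner
    simp only [act]
    rcases h1 with h1 | h1 | h1 | h1 | h1 <;> rcases h2 with h2 | h2 | h2 | h2 | h2 <;> grind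
  have strand : ∀ a : Fin N, Sum.inl a ≠ GenIdx.lo i → Sum.inl a ≠ GenIdx.hi i →
      SameOwner i D (outerNode (Sum.inl a)) (secondNode (Sum.inl a)) := by
    intro a h1 h2
    have h4 := owner_second i D (Sum.inl a)
    rw [SameOwner, owner_outer]
    grind
  have symm : ∀ {p q}, SameOwner i D p q → SameOwner i D q p := by
    intro p q h
    have := (act i D).mate_mate
    unfold SameOwner at *
    grind
  rcases u with a | a
  · by_cases h1 : Sum.inl a = GenIdx.lo i
    · rw [h1, elem_mate_lo]
      exact outer
    · by_cases h2 : Sum.inl a = GenIdx.hi i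
      · rw [h2, elem_mate_hi]
        exact symm outer
      · rw [elem_mate_inl i h1 h2]
        exact strand a h1 h2
  · by_cases h1 : Sum.inl a = GenIdx.lo i
    · rw [← Sum.swap_inl, h1, elem_mate_swap, elem_mate_lo]
      exact inner
    · by_cases h2 : Sum.inl a = GenIdx.hi i
      · rw [← Sum.swap_inl, h2, elem_mate_swap, elem_mate_hi]
        exact symm inner
      · rw [elem_mate_inr i h1 h2]
        exact symm (strand a h1 h2)

theorem sameOwner_trans {i : GenIdx N} {D : ArcDiagram N} {p q r : CNode N}
    (h1 : SameOwner i D p q) (h2 : SameOwner i D q r) : SameOwner i D p r := by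
  have := (act i D).mate_mate
  unfold SameOwner at *
  grind

theorem sameOwner_of_joined {i : GenIdx N} {D : ArcDiagram N} {p q : CNode N}
    (h : Joined (elem i) D p q) : SameOwner i D p q := by
  induction h with
  | refl =>
    unfold SameOwner
    cases owner i D p <;> simp
  | tail _ h ih =>
    refine sameOwner_trans ih ?_
    rcases h with ⟨u, rfl, rfl⟩ | ⟨u, rfl, rfl⟩
    · exact sameOwner_first i D u
    · exact sameOwner_second i D u

/-- `owner` is constant, up to exchanging the two ends of an arc, along every fragment of the
concatenation. So an outer node reaches only the fragments of its own arc and never a loop. -/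
theorem owner_of_joined {i : GenIdx N} {D : ArcDiagram N} {u : Node N} {p : CNode N}
    (h : Joined (elem i) D (outerNode u) p) :
    ∃ w, owner i D p = some w ∧ (w = u ∨ w = (act i D).mate u) := by
  rcases sameOwner_of_joined h with h | ⟨v, w, h1, h2, h3⟩
  · rw [owner_outer] at h
    simp at h
  · rw [owner_outer, Option.some_inj] at h1
    subst h1
    exact ⟨w, h2, h3⟩

theorem joined_second {i : GenIdx N} (D : ArcDiagram N) {u : Node N} (h1 : u ≠ GenIdx.lo i)
    (h2 : u ≠ GenIdx.hi i) : Joined (elem i) D (outerNode u) (secondNode u) := by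
  rcases u with a | a
  · refine Relation.ReflTransGen.single (Or.inl ⟨Sum.inl a, rfl, ?_⟩)
    rw [elem_mate_inl i h1 h2]
    rfl
  · exact Relation.ReflTransGen.refl

theorem joined_mate {i : GenIdx N} (D : ArcDiagram N) (u : Node N) :
    Joined (elem i) D (secondNode u) (secondNode (D.mate u)) :=
  Relation.ReflTransGen.single (Or.inr ⟨u, rfl, rfl⟩)

theorem joined_lo_hi (i : GenIdx N) (D : ArcDiagram N) :
    Joined (elem i) D (secondNode (GenIdx.lo i)) (secondNode (GenIdx.hi i)) := by
  refine Relation.ReflTransGen.single (Or.inl ⟨(GenIdx.lo i).swap, rfl, ?_⟩)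
  rw [elem_mate_swap, elem_mate_lo]
  rfl

theorem mate_hi_eq_iff (i : GenIdx N) (D : ArcDiagram N) :
    D.mate (GenIdx.hi i) = GenIdx.lo i ↔ D.mate (GenIdx.lo i) = GenIdx.hi i :=
  ⟨fun e => by rw [← e, D.mate_mate], fun e => by rw [← e, D.mate_mate]⟩

/-- The height of the composition is at most the height of the fragments of `D`. -/
theorem height_le_second (i : GenIdx N) (D : ArcDiagram N) {u w : Node N}
    (h : owner i D (secondNode u) = some w) : (act i D).height w ≤ D.height u := by
  have h1 := owner_second i D u
  have h2 := act_cases i D w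
  have h3 := D.height_mate (GenIdx.lo i)
  have h4 := D.height_mate (GenIdx.hi i)
  have h5 := D.mate_ne (GenIdx.lo i)
  have h6 := D.mate_ne (GenIdx.hi i)
  have h7 := mate_hi_eq_iff i D
  rcases h1 with h1 | h1 | h1 | h1 | h1 <;> rcases h2 with h2 | h2 | h2 | h2 | h2 <;> grind

/-- The height of the composition is at most the height of the fragments of `G_i`. -/
theorem height_le_first (i : GenIdx N) (D : ArcDiagram N) {u w : Node N}
    (h : owner i D (firstNode u) = some w) : (act i D).height w ≤ (elem i).height u := by
  have hlo := D.height_le_pos (GenIdx.lo i)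
  have hhi := D.height_le_pos (GenIdx.hi i)
  rw [GenIdx.pos_lo] at hlo
  rw [GenIdx.pos_hi] at hhi
  rw [elem_height]
  rcases u with a | a
  · have : firstNode (Sum.inl a) = outerNode (Sum.inl a) := rfl
    rw [this, owner_outer, Option.some_inj] at h
    subst h
    have h1 := (act i D).height_le (Sum.inl a)
    split_ifs with h2
    · rw [show (Sum.inl a : Node N) = GenIdx.hi i from
        Node.ext_abs (by rw [h2, GenIdx.hi_abs]) rfl]
      have := act_cases i D (GenIdx.hi i)
      have := GenIdx.lo_ne_hi i
      grind
    · omega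
  · have : firstNode (Sum.inr a) = secondNode (Sum.inl a) := rfl
    rw [this] at h
    have h0 : Node.abs (Sum.inr a : Node N) = Node.abs (Sum.inl a : Node N) := rfl
    rw [h0]
    have h1 := height_le_second i D h
    have h2 := D.height_le (Sum.inl a)
    split_ifs with h3
    · have h4 : (Sum.inl a : Node N) = GenIdx.hi i :=
        Node.ext_abs (by rw [h3, GenIdx.hi_abs]) rfl
      rw [h4] at h h1
      have h5 := owner_second i D (GenIdx.hi i)
      have h6 := act_cases i D w
      have h7 := D.mate_ne (GenIdx.hi i)
      have h8 := mate_hi_eq_iff i D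
      have h9 := GenIdx.lo_ne_hi i
      grind
    · omega

theorem joined_mates {i : GenIdx N} {D : ArcDiagram N}
    (h : D.mate (GenIdx.lo i) ≠ GenIdx.hi i) :
    Joined (elem i) D (outerNode (D.mate (GenIdx.lo i))) (secondNode (GenIdx.lo i)) ∧
    Joined (elem i) D (secondNode (GenIdx.hi i)) (outerNode (D.mate (GenIdx.hi i))) := by
  constructor
  · refine (joined_second D (D.mate_ne _) h).trans ?_
    have := joined_mate (i := i) D (D.mate (GenIdx.lo i))
    rwa [D.mate_mate] at this
  · refine (joined_mate D _).trans (joined_symm (joined_second D ?_ (D.mate_ne _)))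
    rwa [Ne, mate_hi_eq_iff]

theorem joined_act_mate (i : GenIdx N) (D : ArcDiagram N) (u : Node N) :
    Joined (elem i) D (outerNode u) (outerNode ((act i D).mate u)) := by
  have hlohi : Joined (elem i) D (outerNode (GenIdx.lo i)) (outerNode (GenIdx.hi i)) := by
    refine Relation.ReflTransGen.single (Or.inl ⟨GenIdx.lo i, rfl, ?_⟩)
    rw [elem_mate_lo]
    rfl
  rcases act_cases i D u with ⟨rfl, h, _⟩ | ⟨rfl, _, h, _⟩ | ⟨rfl, _, h', h, _⟩ |
    ⟨rfl, h', _, _, h, _⟩ | ⟨u1, u2, u3, u4, h, _⟩ <;> rw [h]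
  · exact hlohi
  · exact joined_symm hlohi
  · exact (joined_mates h').1.trans ((joined_lo_hi i D).trans (joined_mates h').2)
  · rw [Ne, mate_hi_eq_iff] at h'
    exact joined_symm ((joined_mates h').1.trans ((joined_lo_hi i D).trans (joined_mates h').2))
  · refine (joined_second D u1 u2).trans ((joined_mate D u).trans
      (joined_symm (joined_second D ?_ ?_)))
    · exact fun e => u3 (by rw [← e, D.mate_mate])
    · exact fun e => u4 (by rw [← e, D.mate_mate])

theorem isComposition_act (i : GenIdx N) (D : ArcDiagram N) :
    IsComposition (elem i) D (act i D) := by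
  refine ⟨joined_act_mate i D, fun u => ⟨?_, ?_⟩⟩
  · rcases act_cases i D u with ⟨rfl, _, h⟩ | ⟨rfl, _, _, h⟩ | ⟨rfl, _, h', _, h⟩ |
      ⟨rfl, h', _, _, _, h⟩ | ⟨u1, u2, u3, u4, _, h⟩ <;> rw [h]
    · refine Or.inl ⟨GenIdx.lo i, Relation.ReflTransGen.refl, ?_⟩
      rw [elem_height, GenIdx.lo_abs]
      simp
    · refine Or.inl ⟨GenIdx.hi i, Relation.ReflTransGen.refl, ?_⟩
      rw [elem_height, GenIdx.hi_abs]
      simp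
    · rcases min_choice (D.height (GenIdx.lo i)) (D.height (GenIdx.hi i)) with e | e
      · exact Or.inr ⟨_, (joined_mates h').1, e⟩
      · exact Or.inr ⟨_, (joined_mates h').1.trans (joined_lo_hi i D), e⟩
    · rw [Ne, mate_hi_eq_iff] at h'
      rcases min_choice (D.height (GenIdx.lo i)) (D.height (GenIdx.hi i)) with e | e
      · exact Or.inr ⟨_, joined_symm ((joined_lo_hi i D).trans (joined_mates h').2), e⟩
      · exact Or.inr ⟨_, joined_symm (joined_mates h').2, e⟩
    · exact Or.inr ⟨u, joined_second D u1 u2, rfl⟩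
  · rintro k (⟨v, hv, rfl⟩ | ⟨v, hv, rfl⟩)
    · obtain ⟨w, hw, hw'⟩ := owner_of_joined hv
      have := height_le_first i D hw
      have := (act i D).height_mate u
      rcases hw' with rfl | rfl <;> omega
    · obtain ⟨w, hw, hw'⟩ := owner_of_joined hv
      have := height_le_second i D hw
      have := (act i D).height_mate u
      rcases hw' with rfl | rfl <;> omega

/-- The relational definition leaves no freedom: the owner determines the mate, and a least element
is unique. From here on composition with G_i is the function `act i`. -/
theorem isComposition_elem_iff {i : GenIdx N} {D E : ArcDiagram N} :
    IsComposition (elem i) D E ↔ E = act i D := by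
  constructor
  · rintro ⟨h1, h2⟩
    have hmate : E.mate = (act i D).mate := by
      funext u
      obtain ⟨w, hw, hw'⟩ := owner_of_joined (h1 u)
      rw [owner_outer, Option.some_inj] at hw
      subst hw
      exact hw'.resolve_left (E.mate_ne u)
    refine ArcDiagram.ext hmate (funext fun u => ?_)
    exact (h2 u).unique ((isComposition_act i D).2 u)
  · rintro rfl
    exact isComposition_act i D

/-- The composition of the elementary diagrams along a word. -/
def ofWord (w : List (GenIdx N)) : ArcDiagram N :=
  w.foldr act (ArcDiagram.id N)

theorem isWordDiagram_iff {w : List (GenIdx N)} {D : ArcDiagram N} :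
    IsWordDiagram w D ↔ D = ofWord w := by
  constructor
  · intro h
    induction h with
    | nil => rfl
    | cons i w D E _ h ih =>
      rw [isComposition_elem_iff.1 h, ih]
      rfl
  · rintro rfl
    induction w with
    | nil => exact IsWordDiagram.nil
    | cons i w ih => exact IsWordDiagram.cons i w _ _ ih (isComposition_act i _)

end ArcDiagram

end Okada

namespace Okada

namespace ArcDiagram

variable {N : ℕ}

/-! ### Relations between the elementary diagrams -/

theorem lo_hi_ne {i j : GenIdx N} (h : i.1 + 2 ≤ j.1 ∨ j.1 + 2 ≤ i.1) :
    GenIdx.lo i ≠ GenIdx.lo j ∧ GenIdx.lo i ≠ GenIdx.hi j ∧ GenIdx.hi i ≠ GenIdx.lo j ∧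
      GenIdx.hi i ≠ GenIdx.hi j := by
  refine ⟨?_, ?_, ?_, ?_⟩ <;> intro e <;> have := congrArg Node.pos e <;>
    simp only [GenIdx.pos_lo, GenIdx.pos_hi] at this <;> omega

theorem act_comm {i j : GenIdx N} (h : i.1 + 2 ≤ j.1 ∨ j.1 + 2 ≤ i.1) (D : ArcDiagram N) :
    act i (act j D) = act j (act i D) := by
  obtain ⟨h1, h2, h3, h4⟩ := lo_hi_ne h
  apply ArcDiagram.ext
  · funext u
    exact joinMate_comm D.mate_mate D.mate_ne h1.symm h3.symm h2.symm h4.symm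
      (GenIdx.lo_ne_hi j) (GenIdx.lo_ne_hi i) u
  · funext u
    exact joinHeight_comm D.mate_mate D.mate_ne D.height_mate h1.symm h3.symm h2.symm h4.symm
      (GenIdx.lo_ne_hi j) (GenIdx.lo_ne_hi i) u

theorem act_height_lo (i : GenIdx N) (D : ArcDiagram N) :
    (act i D).height (GenIdx.lo i) = i.1 := by
  simp [act, joinHeight]

theorem act_height_hi (i : GenIdx N) (D : ArcDiagram N) :
    (act i D).height (GenIdx.hi i) = i.1 := by
  simp [act, joinHeight]

theorem act_eq_of_mate_lo {i : GenIdx N} {D : ArcDiagram N} (h : D.mate (GenIdx.lo i) = GenIdx.hi i)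
    (h' : D.height (GenIdx.lo i) = i.1) : act i D = D := by
  have h1 := D.mate_mate (GenIdx.lo i)
  have h2 := D.height_mate (GenIdx.lo i)
  rw [h] at h1 h2
  apply ArcDiagram.ext <;> funext u <;> have := act_cases i D u <;> grind

theorem act_act_self (i : GenIdx N) (D : ArcDiagram N) : act i (act i D) = act i D :=
  act_eq_of_mate_lo (act_mate_lo i D) (act_height_lo i D)

theorem hi_eq_lo {i j : GenIdx N} (h : j.1 = i.1 + 1) : GenIdx.hi i = GenIdx.lo j :=
  Node.pos_injective (by rw [GenIdx.pos_lo, GenIdx.pos_hi, h])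

theorem height_lo_le (i : GenIdx N) (D : ArcDiagram N) : D.height (GenIdx.lo i) ≤ i.1 := by
  have := (D.height_le_pos (GenIdx.lo i)).1
  rwa [GenIdx.pos_lo] at this

theorem height_hi_le (i : GenIdx N) (D : ArcDiagram N) : D.height (GenIdx.hi i) ≤ i.1 + 1 := by
  have := (D.height_le_pos (GenIdx.hi i)).1
  rwa [GenIdx.pos_hi] at this

theorem lo_ne_hi_succ {i j : GenIdx N} (h : j.1 = i.1 + 1) : GenIdx.lo i ≠ GenIdx.hi j := by
  intro e
  have := congrArg Node.pos e
  simp only [GenIdx.pos_lo, GenIdx.pos_hi] at this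
  omega

/-- After `act j` the nodes j and j+1 are joined with label j = i+1. Then `act i` only shifts the
arc of node i to node j+1, without changing its label, which is at most i; the second `act j` shifts
it back. -/
theorem act_act_act {i j : GenIdx N} (h : j.1 = i.1 + 1) (D : ArcDiagram N) :
    act j (act i (act j D)) = act j D := by
  have hij := hi_eq_lo h
  have n1 := GenIdx.lo_ne_hi i
  have n2 := GenIdx.lo_ne_hi j
  have n3 := lo_ne_hi_succ h
  have b1 := height_lo_le i (act j D)
  have b2 := height_hi_le j (act j D)
  have a1 := act_mate_lo j D
  have a2 := act_mate_hi j D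
  have a3 := act_height_lo j D
  have a4 := act_height_hi j D
  set E := act j D
  have e1 := E.mate_mate (GenIdx.lo i)
  have e2 := E.height_mate (GenIdx.lo i)
  have e3 := E.mate_ne (GenIdx.lo i)
  have f1 := act_cases i E (GenIdx.lo i)
  have f2 := act_cases i E (GenIdx.lo j)
  have f3 := act_cases i E (GenIdx.hi j)
  apply ArcDiagram.ext <;> funext u <;> have g1 := act_cases j (act i E) u <;>
    have g2 := act_cases i E u
  · rcases g1 with g1 | g1 | g1 | g1 | g1 <;> grind
  · rcases g1 with g1 | g1 | g1 | g1 | g1 <;> grind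

/-! ### The mirror -/

theorem mirror_mirror (D : ArcDiagram N) : D.mirror.mirror = D := by
  apply ArcDiagram.ext <;> funext u <;> simp [mirror]

theorem mirror_act_mirror_mate (i : GenIdx N) (D : ArcDiagram N) :
    (mirror (act i D.mirror)).mate = joinMate D.mate (GenIdx.lo i).swap (GenIdx.hi i).swap := by
  funext u
  have := joinMate_map (Equiv.sumComm (Fin N) (Fin N)) D.mirror.mate (GenIdx.lo i) (GenIdx.hi i) u
  simpa [mirror, act] using this

theorem mirror_act_mirror_height (i : GenIdx N) (D : ArcDiagram N) :
    (mirror (act i D.mirror)).height =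
      joinHeight D.mate D.height (GenIdx.lo i).swap (GenIdx.hi i).swap i.1 := by
  funext u
  have := joinHeight_map (Equiv.sumComm (Fin N) (Fin N)) D.mirror.mate D.mirror.height
    (GenIdx.lo i) (GenIdx.hi i) i.1 u
  simpa [mirror, act] using this

/-- `mirror (act j D.mirror)` is the composition with G_j on the right. It joins two right nodes,
`act i` joins two left nodes, and joins at disjoint pairs commute. -/
theorem act_mirror_act_mirror (i j : GenIdx N) (D : ArcDiagram N) :
    act i (mirror (act j D.mirror)) = mirror (act j (mirror (act i D))) := by
  have h : ∀ u v : Node N, u.isLeft = true → v.isLeft = true → u.swap ≠ v := by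
    rintro (u | u) (v | v) <;> simp
  have h1 := h (GenIdx.lo j) (GenIdx.lo i) rfl rfl
  have h2 := h (GenIdx.lo j) (GenIdx.hi i) rfl rfl
  have h3 := h (GenIdx.hi j) (GenIdx.lo i) rfl rfl
  have h4 := h (GenIdx.hi j) (GenIdx.hi i) rfl rfl
  have h5 : (GenIdx.lo j).swap ≠ (GenIdx.hi j).swap := fun e =>
    GenIdx.lo_ne_hi j (by rw [← Sum.swap_swap (GenIdx.lo j), e, Sum.swap_swap])
  apply ArcDiagram.ext
  · rw [mirror_act_mirror_mate]
    change joinMate (mirror (act j D.mirror)).mate _ _ = _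
    rw [mirror_act_mirror_mate]
    funext u
    exact joinMate_comm D.mate_mate D.mate_ne h1 h2 h3 h4 h5 (GenIdx.lo_ne_hi i) u
  · rw [mirror_act_mirror_height]
    change joinHeight (mirror (act j D.mirror)).mate (mirror (act j D.mirror)).height _ _ _ = _
    rw [mirror_act_mirror_mate, mirror_act_mirror_height]
    funext u
    exact joinHeight_comm D.mate_mate D.mate_ne D.height_mate h1 h2 h3 h4 h5
      (GenIdx.lo_ne_hi i) u

theorem mirror_id : (ArcDiagram.id N).mirror = ArcDiagram.id N := by
  apply ArcDiagram.ext <;> funext u <;> simp [mirror, ArcDiagram.id, Node.abs_swap]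

theorem act_id (i : GenIdx N) : act i (ArcDiagram.id N) = mirror (act i (ArcDiagram.id N)) := by
  have h := mirror_act_mirror_mate i (ArcDiagram.id N)
  have h' := mirror_act_mirror_height i (ArcDiagram.id N)
  rw [mirror_id] at h h'
  have n1 := GenIdx.lo_ne_hi i
  have n2 := GenIdx.lo_abs i
  have n3 := GenIdx.hi_abs i
  apply ArcDiagram.ext <;> funext u
  · rw [h]
    have c1 := act_cases i (ArcDiagram.id N) u
    have c2 := joinMate_cases (ArcDiagram.id N).mate (GenIdx.lo i).swap (GenIdx.hi i).swap u
    simp only [ArcDiagram.id] at c1 c2 ⊢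
    rw [Sum.swap_swap, Sum.swap_swap] at c2
    grind
  · rw [h']
    have c1 := act_cases i (ArcDiagram.id N) u
    have c2 := joinHeight_cases (ArcDiagram.id N).mate (ArcDiagram.id N).height (GenIdx.lo i).swap
      (GenIdx.hi i).swap i.1 u
    simp only [ArcDiagram.id] at c1 c2 ⊢
    rw [Sum.swap_swap, Sum.swap_swap, Node.abs_swap, Node.abs_swap] at c2
    grind

theorem ofWord_append_singleton (w : List (GenIdx N)) (j : GenIdx N) :
    ofWord (w ++ [j]) = mirror (act j (mirror (ofWord w))) := by
  induction w with
  | nil =>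
    change act j (ArcDiagram.id N) = mirror (act j (ArcDiagram.id N).mirror)
    rw [mirror_id]
    exact act_id j
  | cons i w ih =>
    change act i (ofWord (w ++ [j])) = mirror (act j (mirror (act i (ofWord w))))
    rw [ih, act_mirror_act_mirror]

theorem ofWord_reverse (w : List (GenIdx N)) : ofWord w.reverse = (ofWord w).mirror := by
  induction w with
  | nil => exact mirror_id.symm
  | cons i w ih =>
    rw [List.reverse_cons, ofWord_append_singleton, ih, mirror_mirror]
    rfl

end ArcDiagram

end Okada

namespace Okada

/-! ### Weights -/

section Weight

variable {K : Type*} [Field K] {N : ℕ} (X Y : ℕ → K)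

/-- The product of the `Y m` for `s ≤ m < t` with `m ≡ t` modulo `2`. -/
def stepProd (s t : ℕ) : K :=
  ∏ m ∈ (Finset.range t).filter fun m => s ≤ m ∧ m % 2 = t % 2, Y m

theorem stepProd_mul {s r t : ℕ} (h1 : s ≤ r) (h2 : r ≤ t) (h : r % 2 = t % 2) :
    stepProd Y s t = stepProd Y s r * stepProd Y r t := by
  unfold stepProd
  rw [← Finset.prod_union]
  · congr 1
    ext m
    simp only [Finset.mem_union, Finset.mem_filter, Finset.mem_range]
    omega
  · rw [Finset.disjoint_left]
    intro m
    simp only [Finset.mem_filter, Finset.mem_range]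
    omega

theorem stepProd_self (t : ℕ) : stepProd Y t t = 1 := by
  unfold stepProd
  apply Finset.prod_eq_one
  intro m
  simp only [Finset.mem_filter, Finset.mem_range]
  omega

theorem stepProd_add_two (t : ℕ) : stepProd Y t (t + 2) = Y t := by
  unfold stepProd
  have : (Finset.range (t + 2)).filter (fun m => t ≤ m ∧ m % 2 = (t + 2) % 2) = {t} := by
    ext m
    simp only [Finset.mem_singleton, Finset.mem_filter, Finset.mem_range]
    omega
  rw [this, Finset.prod_singleton]

/-- Both sides are the product from s to r times the products from r to t and from r to u. This
symmetry in t and u is what makes the weights of commuting generators agree. -/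
theorem stepProd_exchange {s r t u : ℕ} (h1 : s ≤ r) (h2 : r ≤ t) (h3 : r ≤ u)
    (h : r % 2 = t % 2) (h' : r % 2 = u % 2) :
    stepProd Y r t * stepProd Y s u = stepProd Y r u * stepProd Y s t := by
  rw [stepProd_mul Y h1 h2 h, stepProd_mul Y h1 h3 h']
  ring

/-- Here a, b, c are the labels along a path of three arcs whose two junctions are merged in either
order. Only when b is the strict maximum do the factors change, and then they are exchanged at b. -/
theorem stepProd_max {a b c t u : ℕ} (h1 : max a b % 2 = t % 2) (h2 : max b c % 2 = u % 2)
    (h3 : b ≤ t) (h4 : b ≤ u) :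
    stepProd Y (max a b) t * stepProd Y (max (min a b) c) u =
      stepProd Y (max b c) u * stepProd Y (max a (min b c)) t := by
  rcases le_or_gt b a with h | h
  · rw [min_eq_right h, max_eq_left h, max_eq_left (a := a) (min_le_of_left_le h), mul_comm]
  · rcases le_or_gt b c with h' | h'
    · rw [min_eq_left h.le, max_eq_right h.le, min_eq_left h', max_eq_right h.le,
        max_eq_right (h.le.trans h'), max_eq_right h', mul_comm]
    · rw [max_eq_right h.le] at h1 ⊢
      rw [max_eq_left h'.le] at h2 ⊢
      rw [min_eq_left h.le, min_eq_right h'.le]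
      exact stepProd_exchange Y (max_le h.le h'.le) h3 h4 h1 h2

/-- The coefficient of `E_{[G_i ∘ D]}` in the product of `E_i` and the element of `D`. -/
noncomputable def weight (i : GenIdx N) (D : ArcDiagram N) : K :=
  if D.mate (GenIdx.lo i) = GenIdx.hi i then
    X (D.height (GenIdx.lo i)) * stepProd Y (D.height (GenIdx.lo i) + 1) (i.1 + 1)
  else stepProd Y (max (D.height (GenIdx.lo i)) (D.height (GenIdx.hi i))) (i.1 + 1)

namespace ArcDiagram

theorem act_at_mate_lo {i : GenIdx N} {D : ArcDiagram N} {u : Node N}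
    (h : D.mate (GenIdx.lo i) = u) (h1 : GenIdx.lo i ≠ u) (h2 : GenIdx.hi i ≠ u) :
    (act i D).mate u = D.mate (GenIdx.hi i) ∧
      (act i D).height u = min (D.height (GenIdx.lo i)) (D.height (GenIdx.hi i)) := by
  have := act_cases i D u
  grind

theorem act_at_mate_hi {i : GenIdx N} {D : ArcDiagram N} {u : Node N}
    (h : D.mate (GenIdx.hi i) = u) (h1 : GenIdx.lo i ≠ u) (h2 : GenIdx.hi i ≠ u) :
    (act i D).mate u = D.mate (GenIdx.lo i) ∧
      (act i D).height u = min (D.height (GenIdx.lo i)) (D.height (GenIdx.hi i)) := by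
  have := act_cases i D u
  have : D.mate (GenIdx.lo i) ≠ u := fun e =>
    GenIdx.lo_ne_hi i (D.mate_injective (e.trans h.symm))
  grind

theorem act_at_other {i : GenIdx N} {D : ArcDiagram N} {u : Node N}
    (h3 : D.mate (GenIdx.lo i) ≠ u) (h4 : D.mate (GenIdx.hi i) ≠ u)
    (h1 : GenIdx.lo i ≠ u) (h2 : GenIdx.hi i ≠ u) :
    (act i D).mate u = D.mate u ∧ (act i D).height u = D.height u := by
  have := act_cases i D u
  grind

theorem weight_act_self (i : GenIdx N) (D : ArcDiagram N) :
    weight X Y i (act i D) = X i.1 := by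
  rw [weight, if_pos (act_mate_lo i D), act_height_lo, stepProd_self, mul_one]

/-- In `act j D` the larger label at the nodes i, i+1 is j = i+1, so the product is empty. One step
later the larger label at j, j+1 is i, and the product from i to i+2 is the single factor `Y i`. -/
theorem weight_braid {i j : GenIdx N} (h : j.1 = i.1 + 1) (D : ArcDiagram N) :
    weight X Y i (act j D) = 1 ∧ weight X Y j (act i (act j D)) = Y i.1 := by
  have hij := hi_eq_lo h
  have n1 := GenIdx.lo_ne_hi i
  have n2 := GenIdx.lo_ne_hi j
  have n3 := lo_ne_hi_succ h
  have a1 := act_mate_lo j D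
  have a2 := act_mate_hi j D
  have a3 := act_height_lo j D
  have b1 := height_lo_le i (act j D)
  set E := act j D
  have e1 := E.mate_mate (GenIdx.lo i)
  have e2 := E.height_mate (GenIdx.lo i)
  have e3 := E.mate_ne (GenIdx.lo i)
  have f2 := act_cases i E (GenIdx.lo j)
  have f3 := act_cases i E (GenIdx.hi j)
  constructor
  · rw [weight, if_neg (by grind), hij, a3, max_eq_right (by omega), h, stepProd_self]
  · have g1 : (act i E).height (GenIdx.lo j) = i.1 := by rw [← hij]; exact act_height_hi i E
    have g2 : (act i E).height (GenIdx.hi j) ≤ i.1 := by grind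
    rw [weight, if_neg (by grind), g1, max_eq_left g2, h, stepProd_add_two]

/-! ### Weights of two distant generators, according to the arcs that link their nodes. -/

section Comm

variable {X Y} {i j : GenIdx N} {D : ArcDiagram N}

theorem weight_comm_unlinked (h : i.1 + 2 ≤ j.1 ∨ j.1 + 2 ≤ i.1)
    (h1 : D.mate (GenIdx.lo i) ≠ GenIdx.lo j) (h2 : D.mate (GenIdx.lo i) ≠ GenIdx.hi j)
    (h3 : D.mate (GenIdx.hi i) ≠ GenIdx.lo j) (h4 : D.mate (GenIdx.hi i) ≠ GenIdx.hi j) :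
    weight X Y i D * weight X Y j (act i D) = weight X Y j D * weight X Y i (act j D) := by
  obtain ⟨n1, n2, n3, n4⟩ := lo_hi_ne h
  have swap : ∀ {u v}, D.mate u ≠ v → D.mate v ≠ u := fun h e => h (by rw [← e, D.mate_mate])
  obtain ⟨e1, e2⟩ := act_at_other h1 h3 n1 n3
  obtain ⟨-, e3⟩ := act_at_other h2 h4 n2 n4
  obtain ⟨e4, e5⟩ := act_at_other (swap h1) (swap h2) n1.symm n2.symm
  obtain ⟨-, e6⟩ := act_at_other (swap h3) (swap h4) n3.symm n4.symm
  unfold weight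
  rw [e1, e2, e3, e4, e5, e6, mul_comm]

/-- Exactly one arc, with label b, links the pair of i to the pair of j; a and c are the labels at
the two remaining nodes. -/
theorem weight_comm_single (hA : D.mate (GenIdx.lo i) ≠ GenIdx.hi i)
    (hB : D.mate (GenIdx.lo j) ≠ GenIdx.hi j) {a b c : ℕ}
    (g1 : (act i D).mate (GenIdx.lo j) ≠ GenIdx.hi j)
    (g2 : (act j D).mate (GenIdx.lo i) ≠ GenIdx.hi i)
    (k1 : max (D.height (GenIdx.lo i)) (D.height (GenIdx.hi i)) = max a b)
    (k2 : max (D.height (GenIdx.lo j)) (D.height (GenIdx.hi j)) = max b c)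
    (k3 : max ((act i D).height (GenIdx.lo j)) ((act i D).height (GenIdx.hi j)) = max (min a b) c)
    (k4 : max ((act j D).height (GenIdx.lo i)) ((act j D).height (GenIdx.hi i)) =
      max a (min b c)) :
    weight X Y i D * weight X Y j (act i D) = weight X Y j D * weight X Y i (act j D) := by
  have p1 := (act_arc_parity D i hA).2
  have p2 := (act_arc_parity D j hB).2
  have b1 := height_lo_le i D
  have b2 := height_hi_le i D
  have b3 := height_lo_le j D
  have b4 := height_hi_le j D
  unfold weight
  rw [if_neg hA, if_neg hB, if_neg g1, if_neg g2, k1, k2, k3, k4]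
  rw [k1] at p1
  rw [k2] at p2
  exact stepProd_max Y p1 p2 (by omega) (by omega)

/-- Two arcs link the pairs, so the second generator closes a loop whose label is the minimum. The
minimum and the maximum have different parity, whence min + 1 ≤ max, and the exchange takes place at
the maximum. -/
theorem weight_comm_double (hA : D.mate (GenIdx.lo i) ≠ GenIdx.hi i)
    (hB : D.mate (GenIdx.lo j) ≠ GenIdx.hi j)
    (g1 : (act i D).mate (GenIdx.lo j) = GenIdx.hi j)
    (g2 : (act j D).mate (GenIdx.lo i) = GenIdx.hi i)
    (k1 : max (D.height (GenIdx.lo i)) (D.height (GenIdx.hi i)) =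
        max (D.height (GenIdx.lo j)) (D.height (GenIdx.hi j)))
    (k2 : (act i D).height (GenIdx.lo j) = min (D.height (GenIdx.lo j)) (D.height (GenIdx.hi j)))
    (k3 : (act j D).height (GenIdx.lo i) = min (D.height (GenIdx.lo j)) (D.height (GenIdx.hi j))) :
    weight X Y i D * weight X Y j (act i D) = weight X Y j D * weight X Y i (act j D) := by
  have p1 := (act_arc_parity D i hA).2
  have p2 := (act_arc_parity D j hB).2
  have b1 := height_lo_le i D
  have b2 := height_hi_le i D
  have b3 := height_lo_le j D
  have b4 := height_hi_le j D
  have r1 := (act i D).height_parity (GenIdx.lo j)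
  rw [g1, GenIdx.lo_abs, GenIdx.hi_abs, k2] at r1
  unfold weight
  rw [if_neg hA, if_neg hB, if_pos g1, if_pos g2, k1, k2, k3]
  rw [k1] at p1
  rw [mul_left_comm, mul_left_comm (stepProd Y _ (j.1 + 1))]
  congr 1
  exact stepProd_exchange Y (by omega) (by omega) (by omega) p1 p2

end Comm

theorem weight_comm {i j : GenIdx N} (h : i.1 + 2 ≤ j.1 ∨ j.1 + 2 ≤ i.1) (D : ArcDiagram N) :
    weight X Y i D * weight X Y j (act i D) = weight X Y j D * weight X Y i (act j D) := by
  obtain ⟨n1, n2, n3, n4⟩ := lo_hi_ne h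
  have n5 := GenIdx.lo_ne_hi i
  have n6 := GenIdx.lo_ne_hi j
  have swap : ∀ {u v}, D.mate u = v → D.mate v = u := fun e => by rw [← e, D.mate_mate]
  have uniq : ∀ {u v w}, D.mate u = v → v ≠ w → D.mate u ≠ w := fun e h e' => h (e.symm.trans e')
  have ht : ∀ {u v}, D.mate u = v → D.height u = D.height v := fun e => by
    rw [← e, D.height_mate]
  by_cases hA : D.mate (GenIdx.lo i) = GenIdx.hi i
  · exact weight_comm_unlinked h (uniq hA n3) (uniq hA n4) (uniq (swap hA) n1) (uniq (swap hA) n2)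
  by_cases hB : D.mate (GenIdx.lo j) = GenIdx.hi j
  · have s1 := swap hB
    exact weight_comm_unlinked h (fun e => n2 ((swap e).symm.trans hB))
      (fun e => n1 ((swap e).symm.trans s1)) (fun e => n4 ((swap e).symm.trans hB))
      (fun e => n3 ((swap e).symm.trans s1))
  by_cases h1 : D.mate (GenIdx.lo i) = GenIdx.lo j
  · have t1 := ht h1
    obtain ⟨x1, x2⟩ := act_at_mate_lo h1 n1 n3
    obtain ⟨y1, y2⟩ := act_at_mate_lo (swap h1) n1.symm n2.symm
    by_cases h2 : D.mate (GenIdx.hi i) = GenIdx.hi j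
    · have t2 := ht h2
      exact weight_comm_double hA hB (x1.trans h2) (y1.trans (swap h2)) (by rw [t1, t2])
        (by rw [x2, t1, t2]) y2
    · have s2 : D.mate (GenIdx.hi j) ≠ GenIdx.hi i := fun e => h2 (swap e)
      obtain ⟨-, x3⟩ := act_at_other (uniq h1 n6) h2 n2 n4
      obtain ⟨-, y3⟩ := act_at_other (uniq (swap h1) n5) s2 n3.symm n4.symm
      refine weight_comm_single (a := D.height (GenIdx.hi i)) (b := D.height (GenIdx.lo j))
        (c := D.height (GenIdx.hi j)) hA hB (by rwa [x1]) (by rwa [y1]) ?_ rfl ?_ ?_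
      · rw [t1, max_comm]
      · rw [x2, x3, t1, min_comm]
      · rw [y2, y3, max_comm]
  by_cases h2 : D.mate (GenIdx.lo i) = GenIdx.hi j
  · have t1 := ht h2
    obtain ⟨x1, x2⟩ := act_at_mate_lo h2 n2 n4
    obtain ⟨y1, y2⟩ := act_at_mate_hi (swap h2) n1.symm n2.symm
    by_cases h3 : D.mate (GenIdx.hi i) = GenIdx.lo j
    · have t2 := ht h3
      obtain ⟨z1, z2⟩ := act_at_mate_hi h3 n1 n3
      exact weight_comm_double hA hB (z1.trans h2) (y1.trans (swap h3))
        (by rw [t1, t2, max_comm]) (by rw [z2, t1, t2, min_comm]) y2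
    · have s2 : D.mate (GenIdx.lo j) ≠ GenIdx.hi i := fun e => h3 (swap e)
      obtain ⟨x4, x3⟩ := act_at_other h1 h3 n1 n3
      obtain ⟨-, y3⟩ := act_at_other s2 (uniq (swap h2) n5) n3.symm n4.symm
      refine weight_comm_single (a := D.height (GenIdx.hi i)) (b := D.height (GenIdx.hi j))
        (c := D.height (GenIdx.lo j)) hA hB (by rwa [x4]) (by rwa [y1]) ?_ (max_comm _ _) ?_ ?_
      · rw [t1, max_comm]
      · rw [x2, x3, t1, max_comm, min_comm]
      · rw [y2, y3, max_comm, min_comm]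
  by_cases h3 : D.mate (GenIdx.hi i) = GenIdx.lo j
  · have t1 := ht h3
    have s2 : D.mate (GenIdx.hi j) ≠ GenIdx.lo i := fun e => h2 (swap e)
    obtain ⟨x1, x2⟩ := act_at_mate_hi h3 n1 n3
    obtain ⟨-, x3⟩ := act_at_other h2 (uniq h3 n6) n2 n4
    obtain ⟨y1, y2⟩ := act_at_mate_lo (swap h3) n3.symm n4.symm
    obtain ⟨y4, y3⟩ := act_at_other (uniq (swap h3) n5.symm) s2 n1.symm n2.symm
    refine weight_comm_single (a := D.height (GenIdx.lo i)) (b := D.height (GenIdx.lo j))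
        (c := D.height (GenIdx.hi j)) hA hB (by rwa [x1]) (by rwa [y4]) ?_ rfl ?_ ?_
    · rw [t1]
    · rw [x2, x3, t1]
    · rw [y2, y3]
  by_cases h4 : D.mate (GenIdx.hi i) = GenIdx.hi j
  · have t1 := ht h4
    have s2 : D.mate (GenIdx.lo j) ≠ GenIdx.lo i := fun e => h1 (swap e)
    obtain ⟨x1, x2⟩ := act_at_mate_hi h4 n2 n4
    obtain ⟨x4, x3⟩ := act_at_other h1 h3 n1 n3
    obtain ⟨y1, y2⟩ := act_at_mate_hi (swap h4) n3.symm n4.symm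
    obtain ⟨y4, y3⟩ := act_at_other s2 (uniq (swap h4) n5.symm) n1.symm n2.symm
    refine weight_comm_single (a := D.height (GenIdx.lo i)) (b := D.height (GenIdx.hi j))
        (c := D.height (GenIdx.lo j)) hA hB (by rwa [x4]) (by rwa [y4]) ?_ (max_comm _ _) ?_ ?_
    · rw [t1]
    · rw [x2, x3, t1, max_comm]
    · rw [y2, y3, min_comm]
  exact weight_comm_unlinked h h1 h2 h3 h4

end ArcDiagram

end Weight

end Okada

namespace Okada

/-! ### The length of a diagram -/

namespace ArcDiagram

variable {N : ℕ}

/-- The sum of the labels over all the nodes. -/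
def htSum (D : ArcDiagram N) : ℕ := ∑ u, D.height u

theorem htSum_mirror (D : ArcDiagram N) : D.mirror.htSum = D.htSum :=
  Equiv.sum_comp (Equiv.sumComm (Fin N) (Fin N)) D.height

theorem htSum_act_of_mate {i : GenIdx N} {D : ArcDiagram N}
    (h : D.mate (GenIdx.lo i) = GenIdx.hi i) :
    (act i D).htSum + 2 * D.height (GenIdx.lo i) = D.htSum + 2 * i.1 := by
  have n := GenIdx.lo_ne_hi i
  have h2 := D.height_mate (GenIdx.lo i)
  rw [h] at h2
  have key : ∀ u, (act i D).height u + ((if u = GenIdx.lo i then D.height (GenIdx.lo i) else 0) +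
      (if u = GenIdx.hi i then D.height (GenIdx.lo i) else 0)) = D.height u +
      ((if u = GenIdx.lo i then i.1 else 0) + (if u = GenIdx.hi i then i.1 else 0)) := by
    intro u
    have := act_cases i D u
    have := (mate_hi_eq_iff i D).2 h
    grind
  have := Finset.sum_congr rfl fun u (_ : u ∈ Finset.univ) => key u
  simp only [Finset.sum_add_distrib, Finset.sum_ite_eq', Finset.mem_univ, if_true] at this
  unfold htSum
  omega

/-- Four nodes with labels h, h, k, k receive i, i, min h k, min h k. -/
theorem htSum_act_of_ne {i : GenIdx N} {D : ArcDiagram N}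
    (h : D.mate (GenIdx.lo i) ≠ GenIdx.hi i) :
    (act i D).htSum + 2 * max (D.height (GenIdx.lo i)) (D.height (GenIdx.hi i)) =
      D.htSum + 2 * i.1 := by
  have n := GenIdx.lo_ne_hi i
  have h1 := D.height_mate (GenIdx.lo i)
  have h2 := D.height_mate (GenIdx.hi i)
  have h3 : D.mate (GenIdx.hi i) ≠ GenIdx.lo i := (mate_hi_eq_iff i D).not.2 h
  have h4 := D.mate_ne (GenIdx.lo i)
  have h5 := D.mate_ne (GenIdx.hi i)
  have h6 : D.mate (GenIdx.lo i) ≠ D.mate (GenIdx.hi i) := fun e => n (D.mate_injective e)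
  have c := act_cases i D
  generalize GenIdx.lo i = p at *
  generalize GenIdx.hi i = q at *
  have key : ∀ u, (act i D).height u +
      (((if u = p then D.height p else 0) + (if u = q then D.height q else 0)) +
      ((if u = D.mate p then D.height p else 0) + (if u = D.mate q then D.height q else 0))) =
      D.height u +
      (((if u = p then i.1 else 0) + (if u = q then i.1 else 0)) +
      ((if u = D.mate p then min (D.height p) (D.height q) else 0) +
        (if u = D.mate q then min (D.height p) (D.height q) else 0))) := by
    intro u
    rcases c u with c | c | c | c | c
    · obtain ⟨rfl, -, e⟩ := c
      rw [e, if_pos rfl, if_pos rfl, if_neg n, if_neg n, if_neg h4.symm, if_neg h4.symm,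
        if_neg h3.symm, if_neg h3.symm]
      omega
    · obtain ⟨rfl, -, -, e⟩ := c
      rw [e, if_pos rfl, if_pos rfl, if_neg n.symm, if_neg n.symm, if_neg h5.symm,
        if_neg h5.symm, if_neg h.symm, if_neg h.symm]
      omega
    · obtain ⟨rfl, c1, c2, -, e⟩ := c
      rw [e, if_neg c1, if_neg c1, if_neg c2, if_neg c2, if_pos rfl, if_pos rfl, if_neg h6,
        if_neg h6, h1]
      omega
    · obtain ⟨rfl, c1, c2, c3, -, e⟩ := c
      rw [e, if_neg c1, if_neg c1, if_neg c2, if_neg c2, if_pos rfl, if_pos rfl, if_neg c3,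
        if_neg c3, h2]
      omega
    · obtain ⟨c1, c2, c3, c4, -, e⟩ := c
      rw [e, if_neg c1, if_neg c1, if_neg c2, if_neg c2, if_neg c3, if_neg c3, if_neg c4,
        if_neg c4]
  have := Finset.sum_congr rfl fun u (_ : u ∈ Finset.univ) => key u
  simp only [Finset.sum_add_distrib, Finset.sum_ite_eq', Finset.mem_univ, if_true] at this
  unfold htSum
  omega

/-- The label at i+1 is at most i+1 and the label at i at most i, so the larger exceeds i by at most
1. Equality means that node i+1 has its largest possible label. -/
theorem htSum_le_act (i : GenIdx N) (D : ArcDiagram N) : D.htSum ≤ (act i D).htSum + 2 := by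
  have b1 := height_lo_le i D
  have b2 := height_hi_le i D
  by_cases h : D.mate (GenIdx.lo i) = GenIdx.hi i
  · have := htSum_act_of_mate h
    omega
  · have := htSum_act_of_ne h
    omega

theorem weight_eq_one {K : Type*} [Field K] (X Y : ℕ → K) {i : GenIdx N} {D : ArcDiagram N}
    (h : D.htSum = (act i D).htSum + 2) : weight X Y i D = 1 := by
  have b1 := height_lo_le i D
  have b2 := height_hi_le i D
  by_cases h' : D.mate (GenIdx.lo i) = GenIdx.hi i
  · have := htSum_act_of_mate h'
    omega
  · have := htSum_act_of_ne h'
    rw [weight, if_neg h', show max (D.height (GenIdx.lo i)) (D.height (GenIdx.hi i)) = i.1 + 1 by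
      omega, stepProd_self]

theorem htSum_id_le (w : List (GenIdx N)) :
    (ArcDiagram.id N).htSum ≤ (ofWord w).htSum + 2 * w.length := by
  induction w with
  | nil => exact le_rfl
  | cons i w ih =>
    have := htSum_le_act i (ofWord w)
    have h : ofWord (i :: w) = act i (ofWord w) := rfl
    rw [h, List.length_cons]
    omega

end ArcDiagram

open ArcDiagram

/-! ### The regular representation -/

section Representation

variable {K : Type*} [Field K] {N : ℕ} (X Y : ℕ → K)

/-- The operator of the generator `E_i` on the formal combinations of diagrams. -/
noncomputable def genOp (i : GenIdx N) : (ArcDiagram N →₀ K) →ₗ[K] (ArcDiagram N →₀ K) :=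
  Finsupp.linearCombination K fun D => Finsupp.single (act i D) (weight X Y i D)

theorem genOp_single (i : GenIdx N) (D : ArcDiagram N) (c : K) :
    genOp X Y i (Finsupp.single D c) = Finsupp.single (act i D) (c * weight X Y i D) := by
  rw [genOp, Finsupp.linearCombination_single, Finsupp.smul_single, smul_eq_mul]

/-- The generator `E_i` of the Okada algebra. -/
def gen (i : GenIdx N) : OkadaAlgebra K N X Y :=
  RingQuot.mkAlgHom K (OkadaRel K N X Y) (FreeAlgebra.ι K i)

/-- The product of generators along a word. -/
def wordProd (w : List (GenIdx N)) : OkadaAlgebra K N X Y := (w.map (gen X Y)).prod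

theorem permElt_eq (σ : Equiv.Perm (Fin N)) : permElt X Y σ = wordProd X Y (permWord σ) := rfl

theorem gen_mul_self (i : GenIdx N) : gen X Y i * gen X Y i = X i.1 • gen X Y i := by
  have := RingQuot.mkAlgHom_rel K (OkadaRel.idem (K := K) (X := X) (Y := Y) i)
  simp only [map_mul, map_smul] at this
  exact this

theorem gen_comm {i j : GenIdx N} (h : i.1 + 2 ≤ j.1 ∨ j.1 + 2 ≤ i.1) :
    gen X Y i * gen X Y j = gen X Y j * gen X Y i := by
  have := RingQuot.mkAlgHom_rel K (OkadaRel.comm (K := K) (X := X) (Y := Y) i j h)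
  simp only [map_mul] at this
  exact this

theorem gen_braid {i j : GenIdx N} (h : j.1 = i.1 + 1) :
    gen X Y j * gen X Y i * gen X Y j = Y i.1 • gen X Y j := by
  have := RingQuot.mkAlgHom_rel K (OkadaRel.succ (K := K) (X := X) (Y := Y) i j h)
  simp only [map_mul, map_smul] at this
  exact this

/-- The universal property of the Okada algebra. -/
noncomputable def okadaLift {A : Type*} [Ring A] [Algebra K A] (f : GenIdx N → A)
    (h1 : ∀ i, f i * f i = X i.1 • f i)
    (h2 : ∀ i j : GenIdx N, i.1 + 2 ≤ j.1 ∨ j.1 + 2 ≤ i.1 → f i * f j = f j * f i)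
    (h3 : ∀ i j : GenIdx N, j.1 = i.1 + 1 → f j * f i * f j = Y i.1 • f j) :
    OkadaAlgebra K N X Y →ₐ[K] A :=
  RingQuot.liftAlgHom K ⟨FreeAlgebra.lift K f, by
    intro a b h
    induction h with
    | idem i => simpa using h1 i
    | comm i j h => simpa using h2 i j h
    | succ i j h => simpa using h3 i j h⟩

theorem okadaLift_gen {A : Type*} [Ring A] [Algebra K A] (f : GenIdx N → A)
    (h1 : ∀ i, f i * f i = X i.1 • f i)
    (h2 : ∀ i j : GenIdx N, i.1 + 2 ≤ j.1 ∨ j.1 + 2 ≤ i.1 → f i * f j = f j * f i)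
    (h3 : ∀ i j : GenIdx N, j.1 = i.1 + 1 → f j * f i * f j = Y i.1 • f j) (i : GenIdx N) :
    okadaLift X Y f h1 h2 h3 (gen X Y i) = f i := by
  simp [okadaLift, gen]

theorem adjoin_range_gen : Algebra.adjoin K (Set.range (gen (N := N) X Y)) = ⊤ := by
  have h : Set.range (gen (N := N) X Y) =
      RingQuot.mkAlgHom K (OkadaRel K N X Y) '' Set.range (FreeAlgebra.ι K) := by
    rw [← Set.range_comp]
    rfl
  rw [h, ← AlgHom.map_adjoin, FreeAlgebra.adjoin_range_ι, Algebra.map_top,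
    AlgHom.range_eq_top]
  exact RingQuot.mkAlgHom_surjective K (OkadaRel K N X Y)

/-- The action of the Okada algebra on the formal combinations of diagrams. -/
noncomputable def rep : OkadaAlgebra K N X Y →ₐ[K] Module.End K (ArcDiagram N →₀ K) :=
  okadaLift X Y (genOp X Y)
    (fun i => Finsupp.lhom_ext fun D c => by
      rw [Module.End.mul_apply, LinearMap.smul_apply]
      simp only [genOp_single]
      rw [act_act_self, weight_act_self, Finsupp.smul_single, smul_eq_mul, mul_comm])
    (fun i j h => Finsupp.lhom_ext fun D c => by
      rw [Module.End.mul_apply, Module.End.mul_apply]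
      simp only [genOp_single]
      rw [act_comm h, mul_assoc, mul_assoc, weight_comm X Y h])
    (fun i j h => Finsupp.lhom_ext fun D c => by
      rw [Module.End.mul_apply, Module.End.mul_apply, LinearMap.smul_apply]
      simp only [genOp_single]
      rw [act_act_act h, (weight_braid X Y h D).1, (weight_braid X Y h D).2,
        Finsupp.smul_single, smul_eq_mul, mul_one, mul_comm])

/-- The vector of an element of the Okada algebra in the regular representation. -/
noncomputable def vec : OkadaAlgebra K N X Y →ₗ[K] (ArcDiagram N →₀ K) :=
  (LinearMap.applyₗ (Finsupp.single (ArcDiagram.id N) 1)).comp (rep X Y).toLinearMap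

theorem vec_one : vec X Y (1 : OkadaAlgebra K N X Y) = Finsupp.single (ArcDiagram.id N) 1 := by
  simp [vec]

theorem vec_gen_mul (i : GenIdx N) (a : OkadaAlgebra K N X Y) :
    vec X Y (gen X Y i * a) = genOp X Y i (vec X Y a) := by
  simp [vec, rep, okadaLift_gen]

/-- A word is reduced if its length is the length of its diagram. -/
def IsReduced (w : List (GenIdx N)) : Prop :=
  (ArcDiagram.id N).htSum = (ofWord w).htSum + 2 * w.length

/-- Each letter lowers `htSum` by at most 2, so in a reduced word each letter lowers it by exactly 2
and contributes weight 1. -/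
theorem vec_wordProd_of_isReduced {w : List (GenIdx N)} (h : IsReduced w) :
    vec X Y (wordProd X Y w) = Finsupp.single (ofWord w) 1 := by
  induction w with
  | nil => exact vec_one X Y
  | cons i w ih =>
    have h1 : ofWord (i :: w) = act i (ofWord w) := rfl
    have h2 := htSum_id_le w
    have h3 := htSum_le_act i (ofWord w)
    rw [IsReduced, h1, List.length_cons] at h
    have : wordProd X Y (i :: w) = gen X Y i * wordProd X Y w := by simp [wordProd]
    rw [this, vec_gen_mul, ih (by unfold IsReduced; omega), genOp_single,
      weight_eq_one X Y (by omega), mul_one]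
    rfl

theorem IsReduced.reverse {w : List (GenIdx N)} (h : IsReduced w) : IsReduced w.reverse := by
  rw [IsReduced, ofWord_reverse, htSum_mirror, List.length_reverse]
  exact h

end Representation

end Okada

namespace Okada

namespace ArcDiagram

variable {N : ℕ}

/-! ### Every diagram has a reduced word -/

/-- The first `k` left nodes have the largest possible labels. -/
def OpenTo (D : ArcDiagram N) (k : ℕ) : Prop := ∀ u : Node N, u.pos ≤ k → D.height u = u.pos

theorem lt_mate_of_height_eq {D : ArcDiagram N} {u : Node N} (h : D.height u = u.pos) :
    u.pos < (D.mate u).pos := by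
  have := (D.height_le_pos u).2
  have := D.mate_pos_ne u
  omega

/-- A node whose label equals its position opens its arc, because a label is at most the position of
either end. So no arc joins two left nodes, and the non-crossing bijection from left to right is
monotone, hence the identity. -/
theorem eq_id_of_openTo {D : ArcDiagram N} (h : D.OpenTo N) : D = ArcDiagram.id N := by
  have hr : ∀ a : Fin N, ∃ b, D.mate (Sum.inl a) = Sum.inr b := by
    intro a
    cases e : D.mate (Sum.inl a) with
    | inr b => exact ⟨b, rfl⟩
    | inl b =>
      have h1 := lt_mate_of_height_eq (h (Sum.inl a) (by simp only [Node.pos]; omega))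
      have h2 := lt_mate_of_height_eq (h (Sum.inl b) (by simp only [Node.pos]; omega))
      rw [← e, D.mate_mate] at h2
      omega
  choose f hf using hr
  have hmono : StrictMono f := by
    intro a b hab
    have h1 := D.inside (u := Sum.inl a) (v := Sum.inl b) (by simp only [Node.pos]; omega)
      (by rw [hf]; simp only [Node.pos]; omega)
    rw [hf, hf] at h1
    simp only [Node.pos] at h1
    rw [Fin.lt_def]
    omega
  have hfid : f = _root_.id := by
    apply (hmono.range_inj strictMono_id).1
    rw [Set.range_id]
    exact (Finite.injective_iff_surjective.1 hmono.injective).range_eq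
  subst hfid
  apply ArcDiagram.ext <;> funext u
  · rcases u with a | a
    · exact hf a
    · change D.mate (Sum.inr a) = Sum.inl a
      rw [← D.mate_mate (Sum.inl a), hf]
      rfl
  · rcases u with a | a
    · exact h (Sum.inl a) (by simp only [Node.pos]; omega)
    · have := h (Sum.inl a) (by simp only [Node.pos]; omega)
      rw [← D.height_mate, hf] at this
      exact this

/-- The first left arc which ends on the left. -/
theorem exists_first_arc {D : ArcDiagram N} (h : D ≠ ArcDiagram.id N) :
    ∃ i : GenIdx N, D.OpenTo i.1 ∧ D.mate (GenIdx.lo i) = GenIdx.hi i := by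
  classical
  have hex : ∃ k, k ≤ N ∧ ¬ D.OpenTo k := ⟨N, le_rfl, fun e => h (eq_id_of_openTo e)⟩
  obtain ⟨hk, hno⟩ := Nat.find_spec hex
  have hmin := fun m => Nat.find_min hex (m := m)
  generalize Nat.find hex = k at *
  -- At position 1 the label is forced to be 1, so the first failure is later.
  have hk2 : 2 ≤ k := by
    by_contra hlt
    apply hno
    intro u hu
    have := Node.pos_abs u
    have := D.one_le_height u
    have := (D.height_le_pos u).1
    omega
  have hop : D.OpenTo (k - 1) := by
    have := hmin (k - 1) (by omega)
    by_contra hc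
    exact this ⟨by omega, hc⟩
  refine ⟨⟨k - 1, by omega⟩, hop, ?_⟩
  set i : GenIdx N := ⟨k - 1, by omega⟩ with hi
  have pl : (GenIdx.lo i).pos = k - 1 := GenIdx.pos_lo i
  have ph : (GenIdx.hi i).pos = k := by rw [GenIdx.pos_hi, hi]; simp only; omega
  -- If i were not matched with i+1, then i+1 would lie below the arc of i; its label would exceed i
  -- and so equal i+1, and the prefix would extend to k.
  by_contra hne
  apply hno
  intro u hu
  by_cases hu' : u.pos ≤ k - 1
  · exact hop u hu'
  · have hu2 : u = GenIdx.hi i := Node.pos_injective (by omega)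
    subst hu2
    have h1 := hop _ pl.le
    have h2 := lt_mate_of_height_eq h1
    have h3 := Node.pos_ne hne
    have h4 := D.nested_lt (u := GenIdx.hi i) (v := GenIdx.lo i) (by omega) (by omega)
    have := (D.height_le_pos (GenIdx.hi i)).1
    omega

/-- The first node to the right of the arc `{i, i + 1}` whose label is at most `i`. -/
structure IsCutNode (D : ArcDiagram N) (i : GenIdx N) (v : Node N) : Prop where
  pos_lt : i.1 + 1 < v.pos
  height_le : D.height v ≤ i.1
  lt_height : ∀ u : Node N, i.1 + 1 < u.pos → u.pos < v.pos → i.1 < D.height u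

theorem exists_isCutNode (D : ArcDiagram N) (i : GenIdx N) : ∃ v, IsCutNode D i v := by
  classical
  have hi := i.2
  have hex : ∃ k, ∃ v : Node N, v.pos = k ∧ i.1 + 1 < v.pos ∧ D.height v ≤ i.1 := by
    -- The last position carries the right node with number 1, whose label is 1.
    obtain ⟨v, hv⟩ := Node.exists_pos (N := N) (k := 2 * N) (by omega) le_rfl
    refine ⟨_, v, rfl, by omega, ?_⟩
    have := D.height_le v
    have := Node.pos_abs v
    omega
  obtain ⟨v, h1, h2, h3⟩ := Nat.find_spec hex
  refine ⟨v, h2, h3, fun u hu hu' => ?_⟩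
  by_contra hc
  exact Nat.find_min hex (m := u.pos) (by omega) ⟨u, rfl, hu, by omega⟩

/-! ### Cutting the arc {i, i+1}: a preimage under `act i`. -/

section Cut

variable {D : ArcDiagram N} {i : GenIdx N} {v : Node N}

/-- The arc of the cut node starts after `i + 1` with label `i`, or it is the arc of `i - 1`. -/
theorem IsCutNode.cases (hv : IsCutNode D i v) (ho : D.OpenTo i.1)
    (hm : D.mate (GenIdx.lo i) = GenIdx.hi i) :
    (v.pos < (D.mate v).pos ∧ D.height v = i.1) ∨
      ((D.mate v).pos + 1 = i.1 ∧ D.height v + 1 = i.1) := by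
  have hi := i.2
  have pl := GenIdx.pos_lo i
  have ph := GenIdx.pos_hi i
  have hh := D.one_le_height v
  have hvl := hv.pos_lt
  have hvh := hv.height_le
  -- The node i-1 opens an arc with label i-1. This arc cannot end at i or i+1, nor before v, where
  -- the labels exceed i; so it reaches v or passes over it. In the first case below v closes an
  -- arc, and non-crossing leaves only i-1 as its mate; in the second v opens an arc below that of
  -- i-1, so its label is i.
  have prev : ∀ w : Node N, w.pos + 1 = i.1 → v.pos ≤ (D.mate w).pos ∧ D.height w = w.pos := by
    intro w hw
    have h1 := ho w (by omega)
    refine ⟨?_, h1⟩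
    by_contra hc
    have h2 := lt_mate_of_height_eq h1
    have h3 := D.height_mate w
    have h4 : D.mate w ≠ GenIdx.lo i := fun e => by
      have := congrArg D.mate e
      rw [hm, D.mate_mate] at this
      rw [this] at hw
      omega
    have h5 : D.mate w ≠ GenIdx.hi i := fun e => by
      rw [← hm] at e
      have := D.mate_injective e
      rw [this] at hw
      omega
    have h4 := Node.pos_ne h4
    have h5 := Node.pos_ne h5
    have := hv.lt_height (D.mate w) (by omega) (by omega)
    omega
  rcases lt_or_gt_of_ne (D.mate_pos_ne v) with h | h
  · right
    have h1 : D.mate v ≠ GenIdx.lo i := fun e => by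
      have := congrArg D.mate e
      rw [hm, D.mate_mate] at this
      rw [this] at hvl
      omega
    have h2 : D.mate v ≠ GenIdx.hi i := fun e => by
      rw [← hm] at e
      have := D.mate_injective e
      rw [this] at hvl
      omega
    have h1 := Node.pos_ne h1
    have h2 := Node.pos_ne h2
    have h3 : (D.mate v).pos < i.1 := by
      by_contra hc
      have := hv.lt_height (D.mate v) (by omega) h
      rw [D.height_mate] at this
      omega
    obtain ⟨w, hw⟩ := Node.exists_pos (N := N) (k := i.1 - 1)
      (by have := Node.pos_abs (D.mate v); omega) (by omega)
    obtain ⟨h4, h5⟩ := prev w (by omega)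
    rcases Nat.lt_or_ge (D.mate v).pos w.pos with h6 | h6
    · have := D.inside (u := D.mate v) (v := w) h6 (by rw [D.mate_mate]; omega)
      rw [D.mate_mate] at this
      omega
    · have : D.mate v = w := Node.pos_injective (by omega)
      rw [← D.height_mate v, this, h5]
      omega
  · left
    refine ⟨h, ?_⟩
    by_cases hi1 : i.1 = 1
    · omega
    · obtain ⟨w, hw⟩ := Node.exists_pos (N := N) (k := i.1 - 1) (by omega) (by omega)
      obtain ⟨h4, h5⟩ := prev w (by omega)
      have h6 : v.pos ≠ (D.mate w).pos := by
        refine Node.pos_ne fun e => ?_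
        rw [e, D.mate_mate] at h
        rw [e] at hvl
        omega
      have := D.nested_lt (u := v) (v := w) (by omega) (by omega)
      omega

/-- A mate at a position at most i would force a label at most i, the node i+1 is taken by i, the
node v has a label that is too small, and an arc passing over v would have a smaller label than v.
-/
theorem IsCutNode.mate_between (hv : IsCutNode D i v)
    (hm : D.mate (GenIdx.lo i) = GenIdx.hi i) {u : Node N} (h1 : i.1 + 1 < u.pos)
    (h2 : u.pos < v.pos) : i.1 + 1 < (D.mate u).pos ∧ (D.mate u).pos < v.pos := by
  have pl := GenIdx.pos_lo i
  have ph := GenIdx.pos_hi i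
  have hu := hv.lt_height u h1 h2
  have hvh := hv.height_le
  have h3 : D.mate u ≠ GenIdx.hi i := fun e => by
    rw [← hm] at e
    have := D.mate_injective e
    rw [this] at h1
    omega
  have h3 := Node.pos_ne h3
  have h4 : D.mate u ≠ v := fun e => by
    have := D.height_mate u
    rw [e] at this
    omega
  have h4 := Node.pos_ne h4
  have h5 : i.1 < (D.mate u).pos := by
    by_contra hc
    have := (D.height_le_pos u).2
    omega
  refine ⟨by omega, ?_⟩
  by_contra hc
  have := D.nested_lt (u := v) (v := u) h2 (by omega)
  omega

/-- The labels between `i + 1` and the cut node are at least `i + 2`. -/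
theorem IsCutNode.succ_lt_height (hv : IsCutNode D i v)
    (hm : D.mate (GenIdx.lo i) = GenIdx.hi i) {u : Node N} (h1 : i.1 + 1 < u.pos)
    (h2 : u.pos < v.pos) : i.1 + 1 < D.height u := by
  classical
  by_contra hc
  have hex : ∃ k, ∃ w : Node N, w.pos = k ∧ i.1 + 1 < w.pos ∧ w.pos < v.pos ∧
      D.height w ≤ i.1 + 1 := ⟨_, u, rfl, h1, h2, by omega⟩
  obtain ⟨w, h3, h4, h5, h6⟩ := Nat.find_spec hex
  have hmin : ∀ x : Node N, i.1 + 1 < x.pos → x.pos < w.pos → i.1 + 1 < D.height x := by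
    intro x hx hx'
    by_contra hc
    exact Nat.find_min hex (m := x.pos) (by omega) ⟨x, rfl, hx, by omega, by omega⟩
  have h7 := hv.lt_height w h4 h5
  have h8 := hv.mate_between hm h4 h5
  have h9 : w.pos < (D.mate w).pos := by
    have := D.mate_pos_ne w
    by_contra hc
    have := hmin (D.mate w) h8.1 (by omega)
    rw [D.height_mate] at this
    omega
  -- `w` is the first node with label exactly i+1. The arcs before it stay strictly between i+1 and
  -- `w`, so their number of nodes is even and `w` has a position ≡ i. As `w` opens its arc, its
  -- label has the parity of its position, a contradiction.
  have h10 := D.even_of_closed (s := i.1 + 1) (t := w.pos) h4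
    (by have := Node.pos_abs w; omega) (by
      intro x hx hx'
      have h11 := hv.mate_between hm hx (by omega)
      refine ⟨h11.1, ?_⟩
      by_contra hc
      have h12 := hmin x hx hx'
      have h13 : w.pos ≠ (D.mate x).pos := Node.pos_ne fun e => by
        rw [e, D.height_mate] at h6
        omega
      have := D.nested_lt (u := w) (v := x) hx' (by omega)
      omega)
  have h11 := D.mate_parity w
  have h12 := D.height_parity w
  have h13 := Node.pos_abs w
  have h14 := Node.pos_abs (D.mate w)
  omega

/-- Needed for an arc {i+1, v} with label i+1 to be legal. Otherwise the node just before v has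
absolute value at most i+1 but a label of at least i+2. -/
theorem IsCutNode.lt_abs (hv : IsCutNode D i v)
    (hm : D.mate (GenIdx.lo i) = GenIdx.hi i) : i.1 + 1 ≤ v.abs := by
  have h1 := hv.pos_lt
  have h2 := Node.pos_abs v
  have hi := i.2
  by_contra hc
  obtain ⟨w, hw⟩ := Node.exists_pos (N := N) (k := v.pos - 1) (by omega) (by omega)
  have h3 := Node.pos_abs w
  have h4 := hv.succ_lt_height hm (u := w) (by omega) (by omega)
  have h5 := D.height_le w
  omega

theorem IsCutNode.ne (hv : IsCutNode D i v) (hm : D.mate (GenIdx.lo i) = GenIdx.hi i) :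
    v ≠ GenIdx.lo i ∧ v ≠ GenIdx.hi i ∧ D.mate v ≠ GenIdx.lo i ∧ D.mate v ≠ GenIdx.hi i := by
  have pl := GenIdx.pos_lo i
  have ph := GenIdx.pos_hi i
  have h := hv.pos_lt
  have h1 : v ≠ GenIdx.lo i := fun e => by rw [e] at h; omega
  have h2 : v ≠ GenIdx.hi i := fun e => by rw [e] at h; omega
  refine ⟨h1, h2, fun e => h2 ?_, fun e => h1 ?_⟩
  · rw [← hm, ← e, D.mate_mate]
  · rw [← D.mate_mate v, e, ← hm, D.mate_mate]

/-- The labels of the diagram with the arcs `{i, i + 1}` and `{v, mate v}` cut. -/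
def cutHeight (D : ArcDiagram N) (i : GenIdx N) (v u : Node N) : ℕ :=
  if u = GenIdx.lo i ∨ u = D.mate v then D.height v else
    if u = GenIdx.hi i ∨ u = v then i.1 + 1 else D.height u

theorem IsCutNode.cut_cases (hv : IsCutNode D i v)
    (hm : D.mate (GenIdx.lo i) = GenIdx.hi i) (u : Node N) :
    (u = GenIdx.lo i ∧ joinMate D.mate (GenIdx.lo i) (D.mate v) u = D.mate v ∧
      cutHeight D i v u = D.height v) ∨
    (u = D.mate v ∧ joinMate D.mate (GenIdx.lo i) (D.mate v) u = GenIdx.lo i ∧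
      cutHeight D i v u = D.height v) ∨
    (u = GenIdx.hi i ∧ joinMate D.mate (GenIdx.lo i) (D.mate v) u = v ∧
      cutHeight D i v u = i.1 + 1) ∨
    (u = v ∧ joinMate D.mate (GenIdx.lo i) (D.mate v) u = GenIdx.hi i ∧
      cutHeight D i v u = i.1 + 1) ∨
    ((u ≠ GenIdx.lo i ∧ u ≠ D.mate v ∧ u ≠ GenIdx.hi i ∧ u ≠ v) ∧
      joinMate D.mate (GenIdx.lo i) (D.mate v) u = D.mate u ∧
      cutHeight D i v u = D.height u) := by
  have h1 := hv.ne hm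
  have h2 := joinMate_cases D.mate (GenIdx.lo i) (D.mate v) u
  have h3 := GenIdx.lo_ne_hi i
  have h4 := D.mate_mate v
  have h5 := D.mate_ne v
  unfold cutHeight
  grind

/-- The position of an arc which is not cut. -/
theorem IsCutNode.other (hv : IsCutNode D i v) (hm : D.mate (GenIdx.lo i) = GenIdx.hi i)
    {u : Node N} (hu : u ≠ GenIdx.lo i ∧ u ≠ D.mate v ∧ u ≠ GenIdx.hi i ∧ u ≠ v) :
    (u.pos < i.1 ∨ i.1 + 1 < u.pos) ∧ ((D.mate u).pos < i.1 ∨ i.1 + 1 < (D.mate u).pos) ∧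
    (i.1 + 1 < u.pos ∧ u.pos < v.pos ↔ i.1 + 1 < (D.mate u).pos ∧ (D.mate u).pos < v.pos) ∧
    u.pos ≠ v.pos ∧ (D.mate u).pos ≠ v.pos ∧ u.pos ≠ (D.mate v).pos ∧
    (D.mate u).pos ≠ (D.mate v).pos ∧ u.pos ≠ (D.mate u).pos ∧
    (v.pos < u.pos ∧ u.pos < (D.mate v).pos ↔
      v.pos < (D.mate u).pos ∧ (D.mate u).pos < (D.mate v).pos) := by
  obtain ⟨u1, u2, u3, u4⟩ := hu
  have pl := GenIdx.pos_lo i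
  have ph := GenIdx.pos_hi i
  have u5 : D.mate u ≠ GenIdx.lo i := fun e => u3 (by rw [← hm, ← e, D.mate_mate])
  have u6 : D.mate u ≠ GenIdx.hi i := fun e => u1 (D.mate_injective (e.trans hm.symm))
  have f1 := Node.pos_ne u1
  have f2 := Node.pos_ne u3
  have f3 := Node.pos_ne u5
  have f4 := Node.pos_ne u6
  obtain ⟨g1, g2, g3, g4, g5, g6, g7, g8⟩ := D.arcs_cases u4 u2
  refine ⟨by omega, by omega, ⟨fun h => hv.mate_between hm h.1 h.2, fun h => ?_⟩, g1, g3, g2, g4,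
    (D.mate_pos_ne u).symm, ⟨g5, g7⟩⟩
  have := hv.mate_between hm h.1 h.2
  rwa [D.mate_mate] at this

theorem IsCutNode.cut_noncrossing (hv : IsCutNode D i v) (ho : D.OpenTo i.1)
    (hm : D.mate (GenIdx.lo i) = GenIdx.hi i) (x y : Node N) (h1 : x.pos < y.pos)
    (h2 : y.pos < (joinMate D.mate (GenIdx.lo i) (D.mate v) x).pos)
    (h3 : (joinMate D.mate (GenIdx.lo i) (D.mate v) x).pos <
      (joinMate D.mate (GenIdx.lo i) (D.mate v) y).pos) : False := by
  have pl := GenIdx.pos_lo i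
  have ph := GenIdx.pos_hi i
  have p1 := hv.pos_lt
  have hc := hv.cases ho hm
  rcases hv.cut_cases hm x with ⟨rfl, e, -⟩ | ⟨rfl, e, -⟩ | ⟨rfl, e, -⟩ | ⟨rfl, e, -⟩ |
    ⟨hx, e, -⟩ <;> rw [e] at h2 h3 <;>
  rcases hv.cut_cases hm y with ⟨rfl, e', -⟩ | ⟨rfl, e', -⟩ | ⟨rfl, e', -⟩ | ⟨rfl, e', -⟩ |
    ⟨hy, e', -⟩ <;> rw [e'] at h3 <;>
  first
  | omega
  | (have := hv.other hm hx; omega)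
  | (have := hv.other hm hy; omega)
  | exact D.noncrossing x y ⟨h1, h2, h3⟩

theorem IsCutNode.cut_height_nested (hv : IsCutNode D i v) (ho : D.OpenTo i.1)
    (hm : D.mate (GenIdx.lo i) = GenIdx.hi i) (x y : Node N) (h1 : y.pos < x.pos)
    (h2 : x.pos < (joinMate D.mate (GenIdx.lo i) (D.mate v) x).pos)
    (h3 : (joinMate D.mate (GenIdx.lo i) (D.mate v) x).pos <
      (joinMate D.mate (GenIdx.lo i) (D.mate v) y).pos) :
    cutHeight D i v y < cutHeight D i v x := by
  have pl := GenIdx.pos_lo i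
  have ph := GenIdx.pos_hi i
  have p1 := hv.pos_lt
  have hc := hv.cases ho hm
  have mid := fun h h' => hv.succ_lt_height hm (u := x) h h'
  have top := D.height_le_pos y
  have nest := D.nested_cases x v
  have hh := hv.height_le
  rcases hv.cut_cases hm x with ⟨rfl, e, f⟩ | ⟨rfl, e, f⟩ | ⟨rfl, e, f⟩ | ⟨rfl, e, f⟩ |
    ⟨hx, e, f⟩ <;> rw [e] at h2 h3 <;> rw [f] <;>
  rcases hv.cut_cases hm y with ⟨rfl, e', f'⟩ | ⟨rfl, e', f'⟩ | ⟨rfl, e', f'⟩ | ⟨rfl, e', f'⟩ |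
    ⟨hy, e', f'⟩ <;> rw [e'] at h3 <;> rw [f'] <;>
  first
  | exact D.height_nested x y h1 h2 h3
  | omega
  | (have := hv.other hm hx; omega)

theorem IsCutNode.cutHeight_le (hv : IsCutNode D i v)
    (hm : D.mate (GenIdx.lo i) = GenIdx.hi i) (u : Node N) : cutHeight D i v u ≤ u.abs := by
  have pl := GenIdx.lo_abs i
  have ph := GenIdx.hi_abs i
  have h1 := D.height_le v
  have h2 := D.height_le u
  have h3 := hv.height_le
  have h4 := hv.lt_abs hm
  rcases hv.cut_cases hm u with ⟨rfl, e, f⟩ | ⟨rfl, e, f⟩ | ⟨rfl, e, f⟩ | ⟨rfl, e, f⟩ |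
    ⟨hx, e, f⟩ <;> rw [f] <;> omega

theorem IsCutNode.cutHeight_mate (hv : IsCutNode D i v)
    (hm : D.mate (GenIdx.lo i) = GenIdx.hi i) (u : Node N) :
    cutHeight D i v (joinMate D.mate (GenIdx.lo i) (D.mate v) u) = cutHeight D i v u := by
  have h1 := hv.ne hm
  have h2 := D.mate_ne v
  have h3 := GenIdx.lo_ne_hi i
  rcases hv.cut_cases hm u with ⟨rfl, e, f⟩ | ⟨rfl, e, f⟩ | ⟨rfl, e, f⟩ | ⟨rfl, e, f⟩ |
    ⟨hx, e, f⟩ <;> rw [f, e]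
  · simp [cutHeight]
  · simp [cutHeight]
  · simp [cutHeight, h1, h2.symm]
  · simp [cutHeight, h3.symm, h1.2.2.2.symm]
  · have h4 : D.mate u ≠ GenIdx.lo i := fun e => hx.2.2.1 (by rw [← hm, ← e, D.mate_mate])
    have h5 : D.mate u ≠ GenIdx.hi i := fun e => hx.1 (D.mate_injective (e.trans hm.symm))
    have h6 : D.mate u ≠ D.mate v := fun e => hx.2.2.2 (D.mate_injective e)
    have h7 : D.mate u ≠ v := fun e => hx.2.1 (by rw [← e, D.mate_mate])
    simp [cutHeight, h4, h5, h6, h7, D.height_mate]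

/-- The diagram with the arcs `{i, i + 1}` and `{v, mate v}` cut and reconnected. -/
def IsCutNode.cut (hv : IsCutNode D i v) (ho : D.OpenTo i.1)
    (hm : D.mate (GenIdx.lo i) = GenIdx.hi i) : ArcDiagram N where
  mate := joinMate D.mate (GenIdx.lo i) (D.mate v)
  height := cutHeight D i v
  mate_mate := joinMate_involutive D.mate_mate D.mate_ne
  mate_ne := joinMate_ne D.mate_mate D.mate_ne (hv.ne hm).2.2.1.symm
  noncrossing u v h := hv.cut_noncrossing ho hm u v h.1 h.2.1 h.2.2
  height_mate := hv.cutHeight_mate hm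
  one_le_height u := by
    have := D.one_le_height u
    have := D.one_le_height v
    rcases hv.cut_cases hm u with ⟨_, _, f⟩ | ⟨_, _, f⟩ | ⟨_, _, f⟩ | ⟨_, _, f⟩ |
      ⟨_, _, f⟩ <;> rw [f] <;> omega
  height_le u := by
    refine le_min (hv.cutHeight_le hm u) ?_
    rw [← hv.cutHeight_mate hm]
    exact hv.cutHeight_le hm _
  height_parity u := by
    have pl := GenIdx.lo_abs i
    have ph := GenIdx.hi_abs i
    have h1 := D.height_le v
    have h4 := hv.lt_abs hm
    have h5 := hv.cases ho hm
    have h6 := Node.pos_abs (D.mate v)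
    have h7 := i.2
    rcases hv.cut_cases hm u with ⟨rfl, e, f⟩ | ⟨rfl, e, f⟩ | ⟨rfl, e, f⟩ | ⟨rfl, e, f⟩ |
      ⟨hx, e, f⟩ <;> rw [f, e]
    · omega
    · omega
    · omega
    · omega
    · exact D.height_parity u
  height_nested := hv.cut_height_nested ho hm

theorem IsCutNode.cut_ends (hv : IsCutNode D i v) (ho : D.OpenTo i.1)
    (hm : D.mate (GenIdx.lo i) = GenIdx.hi i) :
    (hv.cut ho hm).mate (GenIdx.lo i) = D.mate v ∧ (hv.cut ho hm).mate (GenIdx.hi i) = v ∧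
    (hv.cut ho hm).height (GenIdx.lo i) = D.height v ∧
    (hv.cut ho hm).height (GenIdx.hi i) = i.1 + 1 := by
  have h1 := hv.cut_cases hm (GenIdx.lo i)
  have h2 := hv.cut_cases hm (GenIdx.hi i)
  have h3 := GenIdx.lo_ne_hi i
  have h4 := hv.ne hm
  change joinMate D.mate (GenIdx.lo i) (D.mate v) _ = _ ∧
    joinMate D.mate (GenIdx.lo i) (D.mate v) _ = _ ∧ cutHeight D i v _ = _ ∧
    cutHeight D i v _ = _
  grind

/-- Merging the arc of i, with the old label of v, and the arc {i+1, v}, with label i+1, restores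
the old label because it is the smaller one. The label i of {i, i+1} is restored because the prefix
is open. -/
theorem IsCutNode.act_cut (hv : IsCutNode D i v) (ho : D.OpenTo i.1)
    (hm : D.mate (GenIdx.lo i) = GenIdx.hi i) : act i (hv.cut ho hm) = D := by
  obtain ⟨e1, e2, e3, e4⟩ := hv.cut_ends ho hm
  have h1 := ho (GenIdx.lo i) (GenIdx.pos_lo i).le
  have h2 := D.height_mate (GenIdx.lo i)
  rw [GenIdx.pos_lo] at h1
  rw [hm] at h2
  have h3 := hv.height_le
  have h4 := D.height_mate v
  have h5 := D.mate_mate v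
  have h6 := (mate_hi_eq_iff i D).2 hm
  apply ArcDiagram.ext <;> funext u <;> have c1 := act_cases i (hv.cut ho hm) u <;>
    have c2 : _ ∨ _ := hv.cut_cases hm u <;>
    rw [show joinMate D.mate (GenIdx.lo i) (D.mate v) u = (hv.cut ho hm).mate u from rfl,
      show cutHeight D i v u = (hv.cut ho hm).height u from rfl] at c2 <;>
    rw [e1, e2, e3, e4] at c1 <;> grind

theorem IsCutNode.htSum_cut (hv : IsCutNode D i v) (ho : D.OpenTo i.1)
    (hm : D.mate (GenIdx.lo i) = GenIdx.hi i) : (hv.cut ho hm).htSum = D.htSum + 2 := by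
  obtain ⟨e1, e2, e3, e4⟩ := hv.cut_ends ho hm
  have := htSum_act_of_ne (i := i) (D := hv.cut ho hm) (by rw [e1]; exact (hv.ne hm).2.2.2)
  rw [hv.act_cut, e3, e4] at this
  have := hv.height_le
  omega

end Cut

/-- Each cut raises the sum of labels by 2, and this sum is bounded by the sum of the absolute
values; the cutting therefore stops, and it can stop only at the identity diagram. -/
theorem exists_reduced_word (D : ArcDiagram N) : ∃ w, ofWord w = D ∧ IsReduced w := by
  have hle : ∀ D : ArcDiagram N, D.htSum ≤ ∑ u : Node N, u.abs := fun D =>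
    Finset.sum_le_sum fun u _ => (D.height_le u).trans (min_le_left _ _)
  induction hn : (∑ u : Node N, u.abs) - D.htSum using Nat.strong_induction_on generalizing D with
  | _ n ih =>
    by_cases h : D = ArcDiagram.id N
    · subst h
      exact ⟨[], rfl, rfl⟩
    · obtain ⟨i, ho, hm⟩ := exists_first_arc h
      obtain ⟨v, hv⟩ := exists_isCutNode D i
      have h1 := hv.htSum_cut ho hm
      have h2 := hle (hv.cut ho hm)
      obtain ⟨w, hw, hr⟩ := ih _ (by omega) (hv.cut ho hm) rfl
      refine ⟨i :: w, ?_, ?_⟩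
      · change act i (ofWord w) = D
        rw [hw, hv.act_cut]
      · unfold IsReduced at *
        have h3 : ofWord (i :: w) = D := by
          change act i (ofWord w) = D
          rw [hw, hv.act_cut]
        rw [h3, List.length_cons]
        rw [hw] at hr
        omega

end ArcDiagram

end Okada

namespace Okada

/-! ### The code of a permutation -/

/-- The values counted by the code at `m` form an upper segment of the smaller values in the order
given by σ⁻¹. When σ and τ order the smaller values alike, segments of equal size coincide. -/
theorem codeAt_eq_of_lt_iff {N : ℕ} {σ τ : Equiv.Perm (Fin N)} {i : ℕ}
    (h : ∀ j k : Fin N, j.val < i → k.val < i → (σ⁻¹ j < σ⁻¹ k ↔ τ⁻¹ j < τ⁻¹ k))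
    {j : Fin N} (hj : j.val < i) (m : Fin N) (hm : m.val = i) (hc : codeAt σ m = codeAt τ m) :
    σ⁻¹ m < σ⁻¹ j → τ⁻¹ m < τ⁻¹ j := by
  intro hlt
  by_contra hge
  have hne : τ⁻¹ j ≠ τ⁻¹ m := fun e => by
    have := τ⁻¹.injective e
    subst this
    omega
  have hlt' : τ⁻¹ j < τ⁻¹ m := lt_of_le_of_ne (not_lt.1 hge) hne
  have hsub : (Finset.univ.filter fun k : Fin N => k < m ∧ τ⁻¹ m < τ⁻¹ k) ⊂
      (Finset.univ.filter fun k : Fin N => k < m ∧ σ⁻¹ m < σ⁻¹ k) := by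
    rw [Finset.ssubset_iff_of_subset]
    · refine ⟨j, ?_, ?_⟩
      · simp only [Finset.mem_filter, Finset.mem_univ, true_and]
        exact ⟨by rw [Fin.lt_def]; omega, hlt⟩
      · simp only [Finset.mem_filter, Finset.mem_univ, true_and]
        exact fun h => hge h.2
    · intro k
      simp only [Finset.mem_filter, Finset.mem_univ, true_and]
      rintro ⟨hk, hk'⟩
      refine ⟨hk, hlt.trans ?_⟩
      rw [Fin.lt_def] at hk
      exact (h j k hj (by omega)).2 (hlt'.trans hk')
  have := Finset.card_lt_card hsub
  unfold codeAt at hc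
  omega

theorem codeAt_injective {N : ℕ} {σ τ : Equiv.Perm (Fin N)} (h : ∀ i, codeAt σ i = codeAt τ i) :
    σ = τ := by
  have key : ∀ i : ℕ, ∀ j k : Fin N, j.val < i → k.val < i → (σ⁻¹ j < σ⁻¹ k ↔ τ⁻¹ j < τ⁻¹ k) := by
    intro i
    induction i with
    | zero => intro j k hj; omega
    | succ i ih =>
      have ih' := fun j k hj hk => (ih j k hj hk).symm
      have key : ∀ j m : Fin N, j.val < i → m.val = i → (σ⁻¹ m < σ⁻¹ j ↔ τ⁻¹ m < τ⁻¹ j) :=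
        fun j m hj hm => ⟨codeAt_eq_of_lt_iff ih hj m hm (h m),
          codeAt_eq_of_lt_iff ih' hj m hm (h m).symm⟩
      have flip : ∀ (ρ : Equiv.Perm (Fin N)) (j m : Fin N), j ≠ m → (ρ j < ρ m ↔ ¬ ρ m < ρ j) := by
        intro ρ j m hne
        have : ρ j ≠ ρ m := fun e => hne (ρ.injective e)
        rw [not_lt]
        exact ⟨le_of_lt, fun h => lt_of_le_of_ne h this⟩
      intro j k hj hk
      by_cases hj' : j.val < i <;> by_cases hk' : k.val < i
      · exact ih j k hj' hk'
      · rw [flip, flip τ⁻¹, key j k hj' (by omega)] <;>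
          exact fun e => by subst e; omega
      · exact key k j hk' (by omega)
      · have : j = k := Fin.ext (by omega)
        subst this
        simp
  -- σ⁻¹ and τ⁻¹ now order all values alike, so τ⁻¹σ is an increasing permutation, hence the
  -- identity.
  have hmono : StrictMono (τ⁻¹ * σ⁻¹⁻¹ : Equiv.Perm (Fin N)) := by
    intro a b hab
    have := key N (σ a) (σ b) (σ a).2 (σ b).2
    simp only [Equiv.Perm.inv_def, Equiv.symm_apply_apply] at this
    simpa [Equiv.Perm.inv_def] using this.1 hab
  have hid : ((τ⁻¹ * σ⁻¹⁻¹ : Equiv.Perm (Fin N)) : Fin N → Fin N) = id := by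
    apply (hmono.range_inj strictMono_id).1
    rw [Set.range_id]
    exact (Equiv.surjective _).range_eq
  have : (τ⁻¹ * σ⁻¹⁻¹ : Equiv.Perm (Fin N)) = 1 := Equiv.ext fun a => congrFun hid a
  rw [inv_inv] at this
  exact (inv_mul_eq_one.1 this).symm

/-- Codes are injective, and there are N! sequences with c_i at most the zero-based index i. -/
theorem exists_codeAt_eq {N : ℕ} (c : Fin N → ℕ) (hc : ∀ i, c i ≤ i.val) :
    ∃ σ : Equiv.Perm (Fin N), ∀ i, codeAt σ i = c i := by
  let f : Equiv.Perm (Fin N) → ∀ i : Fin N, Fin (i.val + 1) :=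
    fun σ i => ⟨codeAt σ i, Nat.lt_succ_of_le (codeAt_le σ i)⟩
  have hf : Function.Injective f := fun σ τ h =>
    codeAt_injective fun i => congrArg Fin.val (congrFun h i)
  have hcard : Fintype.card (Equiv.Perm (Fin N)) = Fintype.card (∀ i : Fin N, Fin (i.val + 1)) := by
    rw [Fintype.card_perm, Fintype.card_pi, Fintype.card_fin]
    simp only [Fintype.card_fin]
    rw [Fin.prod_univ_eq_prod_range (fun i => i + 1) N, Finset.prod_range_add_one_eq_factorial]
  obtain ⟨σ, hσ⟩ := ((Fintype.bijective_iff_injective_and_card f).2 ⟨hf, hcard⟩).2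
    fun i => ⟨c i, Nat.lt_succ_of_le (hc i)⟩
  exact ⟨σ, fun i => congrArg Fin.val (congrFun hσ i)⟩

/-- The code of a permutation, as a sequence of natural numbers. -/
def codeSeq {N : ℕ} (σ : Equiv.Perm (Fin N)) (n : ℕ) : ℕ :=
  if h : n < N then codeAt σ ⟨n, h⟩ else 0

theorem codeSeq_val {N : ℕ} (σ : Equiv.Perm (Fin N)) (i : Fin N) : codeSeq σ i = codeAt σ i := by
  rw [codeSeq, dif_pos i.2]

theorem codeSeq_le {N : ℕ} (σ : Equiv.Perm (Fin N)) (n : ℕ) : codeSeq σ n ≤ n := by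
  unfold codeSeq
  split_ifs with h
  · exact codeAt_le σ ⟨n, h⟩
  · omega

/-- Stated for an arbitrary fold, since the block is read once as a composition of diagrams and once
as a product in the algebra. -/
theorem codeBlock_cons_induction {N : ℕ} {α : Type*} (f : GenIdx N → α → α) (g : ℕ → α → α)
    (hg : ∀ i a, g i.1 a = f i a) (F : ℕ → ℕ → α) (hF : ∀ c s, F (c + 1) s = g s (F c (s - 1)))
    {z : α} (h0 : ∀ s, F 0 s = z) (σ : Equiv.Perm (Fin N)) (i : Fin N) :
    (codeBlock σ i).foldr f z = F (codeAt σ i) i.val := by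
  have key : ∀ (c s : ℕ) (hs : c ≤ s) (hN : s < N),
      (List.ofFn fun t : Fin c => (⟨s - t.val, by omega⟩ : GenIdx N)).foldr f z = F c s := by
    intro c
    induction c with
    | zero => intro s _ _; simp [h0]
    | succ c ih =>
      intro s hs hN
      rw [List.ofFn_succ, List.foldr_cons, hF, ← ih (s - 1) (by omega) (by omega)]
      have : (fun t : Fin c => (⟨s - t.succ.val, by simp only [Fin.val_succ]; omega⟩ : GenIdx N)) =
          fun t : Fin c => ⟨s - 1 - t.val, by omega⟩ := by
        funext t
        apply Subtype.ext
        simp only [Fin.val_succ]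
        omega
      rw [this, ← hg]
      rfl
  exact key _ _ (codeAt_le σ i) i.2

theorem length_permWord {N : ℕ} (σ : Equiv.Perm (Fin N)) :
    (permWord σ).length = ((List.range N).map (codeSeq σ)).sum := by
  have : (List.finRange N).map (fun i => (codeBlock σ i).length) =
      (List.range N).map (codeSeq σ) := by
    rw [← List.map_coe_finRange_eq_range, List.map_map]
    apply List.map_congr_left
    intro i _
    simp [codeBlock, codeSeq_val]
  rw [permWord, List.length_flatMap, this]

/-! ### The diagrams of permutation words: injectivity and reducedness. -/

namespace ArcDiagram

variable {N : ℕ}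

/-- The composition with the elementary diagram `G_s`; nothing happens if `s` is not an index. -/
def natAct (s : ℕ) (D : ArcDiagram N) : ArcDiagram N :=
  if h : 1 ≤ s ∧ s < N then act ⟨s, h⟩ D else D

theorem natAct_val (i : GenIdx N) (D : ArcDiagram N) : natAct i.1 D = act i D := dif_pos i.2

/-- The composition with the elementary diagrams along the word `s (s - 1) ... (s - c + 1)`. -/
def descAct : ℕ → ℕ → ArcDiagram N → ArcDiagram N
  | 0, _, D => D
  | c + 1, s, D => natAct s (descAct c (s - 1) D)

theorem act_of_height_hi {i : GenIdx N} {D : ArcDiagram N}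
    (h : D.height (GenIdx.hi i) = i.1 + 1) :
    D.mate (GenIdx.lo i) ≠ GenIdx.hi i ∧ i.1 + 1 < (D.mate (GenIdx.hi i)).pos := by
  have h1 := height_lo_le i D
  have h2 := D.height_mate (GenIdx.lo i)
  have h3 := GenIdx.pos_hi i
  have h4 := lt_mate_of_height_eq (h.trans h3.symm)
  refine ⟨fun e => ?_, by omega⟩
  rw [e] at h2
  omega

theorem htSum_act_of_height_hi {i : GenIdx N} {D : ArcDiagram N}
    (h : D.height (GenIdx.hi i) = i.1 + 1) : D.htSum = (act i D).htSum + 2 := by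
  have h1 := height_lo_le i D
  have h2 := htSum_act_of_ne (act_of_height_hi h).1
  omega

/-- The arc of i+1 in D has label i+1, so all labels below it are larger, while its far end receives
the label of i, which is at most i. The far end can thus be recognised in `act i D`. -/
theorem isCutNode_act {i : GenIdx N} {D : ArcDiagram N}
    (h : D.height (GenIdx.hi i) = i.1 + 1) :
    IsCutNode (act i D) i (D.mate (GenIdx.hi i)) := by
  obtain ⟨h1, h2⟩ := act_of_height_hi h
  have h3 := height_lo_le i D
  have pl := GenIdx.pos_lo i
  have ph := GenIdx.pos_hi i
  refine ⟨h2, ?_, fun u hu hu' => ?_⟩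
  · have c := act_cases i D (D.mate (GenIdx.hi i))
    have h4 := (mate_hi_eq_iff i D).not.2 h1
    have h5 := D.mate_ne (GenIdx.hi i)
    grind
  · have h4 := D.nested_lt (u := u) (v := GenIdx.hi i) (by omega) hu'
    have h5 := D.inside (u := GenIdx.hi i) (v := u) (by omega) hu'
    have c := act_cases i D u
    have h6 : u ≠ D.mate (GenIdx.lo i) := fun e => by
      rw [e, D.mate_mate] at h5
      omega
    have h7 : u ≠ D.mate (GenIdx.hi i) := fun e => by rw [e] at hu'; omega
    have h8 : u ≠ GenIdx.lo i := fun e => by rw [e] at hu; omega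
    have h9 : u ≠ GenIdx.hi i := fun e => by rw [e] at hu; omega
    have h10 : (act i D).height u = D.height u := by grind
    omega

theorem eq_cut_act {i : GenIdx N} {D : ArcDiagram N}
    (h : D.height (GenIdx.hi i) = i.1 + 1) :
    D.mate = joinMate (act i D).mate (GenIdx.lo i) ((act i D).mate (D.mate (GenIdx.hi i))) ∧
    D.height = cutHeight (act i D) i (D.mate (GenIdx.hi i)) := by
  obtain ⟨h1, h2⟩ := act_of_height_hi h
  have h3 := height_lo_le i D
  have h4 := (mate_hi_eq_iff i D).not.2 h1
  have h5 := D.mate_ne (GenIdx.hi i)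
  have h6 := D.mate_ne (GenIdx.lo i)
  have h7 := GenIdx.lo_ne_hi i
  have h8 := D.mate_mate (GenIdx.lo i)
  have h9 := D.mate_mate (GenIdx.hi i)
  have h10 := D.height_mate (GenIdx.lo i)
  have h11 := D.height_mate (GenIdx.hi i)
  obtain ⟨e1, e2⟩ := act_at_mate_hi rfl (Ne.symm h4) (Ne.symm h5)
  have hm := act_mate_lo i D
  rw [e1]
  constructor <;> funext u
  · have c1 := act_cases i D u
    have c2 := joinMate_cases (act i D).mate (GenIdx.lo i) (D.mate (GenIdx.lo i)) u
    have c3 := act_at_mate_lo rfl (Ne.symm h6) (Ne.symm h1)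
    grind
  · have c1 := act_cases i D u
    unfold cutHeight
    rw [e1, e2]
    grind

/-- The far end of the arc of i+1 is the first node after i+1 whose label in `act i D` is at most i.
It is therefore determined by `act i D`, and cutting there recovers D. -/
theorem act_injOn {i : GenIdx N} {D E : ArcDiagram N} (hD : D.height (GenIdx.hi i) = i.1 + 1)
    (hE : E.height (GenIdx.hi i) = i.1 + 1) (h : act i D = act i E) : D = E := by
  have c1 := isCutNode_act hD
  have c2 := isCutNode_act hE
  obtain ⟨d1, d2⟩ := eq_cut_act hD
  obtain ⟨e1, e2⟩ := eq_cut_act hE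
  rw [h] at c1 d1 d2
  have hv : D.mate (GenIdx.hi i) = E.mate (GenIdx.hi i) := by
    apply Node.pos_injective
    rcases lt_trichotomy (D.mate (GenIdx.hi i)).pos (E.mate (GenIdx.hi i)).pos with hl | hl | hl
    · have := c2.lt_height _ c1.pos_lt hl
      have := c1.height_le
      omega
    · exact hl
    · have := c1.lt_height _ c2.pos_lt hl
      have := c2.height_le
      omega
  rw [hv] at d1 d2
  exact ArcDiagram.ext (d1.trans e1.symm) (d2.trans e2.symm)

/-- The block s, s-1, ..., s-c+1 spoils only the label at position s+1. In particular node s+1 still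
has its largest label after the block that starts at s-1, so every letter of a descending block can
be undone by `act_injOn`. -/
theorem descAct_open {k : ℕ} (hk : k ≤ N) {D : ArcDiagram N} (hD : D.OpenTo k) {c s : ℕ}
    (hc : c ≤ s) (hs : s < k) {u : Node N} (hu : u.pos ≤ k) (hu' : u.pos ≠ s + 1) :
    (descAct c s D).height u = u.pos := by
  induction c generalizing s u with
  | zero => exact hD u hu
  | succ c ih =>
    have hs' : 1 ≤ s ∧ s < N := by omega
    rw [descAct, natAct, dif_pos hs']
    set i : GenIdx N := ⟨s, hs'⟩
    set E := descAct c (s - 1) D with hE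
    have pl : (GenIdx.lo i).pos = s := GenIdx.pos_lo i
    have ph : (GenIdx.hi i).pos = s + 1 := GenIdx.pos_hi i
    have ihi : E.height (GenIdx.hi i) = (GenIdx.hi i).pos :=
      ih (s := s - 1) (by omega) (by omega) (by omega) (by omega)
    have ihu : u.pos ≠ s → E.height u = u.pos := fun h =>
      ih (s := s - 1) (by omega) (by omega) hu (by omega)
    have hlo : E.height (GenIdx.lo i) ≤ s := height_lo_le i E
    rcases act_cases i E u with ⟨rfl, _, h⟩ | ⟨rfl, _, _, h⟩ | ⟨rfl, h1, _, _, h⟩ |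
      ⟨rfl, h1, _, _, _, h⟩ | ⟨h1, _, _, _, _, h⟩ <;> rw [h]
    · exact pl.symm
    · omega
    · have := ihu (fun e => h1 (Node.pos_injective (by omega)))
      rw [E.height_mate] at this
      omega
    · have := ihu (fun e => h1 (Node.pos_injective (by omega)))
      rw [E.height_mate] at this
      omega
    · exact ihu fun e => h1 (Node.pos_injective (by omega))

theorem descAct_succ {k : ℕ} (hk : k ≤ N) {D : ArcDiagram N} (hD : D.OpenTo k) {c s : ℕ}
    (hc : c + 1 ≤ s) (hs : s < k) :
    ∃ i : GenIdx N, i.1 = s ∧ descAct (c + 1) s D = act i (descAct c (s - 1) D) ∧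
      (descAct c (s - 1) D).height (GenIdx.hi i) = i.1 + 1 := by
  refine ⟨⟨s, by omega⟩, rfl, dif_pos _, ?_⟩
  rw [descAct_open hk hD (by omega) (by omega)]
  · exact GenIdx.pos_hi _
  · rw [GenIdx.pos_hi]; exact hs
  · rw [GenIdx.pos_hi]; simp only; omega

theorem ne_descAct_succ {k : ℕ} (hk : k ≤ N) {D E : ArcDiagram N} (hD : D.OpenTo k)
    (hE : E.OpenTo k) {d s : ℕ} (hd : d + 1 ≤ s) (hs : s < k) : D ≠ descAct (d + 1) s E := by
  intro h
  obtain ⟨i, hi, h1, h2⟩ := descAct_succ hk hE hd hs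
  have h3 := act_height_hi i (descAct d (s - 1) E)
  have h4 := GenIdx.pos_hi i
  rw [← h1, ← h, hD _ (by omega)] at h3
  omega

/-- The label at position s+1 tells whether the block is empty; if it is not, its first letter is s
and can be undone. -/
theorem descAct_injective {k : ℕ} (hk : k ≤ N) {D E : ArcDiagram N} (hD : D.OpenTo k)
    (hE : E.OpenTo k) {c d s : ℕ} (hc : c ≤ s) (hd : d ≤ s) (hs : s < k)
    (h : descAct c s D = descAct d s E) : c = d ∧ D = E := by
  induction c generalizing s d with
  | zero =>
    cases d with
    | zero => exact ⟨rfl, h⟩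
    | succ d => exact (ne_descAct_succ hk hD hE hd hs h).elim
  | succ c ih =>
    cases d with
    | zero => exact (ne_descAct_succ hk hE hD hc hs h.symm).elim
    | succ d =>
      obtain ⟨i, hi, h1, h2⟩ := descAct_succ hk hD hc hs
      obtain ⟨j, hj, h3, h4⟩ := descAct_succ hk hE hd hs
      obtain rfl : i = j := Subtype.ext (hi.trans hj.symm)
      rw [h1, h3] at h
      have h5 := act_injOn h2 h4 h
      obtain ⟨h6, h7⟩ := ih (d := d) (s := s - 1) (by omega) (by omega) (by omega) h5
      exact ⟨by omega, h7⟩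

theorem htSum_descAct {k : ℕ} (hk : k ≤ N) {D : ArcDiagram N} (hD : D.OpenTo k) {c s : ℕ}
    (hc : c ≤ s) (hs : s < k) : D.htSum = (descAct c s D).htSum + 2 * c := by
  induction c generalizing s with
  | zero => rfl
  | succ c ih =>
    obtain ⟨i, hi, h1, h2⟩ := descAct_succ hk hD hc hs
    rw [h1, ih (s := s - 1) (by omega) (by omega), htSum_act_of_height_hi h2]
    omega

/-- The composition of the descending blocks with the numbers `k, ..., k + m - 1`. -/
def towerAct (c : ℕ → ℕ) (k m : ℕ) : ArcDiagram N :=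
  (List.range' k m).foldr (fun n D => descAct (c n) n D) (ArcDiagram.id N)

theorem towerAct_succ (c : ℕ → ℕ) (k m : ℕ) :
    towerAct (N := N) c k (m + 1) = descAct (c k) k (towerAct c (k + 1) m) := by
  rw [towerAct, List.range'_succ, List.foldr_cons]
  rfl

/-- The block with number k operates on a diagram open up to k+1 and spoils only position k+1, so
the next block, with number k-1, again finds what it needs. -/
theorem openTo_towerAct {c : ℕ → ℕ} (hc : ∀ n, c n ≤ n) {k m : ℕ} (h : k + m = N) :
    (towerAct (N := N) c k m).OpenTo k := by
  induction m generalizing k with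
  | zero =>
    intro u hu
    have := Node.pos_abs u
    change u.abs = u.pos
    omega
  | succ m ih =>
    intro u hu
    rw [towerAct_succ]
    exact descAct_open (by omega) (ih (k := k + 1) (by omega)) (hc k) (by omega) (by omega)
      (by omega)

theorem towerAct_injective {c d : ℕ → ℕ} (hc : ∀ n, c n ≤ n) (hd : ∀ n, d n ≤ n) {k m : ℕ}
    (h : k + m = N) (e : towerAct (N := N) c k m = towerAct d k m) {n : ℕ} (h1 : k ≤ n)
    (h2 : n < N) : c n = d n := by
  induction m generalizing k with
  | zero => omega
  | succ m ih =>
    rw [towerAct_succ, towerAct_succ] at e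
    obtain ⟨e1, e2⟩ := descAct_injective (k := k + 1) (by omega) (openTo_towerAct hc (by omega))
      (openTo_towerAct hd (by omega)) (hc k) (hd k) (by omega) e
    rcases h1.eq_or_lt with rfl | h1
    · exact e1
    · exact ih (k := k + 1) (by omega) e2 h1

theorem htSum_towerAct {c : ℕ → ℕ} (hc : ∀ n, c n ≤ n) {k m : ℕ} (h : k + m = N) :
    (ArcDiagram.id N).htSum =
      (towerAct (N := N) c k m).htSum + 2 * ((List.range' k m).map c).sum := by
  induction m generalizing k with
  | zero => rfl
  | succ m ih =>
    rw [towerAct_succ, ih (k := k + 1) (by omega), htSum_descAct (k := k + 1) (by omega)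
      (openTo_towerAct hc (by omega)) (hc k) (by omega), List.range'_succ, List.map_cons,
      List.sum_cons]
    omega

theorem ofWord_permWord (σ : Equiv.Perm (Fin N)) :
    ofWord (permWord σ) = towerAct (codeSeq σ) 0 N := by
  have key : ∀ l : List (Fin N), (l.flatMap (codeBlock σ)).foldr act (ArcDiagram.id N) =
      (l.map Fin.val).foldr (fun n D => descAct (codeSeq σ n) n D) (ArcDiagram.id N) := by
    intro l
    induction l with
    | nil => rfl
    | cons i l ih =>
      rw [List.flatMap_cons, List.foldr_append, ih, List.map_cons, List.foldr_cons, codeSeq_val]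
      exact codeBlock_cons_induction act natAct natAct_val
        (fun c s => descAct c s _) (fun _ _ => rfl) (fun _ => rfl) σ i
  rw [ofWord, permWord, key, List.map_coe_finRange_eq_range, List.range_eq_range']
  rfl

theorem ofWord_permWord_injective {σ τ : Equiv.Perm (Fin N)}
    (h : ofWord (permWord σ) = ofWord (permWord τ)) : σ = τ := by
  rw [ofWord_permWord, ofWord_permWord] at h
  refine codeAt_injective fun i => ?_
  rw [← codeSeq_val, ← codeSeq_val]
  exact towerAct_injective (codeSeq_le σ) (codeSeq_le τ) (Nat.zero_add N) h (Nat.zero_le _) i.2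

end ArcDiagram

open ArcDiagram

theorem isReduced_permWord {N : ℕ} (σ : Equiv.Perm (Fin N)) : IsReduced (permWord σ) := by
  rw [IsReduced, ofWord_permWord, length_permWord, List.range_eq_range']
  exact htSum_towerAct (codeSeq_le σ) (Nat.zero_add N)

end Okada

namespace Okada

open ArcDiagram

/-! ### The elements `E_σ` span the Okada algebra -/

section Spanning

variable {K : Type*} [Field K] {N : ℕ} (X Y : ℕ → K)

/-- The generator `E_s`, or `1` if `s` is not an index. -/
def genNat (s : ℕ) : OkadaAlgebra K N X Y := if h : 1 ≤ s ∧ s < N then gen X Y ⟨s, h⟩ else 1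

theorem genNat_val (i : GenIdx N) : genNat X Y i.1 = gen X Y i := dif_pos i.2

theorem genNat_comm {i j : ℕ} (h : i + 2 ≤ j) :
    Commute (genNat (N := N) X Y i) (genNat X Y j) := by
  unfold genNat
  split_ifs with h1 h2
  · exact gen_comm X Y (Or.inl h)
  all_goals simp

/-- The product `E_s E_{s - 1} ⋯ E_{s - c + 1}`. -/
def descElt : ℕ → ℕ → OkadaAlgebra K N X Y
  | 0, _ => 1
  | c + 1, s => genNat X Y s * descElt c (s - 1)

/-- The product of the descending products with the numbers `0, ..., n - 1`. -/
def towerElt (c : ℕ → ℕ) (n : ℕ) : OkadaAlgebra K N X Y :=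
  ((List.range n).map fun k => descElt X Y (c k) k).prod

theorem towerElt_succ (c : ℕ → ℕ) (n : ℕ) :
    towerElt (N := N) X Y c (n + 1) = towerElt X Y c n * descElt X Y (c n) n := by
  simp [towerElt, List.range_succ]

theorem towerElt_congr {c d : ℕ → ℕ} {n : ℕ} (h : ∀ k < n, c k = d k) :
    towerElt (N := N) X Y c n = towerElt X Y d n := by
  unfold towerElt
  congr 1
  apply List.map_congr_left
  intro k hk
  rw [h k (List.mem_range.1 hk)]

/-- The subalgebra generated by the `E_i` with `i < s`. -/
def lowerSubalgebra (s : ℕ) : Subalgebra K (OkadaAlgebra K N X Y) :=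
  Algebra.adjoin K (genNat X Y '' Set.Iio s)

variable {X Y}

theorem lowerSubalgebra_mono {s t : ℕ} (h : s ≤ t) :
    lowerSubalgebra (N := N) X Y s ≤ lowerSubalgebra X Y t :=
  Algebra.adjoin_mono (Set.image_mono (Set.Iio_subset_Iio h))

theorem genNat_mem_lowerSubalgebra {i s : ℕ} (h : i < s) :
    genNat X Y i ∈ lowerSubalgebra (N := N) X Y s :=
  Algebra.subset_adjoin ⟨i, h, rfl⟩

theorem descElt_mem_lowerSubalgebra {c s t : ℕ} (h : s < t) :
    descElt X Y c s ∈ lowerSubalgebra (N := N) X Y t := by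
  induction c generalizing s with
  | zero => exact one_mem _
  | succ c ih => exact mul_mem (genNat_mem_lowerSubalgebra h) (ih (by omega))

theorem commute_genNat_of_mem {s t : ℕ} (h : s + 1 ≤ t) {b : OkadaAlgebra K N X Y}
    (hb : b ∈ lowerSubalgebra X Y s) : Commute b (genNat X Y t) := by
  induction hb using Algebra.adjoin_induction with
  | mem x hx =>
    obtain ⟨i, hi, rfl⟩ := hx
    exact genNat_comm X Y (by have : i < s := hi; omega)
  | algebraMap r => exact Algebra.commutes r _
  | add x y _ _ hx hy => exact hx.add_left hy
  | mul x y _ _ hx hy => exact hx.mul_left hy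

/-- A descending product times a generator. -/
theorem exists_descElt_mul_genNat {c s j : ℕ} (hc : c ≤ s) (hs : s < N) (hj : 1 ≤ j)
    (hjs : j ≤ s) : ∃ b ∈ lowerSubalgebra (N := N) X Y s, ∃ d ≤ s,
      descElt X Y c s * genNat X Y j = b * descElt X Y d s := by
  induction s generalizing c with
  | zero => omega
  | succ s ih =>
    cases c with
    | zero =>
      rcases hjs.eq_or_lt with rfl | hlt
      · exact ⟨1, one_mem _, 1, by omega, by simp [descElt]⟩
      · exact ⟨genNat X Y j, genNat_mem_lowerSubalgebra hlt, 0, by omega, by simp [descElt]⟩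
    | succ c =>
      rcases hjs.eq_or_lt with rfl | hlt
      · cases c with
        -- The word is E_{s+1} E_{s+1}, here with s+1 in the role of the top index.
        | zero =>
          refine ⟨algebraMap K _ (X (s + 1)), Subalgebra.algebraMap_mem _ _, 1, by omega, ?_⟩
          have := gen_mul_self X Y (⟨s + 1, by omega⟩ : GenIdx N)
          rw [← genNat_val] at this
          simp only [descElt, mul_one]
          rw [this, Algebra.smul_def]
        -- The tail has indices at most s-1, so it commutes with E_{s+1}; this brings together
        -- E_{s+1} E_s E_{s+1}.
        | succ c =>
          have hb := descElt_mem_lowerSubalgebra (N := N) (X := X) (Y := Y) (c := c)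
            (show s - 1 < s by omega)
          refine ⟨algebraMap K _ (Y s) * descElt X Y c (s - 1),
            mul_mem (Subalgebra.algebraMap_mem _ _) (lowerSubalgebra_mono (by omega) hb),
            1, by omega, ?_⟩
          have hcomm := commute_genNat_of_mem (t := s + 1) (by omega) hb
          have := gen_braid X Y (i := (⟨s, by omega⟩ : GenIdx N)) (j := ⟨s + 1, by omega⟩) rfl
          rw [← genNat_val, ← genNat_val] at this
          simp only [descElt, mul_one, Nat.add_sub_cancel]
          rw [mul_assoc, mul_assoc, hcomm.eq, ← mul_assoc, ← mul_assoc, this, smul_mul_assoc,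
            ← hcomm.eq, Algebra.smul_def, mul_assoc]
      -- The generator is absorbed by the shorter block; the coefficient `b` involves only indices
      -- below s and so commutes with the leading E_{s+1}.
      · obtain ⟨b, hb, d, hd, e⟩ := ih (c := c) (by omega) (by omega) (by omega)
        refine ⟨b, lowerSubalgebra_mono (by omega) hb, d + 1, by omega, ?_⟩
        have hcomm := commute_genNat_of_mem (t := s + 1) (by omega) hb
        simp only [descElt, Nat.add_sub_cancel]
        rw [mul_assoc, e, ← mul_assoc, ← hcomm.eq, mul_assoc]

/-- The span of the products of descending products with the numbers `0, ..., n - 1`. -/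
def towerSpan (X Y : ℕ → K) (n : ℕ) : Submodule K (OkadaAlgebra K N X Y) :=
  Submodule.span K {a | ∃ c : ℕ → ℕ, (∀ k, c k ≤ k) ∧ a = towerElt X Y c n}

theorem mul_descElt_mem_towerSpan {n d : ℕ} (hd : d ≤ n) {x : OkadaAlgebra K N X Y}
    (hx : x ∈ towerSpan X Y n) : x * descElt X Y d n ∈ towerSpan X Y (n + 1) := by
  induction hx using Submodule.span_induction with
  | mem x hx =>
    obtain ⟨c, hc, rfl⟩ := hx
    refine Submodule.subset_span ⟨Function.update c n d, fun k => ?_, ?_⟩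
    · rcases eq_or_ne k n with rfl | h
      · rwa [Function.update_self]
      · rw [Function.update_of_ne h]
        exact hc k
    · rw [towerElt_succ, Function.update_self]
      congr 1
      exact towerElt_congr X Y fun k hk => by rw [Function.update_of_ne hk.ne]
  | zero => rw [zero_mul]; exact zero_mem _
  | add x y _ _ hx hy => rw [add_mul]; exact add_mem hx hy
  | smul r x _ hx => rw [smul_mul_assoc]; exact Submodule.smul_mem _ _ hx

/-- A generator multiplied to the right of the last block is absorbed by that block at the cost of
an element with smaller indices on its left, and the induction hypothesis absorbs that element into
the earlier blocks. -/
theorem mul_mem_towerSpan {n : ℕ} (hn : n ≤ N) {b x : OkadaAlgebra K N X Y}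
    (hb : b ∈ lowerSubalgebra X Y n) (hx : x ∈ towerSpan X Y n) : x * b ∈ towerSpan X Y n := by
  induction n generalizing b x with
  | zero =>
    have : b ∈ (⊥ : Subalgebra K (OkadaAlgebra K N X Y)) := by
      rw [lowerSubalgebra] at hb
      simpa using hb
    obtain ⟨r, rfl⟩ := Algebra.mem_bot.1 this
    rw [← Algebra.commutes, ← Algebra.smul_def]
    exact Submodule.smul_mem _ _ hx
  | succ n ih =>
    induction hb using Algebra.adjoin_induction generalizing x with
    | mem b hb =>
      obtain ⟨j, hj, rfl⟩ := hb
      rw [Set.mem_Iio] at hj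
      rcases Nat.eq_zero_or_pos j with rfl | hj0
      · simpa [genNat] using hx
      induction hx using Submodule.span_induction with
      | mem x hx =>
        obtain ⟨c, hc, rfl⟩ := hx
        obtain ⟨b, hb, d, hd, e⟩ := exists_descElt_mul_genNat (N := N) (X := X) (Y := Y) (j := j) (hc n) hn
          hj0 (by omega)
        rw [towerElt_succ, mul_assoc, e, ← mul_assoc]
        exact mul_descElt_mem_towerSpan hd
          (ih (by omega) hb (Submodule.subset_span ⟨c, hc, rfl⟩))
      | zero => rw [zero_mul]; exact zero_mem _
      | add x y _ _ hx hy => rw [add_mul]; exact add_mem hx hy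
      | smul r x _ hx => rw [smul_mul_assoc]; exact Submodule.smul_mem _ _ hx
    | algebraMap r =>
      rw [← Algebra.commutes, ← Algebra.smul_def]
      exact Submodule.smul_mem _ _ hx
    | add a b _ _ ha hb => rw [mul_add]; exact add_mem (ha hx) (hb hx)
    | mul a b _ _ ha hb => rw [← mul_assoc]; exact hb (ha hx)

theorem lowerSubalgebra_eq_top : lowerSubalgebra (N := N) X Y N = ⊤ := by
  rw [eq_top_iff, ← adjoin_range_gen]
  refine Algebra.adjoin_mono ?_
  rintro _ ⟨i, rfl⟩
  exact ⟨i.1, i.2.2, genNat_val X Y i⟩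

theorem towerSpan_eq_top : towerSpan (N := N) X Y N = ⊤ := by
  have one_mem : ∀ n, (1 : OkadaAlgebra K N X Y) ∈ towerSpan X Y n := fun n =>
    Submodule.subset_span ⟨fun _ => 0, fun _ => Nat.zero_le _, by
      induction n with
      | zero => rfl
      | succ n ih => rw [towerElt_succ, ← ih]; simp [descElt]⟩
  refine eq_top_iff.2 fun a _ => ?_
  rw [← one_mul a]
  exact mul_mem_towerSpan le_rfl (by rw [lowerSubalgebra_eq_top]; trivial) (one_mem N)

theorem permElt_eq_towerElt (σ : Equiv.Perm (Fin N)) :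
    permElt X Y σ = towerElt X Y (codeSeq σ) N := by
  have hprod : ∀ w : List (GenIdx N), wordProd X Y w = w.foldr (fun i a => gen X Y i * a) 1 := by
    intro w
    rw [wordProd, List.prod_eq_foldr, List.foldr_map]
  have key : ∀ l : List (Fin N), wordProd X Y (l.flatMap (codeBlock σ)) =
      ((l.map Fin.val).map fun k => descElt X Y (codeSeq σ k) k).prod := by
    intro l
    induction l with
    | nil => rfl
    | cons i l ih =>
      have : wordProd X Y ((i :: l).flatMap (codeBlock σ)) =
          wordProd X Y (codeBlock σ i) * wordProd X Y (l.flatMap (codeBlock σ)) := by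
        simp [wordProd]
      rw [this, ih, List.map_cons, List.map_cons, List.prod_cons, codeSeq_val, hprod]
      congr 1
      exact codeBlock_cons_induction (fun i a => gen X Y i * a) (fun s a => genNat X Y s * a)
        (fun i a => by rw [genNat_val]) (descElt X Y) (fun _ _ => rfl) (fun _ => rfl) σ i
  rw [permElt_eq, permWord, key, List.map_coe_finRange_eq_range]
  rfl

theorem span_range_permElt : Submodule.span K (Set.range (permElt (N := N) X Y)) = ⊤ := by
  rw [eq_top_iff, ← towerSpan_eq_top]
  refine Submodule.span_le.2 ?_
  rintro _ ⟨c, hc, rfl⟩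
  obtain ⟨σ, hσ⟩ := exists_codeAt_eq (fun i : Fin N => c i) fun i => hc i
  refine Submodule.subset_span ⟨σ, ?_⟩
  rw [permElt_eq_towerElt]
  refine towerElt_congr X Y fun k hk => ?_
  rw [← hσ ⟨k, hk⟩, codeSeq, dif_pos hk]

end Spanning

/-! ### The diagram basis -/

section Basis

variable {K : Type*} [Field K] {N : ℕ} (X Y : ℕ → K)

theorem vec_permElt (σ : Equiv.Perm (Fin N)) :
    vec X Y (permElt X Y σ) = Finsupp.single (ofWord (permWord σ)) 1 :=
  vec_wordProd_of_isReduced X Y (isReduced_permWord σ)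

theorem exists_ofWord_permWord (D : ArcDiagram N) :
    ∃ σ : Equiv.Perm (Fin N), ofWord (permWord σ) = D := by
  obtain ⟨w, rfl, hw⟩ := exists_reduced_word D
  -- The claim is purely combinatorial, so any field and parameters will do. The vector of the
  -- reduced word is a single diagram lying in the span of the diagrams of the E_σ, and so is one of
  -- them.
  have h1 : wordProd (0 : ℕ → ℚ) 0 w ∈
      Submodule.span ℚ (Set.range (permElt (N := N) (0 : ℕ → ℚ) 0)) := by
    rw [span_range_permElt]
    trivial
  have h2 := Submodule.mem_map_of_mem (f := vec (N := N) (0 : ℕ → ℚ) 0) h1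
  rw [vec_wordProd_of_isReduced _ _ hw, Submodule.map_span] at h2
  by_contra h
  push Not at h
  have h3 : ∀ f ∈ Submodule.span ℚ (vec (N := N) (0 : ℕ → ℚ) 0 '' Set.range (permElt 0 0)),
      f (ofWord w) = 0 := by
    intro f hf
    induction hf using Submodule.span_induction with
    | mem f hf =>
      obtain ⟨_, ⟨σ, rfl⟩, rfl⟩ := hf
      rw [vec_permElt, Finsupp.single_eq_of_ne (Ne.symm (h σ))]
    | zero => rfl
    | add f g _ _ hf hg => rw [Finsupp.add_apply, hf, hg, add_zero]
    | smul r f _ hf => rw [Finsupp.smul_apply, hf, smul_zero]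
  have h4 := h3 _ h2
  rw [Finsupp.single_eq_same] at h4
  exact one_ne_zero h4

theorem existsUnique_isWordDiagram (D : ArcDiagram N) :
    ∃! σ : Equiv.Perm (Fin N), IsWordDiagram (permWord σ) D := by
  obtain ⟨σ, hσ⟩ := exists_ofWord_permWord D
  refine ⟨σ, (isWordDiagram_iff).2 hσ.symm, fun τ hτ => ?_⟩
  exact ofWord_permWord_injective (((isWordDiagram_iff).1 hτ).symm.trans hσ.symm)

theorem diagramElt_ofWord (σ : Equiv.Perm (Fin N)) :
    diagramElt X Y (ofWord (permWord σ)) = permElt X Y σ := by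
  have h : ∃ τ : Equiv.Perm (Fin N), IsWordDiagram (permWord τ) (ofWord (permWord σ)) :=
    ⟨σ, (isWordDiagram_iff).2 rfl⟩
  rw [diagramElt, dif_pos h]
  congr 1
  exact (existsUnique_isWordDiagram _).unique h.choose_spec ((isWordDiagram_iff).2 rfl)

theorem vec_diagramElt (D : ArcDiagram N) : vec X Y (diagramElt X Y D) = Finsupp.single D 1 := by
  obtain ⟨σ, rfl⟩ := exists_ofWord_permWord D
  rw [diagramElt_ofWord, vec_permElt]

theorem span_range_diagramElt : Submodule.span K (Set.range (diagramElt (N := N) X Y)) = ⊤ := by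
  rw [eq_top_iff, ← span_range_permElt]
  refine Submodule.span_mono ?_
  rintro _ ⟨σ, rfl⟩
  exact ⟨_, diagramElt_ofWord X Y σ⟩

theorem linearIndependent_diagramElt : LinearIndependent K (diagramElt (N := N) X Y) := by
  refine LinearIndependent.of_comp (vec X Y) ?_
  have : (vec X Y) ∘ diagramElt (N := N) X Y = fun D => Finsupp.single D 1 :=
    funext fun D => vec_diagramElt X Y D
  rw [this]
  exact Finsupp.linearIndependent_single_one K _

theorem vec_injective : Function.Injective (vec (N := N) X Y) := by
  let φ : (ArcDiagram N →₀ K) →ₗ[K] OkadaAlgebra K N X Y :=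
    Finsupp.linearCombination K (diagramElt X Y)
  have h : φ ∘ₗ vec X Y = LinearMap.id := by
    refine LinearMap.ext_on_range (span_range_diagramElt X Y) fun D => ?_
    rw [LinearMap.comp_apply, vec_diagramElt, Finsupp.linearCombination_single, one_smul]
    rfl
  exact Function.LeftInverse.injective (g := φ) fun a => LinearMap.congr_fun h a

/-- Because `vec` is injective, the rule that defined the representation is the multiplication of
the algebra. -/
theorem gen_mul_diagramElt (i : GenIdx N) (D : ArcDiagram N) :
    gen X Y i * diagramElt X Y D = weight X Y i D • diagramElt X Y (act i D) := by
  apply vec_injective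
  rw [vec_gen_mul, map_smul, vec_diagramElt, vec_diagramElt, genOp_single, Finsupp.smul_single,
    smul_eq_mul, mul_one, one_mul]

theorem wordProd_of_isReduced {w : List (GenIdx N)} (h : IsReduced w) :
    wordProd X Y w = diagramElt X Y (ofWord w) := by
  apply vec_injective
  rw [vec_wordProd_of_isReduced X Y h, vec_diagramElt]

/-! ### The mirror anti-involution -/

/-- The mirror anti-involution, with values in the opposite algebra. -/
noncomputable def mirrorHom : OkadaAlgebra K N X Y →ₐ[K] (OkadaAlgebra K N X Y)ᵐᵒᵖ :=
  okadaLift X Y (fun i => MulOpposite.op (gen X Y i))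
    (fun i => by rw [← MulOpposite.op_mul, gen_mul_self, MulOpposite.op_smul])
    (fun i j h => by rw [← MulOpposite.op_mul, ← MulOpposite.op_mul, gen_comm X Y h])
    (fun i j h => by
      rw [← MulOpposite.op_mul, ← MulOpposite.op_mul, ← mul_assoc, gen_braid X Y h,
        MulOpposite.op_smul])

/-- The mirror anti-involution of the Okada algebra. -/
noncomputable def mirrorMap : OkadaAlgebra K N X Y →ₗ[K] OkadaAlgebra K N X Y :=
  (MulOpposite.opLinearEquiv K).symm.toLinearMap ∘ₗ (mirrorHom X Y).toLinearMap

theorem mirrorMap_apply (a : OkadaAlgebra K N X Y) :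
    mirrorMap X Y a = (mirrorHom X Y a).unop := rfl

theorem mirrorMap_mul (a b : OkadaAlgebra K N X Y) :
    mirrorMap X Y (a * b) = mirrorMap X Y b * mirrorMap X Y a := by
  simp only [mirrorMap_apply, map_mul, MulOpposite.unop_mul]

theorem mirrorMap_wordProd (w : List (GenIdx N)) :
    mirrorMap X Y (wordProd X Y w) = wordProd X Y w.reverse := by
  induction w with
  | nil => simp [mirrorMap_apply, wordProd]
  | cons i w ih =>
    have h1 : wordProd X Y (i :: w) = gen X Y i * wordProd X Y w := by simp [wordProd]
    have h2 : wordProd X Y (i :: w).reverse = wordProd X Y w.reverse * gen X Y i := by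
      simp [wordProd]
    have h3 : mirrorMap X Y (gen X Y i) = gen X Y i := by
      rw [mirrorMap_apply, mirrorHom, okadaLift_gen, MulOpposite.unop_op]
    rw [h1, h2, mirrorMap_mul, ih, h3]

/-- The permutation word of D need not reverse to a permutation word, but any reduced word
represents its diagram, and reducedness survives reversal. -/
theorem mirrorMap_diagramElt (D : ArcDiagram N) :
    mirrorMap X Y (diagramElt X Y D) = diagramElt X Y D.mirror := by
  obtain ⟨w, rfl, hw⟩ := exists_reduced_word D
  rw [← wordProd_of_isReduced X Y hw, mirrorMap_wordProd, wordProd_of_isReduced X Y hw.reverse,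
    ofWord_reverse]

theorem mirrorMap_mirrorMap (a : OkadaAlgebra K N X Y) : mirrorMap X Y (mirrorMap X Y a) = a := by
  have h : mirrorMap (N := N) X Y ∘ₗ mirrorMap X Y = LinearMap.id := by
    refine LinearMap.ext_on_range (span_range_diagramElt X Y) fun D => ?_
    rw [LinearMap.comp_apply, mirrorMap_diagramElt, mirrorMap_diagramElt, mirror_mirror]
    rfl
  exact LinearMap.congr_fun h a

end Basis

end Okada

namespace Okada

/-! ### Half diagrams -/

section Halves

variable {N : ℕ}

theorem mirror_glue {L R : HalfDiagram N} (h : L.propLab = R.propLab) :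
    (glue L R h).mirror = glue R L h.symm := by
  apply ArcDiagram.ext <;> funext u
  · rcases u with a | a <;> simp only [ArcDiagram.mirror, glue, glueMate, Sum.swap_inl, Sum.swap_inr] <;>
      split_ifs <;> rfl
  · rcases u with a | a <;> rfl

namespace ArcDiagram

/-- The left half of a diagram. -/
def leftHalf (D : ArcDiagram N) : HalfDiagram N where
  mate a := Sum.elim (fun b => b) (fun _ => a) (D.mate (Sum.inl a))
  height a := D.height (Sum.inl a)
  mate_mate a := by
    have h := D.mate_mate (Sum.inl a)
    rcases e : D.mate (Sum.inl a) with b | b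
    · rw [e] at h
      simp [h]
    · simp [e]
  noncrossing a b := by
    have h := D.noncrossing (Sum.inl a) (Sum.inl b)
    rcases e : D.mate (Sum.inl a) with a' | a' <;> rcases e' : D.mate (Sum.inl b) with b' | b' <;>
      simp only [e, e', Node.pos, Sum.elim_inl, Sum.elim_inr] at h ⊢ <;> grind
  noncrossing_half a c hc := by
    have h := D.noncrossing (Sum.inl a) (Sum.inl c)
    have hne := D.mate_ne (Sum.inl c)
    rcases e : D.mate (Sum.inl a) with a' | a' <;> rcases e' : D.mate (Sum.inl c) with c' | c' <;>
      simp only [e, e', Node.pos, Sum.elim_inl, Sum.elim_inr] at h hne hc ⊢ <;> grind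
  height_mate a := by
    have h := D.height_mate (Sum.inl a)
    rcases e : D.mate (Sum.inl a) with b | b
    · rw [e] at h
      simpa using h
    · rfl
  one_le_height a := D.one_le_height _
  height_le a := by
    have h := D.height_le (Sum.inl a)
    rcases e : D.mate (Sum.inl a) with b | b <;>
      simp only [e, Node.abs, Sum.elim_inl, Sum.elim_inr] at h ⊢ <;> omega
  height_parity a := by
    have h := D.height_parity (Sum.inl a)
    have h' := D.mate_parity (Sum.inl a)
    rcases e : D.mate (Sum.inl a) with b | b <;>
      simp only [e, Node.abs, Node.pos, Sum.elim_inl, Sum.elim_inr] at h h' ⊢ <;> omega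
  height_nested a c := by
    have h := D.height_nested (Sum.inl a) (Sum.inl c)
    rcases e : D.mate (Sum.inl a) with a' | a' <;> rcases e' : D.mate (Sum.inl c) with c' | c' <;>
      simp only [e, e', Node.pos, Sum.elim_inl, Sum.elim_inr] at h ⊢ <;> grind
  height_nested_half a c hc := by
    have h := D.nested_lt (u := Sum.inl a) (v := Sum.inl c)
    have hne := D.mate_ne (Sum.inl c)
    rcases e' : D.mate (Sum.inl c) with c' | c' <;>
      simp only [e', Node.pos, Sum.elim_inl, Sum.elim_inr] at h hne hc ⊢ <;> grind

/-- The right half of a diagram, read through the mirror. -/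
def rightHalf (D : ArcDiagram N) : HalfDiagram N := D.mirror.leftHalf

theorem leftHalf_mate_eq_self_iff {D : ArcDiagram N} {a : Fin N} :
    D.leftHalf.mate a = a ↔ ∃ b, D.mate (Sum.inl a) = Sum.inr b := by
  have hne := D.mate_ne (Sum.inl a)
  simp only [leftHalf]
  rcases e : D.mate (Sum.inl a) with b | b
  · rw [e] at hne
    simpa using hne
  · simp

theorem leftHalf_mate_of_eq {D : ArcDiagram N} {a b : Fin N}
    (h : D.mate (Sum.inl a) = Sum.inl b) : D.leftHalf.mate a = b := by
  simp [leftHalf, h]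

theorem leftHalf_eq_iff {D E : ArcDiagram N} : D.leftHalf = E.leftHalf ↔
    ∀ a, D.height (Sum.inl a) = E.height (Sum.inl a) ∧
      ∀ b, D.mate (Sum.inl a) = Sum.inl b ↔ E.mate (Sum.inl a) = Sum.inl b := by
  constructor
  · intro h a
    refine ⟨congrFun (congrArg HalfDiagram.height h) a, fun b => ?_⟩
    have h1 := congrFun (congrArg HalfDiagram.mate h) a
    have h2 := D.mate_ne (Sum.inl a)
    have h3 := E.mate_ne (Sum.inl a)
    simp only [leftHalf] at h1
    rcases e : D.mate (Sum.inl a) with a' | a' <;> rcases e' : E.mate (Sum.inl a) with b' | b' <;>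
      simp only [e, e', Sum.elim_inl, Sum.elim_inr] at h1 h2 h3 ⊢ <;> grind
  · intro h
    apply HalfDiagram.ext <;> funext a
    · have h1 := (h a).2
      simp only [leftHalf]
      rcases e : D.mate (Sum.inl a) with a' | a' <;>
        rcases e' : E.mate (Sum.inl a) with b' | b' <;>
        simp only [e, e', Sum.elim_inl, Sum.elim_inr] at h1 ⊢ <;> grind
    · exact (h a).1

theorem rightHalf_mate_eq_self_iff {D : ArcDiagram N} {a : Fin N} :
    D.rightHalf.mate a = a ↔ ∃ b, D.mate (Sum.inr a) = Sum.inl b := by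
  rw [rightHalf, leftHalf_mate_eq_self_iff]
  simp only [mirror, Sum.swap_inl]
  rcases D.mate (Sum.inr a) with b | b <;> simp

theorem propLab_leftHalf_subset (D : ArcDiagram N) :
    D.leftHalf.propLab ⊆ D.rightHalf.propLab := by
  intro x hx
  obtain ⟨a, ha, rfl⟩ := Finset.mem_image.1 hx
  obtain ⟨b, hb⟩ := leftHalf_mate_eq_self_iff.1 (Finset.mem_filter.1 ha).2
  refine Finset.mem_image.2 ⟨b, Finset.mem_filter.2 ⟨Finset.mem_univ _, ?_⟩, ?_⟩
  · exact rightHalf_mate_eq_self_iff.2 ⟨a, by rw [← hb, D.mate_mate]⟩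
  · have := D.height_mate (Sum.inl a)
    rwa [hb] at this

theorem propLab_rightHalf (D : ArcDiagram N) : D.rightHalf.propLab = D.leftHalf.propLab := by
  refine Finset.Subset.antisymm ?_ D.propLab_leftHalf_subset
  have := D.mirror.propLab_leftHalf_subset
  rwa [rightHalf, mirror_mirror] at this

theorem glue_leftHalf_rightHalf (D : ArcDiagram N) :
    glue D.leftHalf D.rightHalf D.propLab_rightHalf.symm = D := by
  -- Stated for all diagrams, so that the right nodes of `D` follow from the left nodes of its
  -- mirror.
  have key : ∀ (E : ArcDiagram N) (h : E.leftHalf.propLab = E.rightHalf.propLab) (a : Fin N),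
      (glue E.leftHalf E.rightHalf h).mate (Sum.inl a) = E.mate (Sum.inl a) := by
    intro E h a
    rcases e : E.mate (Sum.inl a) with b | b
    · have h1 := leftHalf_mate_of_eq e
      have h2 := E.mate_ne (Sum.inl a)
      refine (glueMate_inl_full _ ?_).trans (by rw [h1])
      rw [h1]
      rintro rfl
      exact h2 e
    · have h1 := leftHalf_mate_eq_self_iff.2 ⟨b, e⟩
      refine (glueMate_inl_half _ h1).trans ?_
      obtain ⟨h2, h3⟩ := HalfDiagram.partner_spec h h1
      rw [E.rightHalf.half_unique h2 (rightHalf_mate_eq_self_iff.2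
        ⟨a, by rw [← e, E.mate_mate]⟩)]
      rw [h3]
      have := E.height_mate (Sum.inl a)
      rw [e] at this
      exact this.symm
  apply ArcDiagram.ext
  · funext u
    rcases u with a | a
    · exact key D _ a
    · have h1 : D.mirror.rightHalf = D.leftHalf := by rw [rightHalf, mirror_mirror]
      have h2 : (glue D.rightHalf D.leftHalf D.propLab_rightHalf).mate (Sum.inl a) =
          D.mirror.mate (Sum.inl a) := by
        have h := key D.mirror (propLab_rightHalf _).symm a
        simp only [h1] at h
        exact h
      rw [← mirror_glue D.propLab_rightHalf.symm] at h2
      exact Sum.swap_leftInverse.injective h2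
  · funext u
    rcases u with a | a <;> rfl

end ArcDiagram

open ArcDiagram

theorem leftHalf_glue {L R : HalfDiagram N} (h : L.propLab = R.propLab) :
    (glue L R h).leftHalf = L := by
  apply HalfDiagram.ext <;> funext a
  · simp only [leftHalf, glue, glueMate]
    split_ifs with h
    · simp [h]
    · simp
  · rfl

theorem rightHalf_glue {L R : HalfDiagram N} (h : L.propLab = R.propLab) :
    (glue L R h).rightHalf = R := by
  rw [rightHalf, mirror_glue, leftHalf_glue]

/-! ### Propagating label sets -/

theorem card_filter_lt_orderEmbOfFin (S : Finset ℕ) (i : Fin S.card) :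
    (S.filter (· < S.orderEmbOfFin rfl i)).card = i.val := by
  have : S.filter (· < S.orderEmbOfFin rfl i) =
      (Finset.Iio i).map (S.orderEmbOfFin rfl).toEmbedding := by
    ext x
    simp only [Finset.mem_filter, Finset.mem_map, Finset.mem_Iio, RelEmbedding.coe_toEmbedding]
    constructor
    · rintro ⟨hx, hlt⟩
      rw [← Finset.mem_coe, ← Finset.range_orderEmbOfFin S rfl] at hx
      obtain ⟨j, rfl⟩ := hx
      exact ⟨j, (S.orderEmbOfFin rfl).lt_iff_lt.1 hlt, rfl⟩
    · rintro ⟨j, hj, rfl⟩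
      exact ⟨Finset.orderEmbOfFin_mem S rfl j, (S.orderEmbOfFin rfl).lt_iff_lt.2 hj⟩
  rw [this, Finset.card_map, Fin.card_Iio]

theorem card_filter_le_orderEmbOfFin (S : Finset ℕ) (i : Fin S.card) :
    (S.filter (S.orderEmbOfFin rfl i ≤ ·)).card + i.val = S.card := by
  have h := S.card_filter_add_card_filter_not (p := (S.orderEmbOfFin rfl i ≤ ·))
  simp only [not_le] at h
  rw [card_filter_lt_orderEmbOfFin] at h
  exact h

/-- If the (i+1)-st largest element of S exceeded that of T, then S would have more elements than T
above this threshold. -/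
theorem dominated_of_card_filter_le {S T : Finset ℕ}
    (h : ∀ m, (S.filter (m ≤ ·)).card ≤ (T.filter (m ≤ ·)).card) : Dominated S T := by
  have hc : S.card ≤ T.card := by simpa using h 0
  refine ⟨hc, fun i => ?_⟩
  by_contra hlt
  rw [not_le] at hlt
  have h1 := card_filter_le_orderEmbOfFin S (Fin.rev i)
  have h2 := card_filter_le_orderEmbOfFin T (Fin.rev (Fin.castLE hc i))
  have h3 := h (S.orderEmbOfFin rfl (Fin.rev i))
  have h4 : T.filter (S.orderEmbOfFin rfl (Fin.rev i) ≤ ·) ⊂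
      T.filter (T.orderEmbOfFin rfl (Fin.rev (Fin.castLE hc i)) ≤ ·) := by
    rw [Finset.ssubset_iff_of_subset]
    · exact ⟨_, Finset.mem_filter.2 ⟨Finset.orderEmbOfFin_mem T rfl _, le_rfl⟩,
        fun hm => (Finset.mem_filter.1 hm).2.not_gt hlt⟩
    · intro x hx
      rw [Finset.mem_filter] at hx ⊢
      exact ⟨hx.1, hlt.le.trans hx.2⟩
  have h5 := Finset.card_lt_card h4
  simp only [Fin.val_rev, Fin.val_castLE] at h1 h2
  have := i.2
  omega

namespace HalfDiagram

/-- The nodes of the propagating arcs. -/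
def halves (H : HalfDiagram N) : Finset (Fin N) := Finset.univ.filter fun a => H.mate a = a

theorem mem_halves {H : HalfDiagram N} {a : Fin N} : a ∈ H.halves ↔ H.mate a = a := by
  simp [halves]

theorem height_injOn_halves (H : HalfDiagram N) : Set.InjOn H.height H.halves :=
  fun _ ha _ hb h => H.half_unique (mem_halves.1 ha) (mem_halves.1 hb) h

theorem propLab_eq_image (H : HalfDiagram N) : H.propLab = H.halves.image H.height := rfl

theorem card_filter_propLab (H : HalfDiagram N) (p : ℕ → Prop) [DecidablePred p] :
    (H.propLab.filter p).card = (H.halves.filter fun a => p (H.height a)).card := by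
  rw [propLab_eq_image, Finset.filter_image, Finset.card_image_of_injOn]
  exact H.height_injOn_halves.mono (Finset.coe_subset.2 (Finset.filter_subset _ _))

theorem card_filter_halves_lt (H : HalfDiagram N) {n : ℕ} (hn : n ≤ N)
    (h : ∀ b : Fin N, b.val < n → (H.mate b).val < n) :
    (H.halves.filter fun b => b.val < n).card % 2 = n % 2 := by
  have h1 : Even ((Finset.univ.filter fun b : Fin N => b.val < n ∧ H.mate b ≠ b).card) := by
    refine even_card_of_involution _ H.mate (fun b hb => ?_) (fun b _ => H.mate_mate b)
      (fun b hb => (Finset.mem_filter.1 hb).2.2)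
    rw [Finset.mem_filter] at hb ⊢
    exact ⟨Finset.mem_univ _, h b hb.2.1, by rw [H.mate_mate]; exact Ne.symm hb.2.2⟩
  have h2 : (Finset.univ.filter fun b : Fin N => b.val < n).card = n := by
    rw [Fin.card_filter_val_lt]
    omega
  have h3 := (Finset.univ.filter fun b : Fin N => b.val < n).card_filter_add_card_filter_not
    (p := fun b => H.mate b = b)
  rw [Finset.filter_filter, Finset.filter_filter, h2] at h3
  have h4 : H.halves.filter (fun b => b.val < n) =
      Finset.univ.filter fun b : Fin N => b.val < n ∧ H.mate b = b := by
    ext b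
    simp only [Finset.mem_filter, mem_halves, Finset.mem_univ, true_and]
    tauto
  rw [h4]
  have := Nat.even_iff.1 h1
  simp only [ne_eq] at this
  omega

/-- Along the half arcs the labels increase from left to right. No full arc passes over a half arc,
so the nodes before it are half arcs and whole pairs; its zero-based index therefore has the parity
of the number of nodes before it, and the label parity follows. -/
theorem isFibonacciSet_propLab (H : HalfDiagram N) : IsFibonacciSet N H.propLab := by
  refine ⟨fun x hx => ?_, ?_, fun i => ?_⟩
  · obtain ⟨a, _, rfl⟩ := Finset.mem_image.1 hx
    have h1 := H.height_le a
    have h2 := H.one_le_height a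
    have h3 := a.2
    rw [Finset.mem_Icc]
    omega
  · have h := H.card_filter_halves_lt le_rfl fun b _ => (H.mate b).2
    rw [propLab_eq_image, Finset.card_image_of_injOn H.height_injOn_halves, ← h]
    congr 2
    exact (Finset.filter_true_of_mem fun b _ => b.2).symm
  · obtain ⟨a, ha, e⟩ := Finset.mem_image.1 (Finset.orderEmbOfFin_mem H.propLab rfl i)
    have ha' : H.mate a = a := (Finset.mem_filter.1 ha).2
    have h1 := card_filter_lt_orderEmbOfFin H.propLab i
    rw [← e, card_filter_propLab] at h1
    have h2 : H.halves.filter (fun b => H.height b < H.height a) =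
        H.halves.filter fun b => b.val < a.val := by
      apply Finset.filter_congr
      intro b hb
      have h3 := H.height_nested_half a b (mem_halves.1 hb)
      have h4 := H.height_nested_half b a ha'
      rw [← Fin.lt_def]
      rcases lt_trichotomy b a with h | rfl | h
      · exact iff_of_true (h3 h) h
      · simp
      · exact iff_of_false (h4 h).not_gt h.not_gt
    have h3 := H.card_filter_halves_lt a.2.le fun b hb => by
      have h4 := H.noncrossing_half b a ha'
      have h5 : H.mate b ≠ a := fun e => by
        have := H.mate_mate b
        rw [e, ha'] at this
        subst this
        omega
      have h6 : (H.mate b).val ≠ a.val := fun e => h5 (Fin.ext e)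
      rw [Fin.lt_def, Fin.lt_def] at h4
      omega
    rw [h2] at h1
    have h4 := H.height_parity a
    rw [ha'] at h4
    rw [← e]
    omega

theorem sum_propLab (H : HalfDiagram N) : ∑ x ∈ H.propLab, x = ∑ a ∈ H.halves, H.height a := by
  rw [propLab_eq_image, Finset.sum_image H.height_injOn_halves]

theorem dominated_propLab {H E : HalfDiagram N}
    (h : ∀ a, H.mate a = a → E.mate a = a ∧ H.height a ≤ E.height a) :
    Dominated H.propLab E.propLab := by
  refine dominated_of_card_filter_le fun m => ?_
  rw [card_filter_propLab, card_filter_propLab]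
  refine Finset.card_le_card fun a ha => ?_
  rw [Finset.mem_filter, mem_halves] at ha ⊢
  exact ⟨(h a ha.1).1, ha.2.trans (h a ha.1).2⟩

/-- The sum of the labels drops strictly, because labels are at least 1. -/
theorem propLab_ne {H E : HalfDiagram N}
    (h : ∀ a, H.mate a = a → E.mate a = a ∧ H.height a ≤ E.height a) {a : Fin N}
    (ha : E.mate a = a) (ha' : H.mate a = a → H.height a < E.height a) :
    H.propLab ≠ E.propLab := by
  intro e
  have h1 := congrArg (fun S : Finset ℕ => ∑ x ∈ S, x) e
  simp only [sum_propLab] at h1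
  have hsub : H.halves ⊆ E.halves := fun b hb => mem_halves.2 (h b (mem_halves.1 hb)).1
  have h2 : ∑ b ∈ H.halves, H.height b ≤ ∑ b ∈ H.halves, E.height b :=
    Finset.sum_le_sum fun b hb => (h b (mem_halves.1 hb)).2
  have h3 : ∑ b ∈ H.halves, E.height b ≤ ∑ b ∈ E.halves, E.height b :=
    Finset.sum_le_sum_of_subset hsub
  by_cases ha2 : H.mate a = a
  · have := Finset.sum_lt_sum (fun b hb => (h b (mem_halves.1 hb)).2)
      ⟨a, mem_halves.2 ha2, ha' ha2⟩
    omega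
  · have := Finset.sum_lt_sum_of_subset (f := E.height) hsub (mem_halves.2 ha)
      (fun hm => ha2 (mem_halves.1 hm)) (E.one_le_height a) (fun _ _ _ => Nat.zero_le _)
    omega

end HalfDiagram

end Halves

end Okada

namespace Okada

open ArcDiagram

/-! ### The action of the generators on half diagrams -/

section ActHalves

variable {N : ℕ}

namespace ArcDiagram

/-- `act i` reads only the labels and mates at i and i+1; which right node a propagating arc reaches
is invisible in the left half. -/
theorem leftHalf_act_congr (i : GenIdx N) {D E : ArcDiagram N} (h : D.leftHalf = E.leftHalf) :
    (act i D).leftHalf = (act i E).leftHalf := by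
  rw [leftHalf_eq_iff] at h ⊢
  intro a
  have hD := act_cases i D (Sum.inl a)
  have hE := act_cases i E (Sum.inl a)
  have h1 := h ⟨i.1 - 1, by have := i.2; omega⟩
  have h2 := h ⟨i.1, i.2.2⟩
  have h3 := h a
  change D.height (GenIdx.lo i) = _ ∧ ∀ b, D.mate (GenIdx.lo i) = _ ↔
    E.mate (GenIdx.lo i) = _ at h1
  change D.height (GenIdx.hi i) = _ ∧ ∀ b, D.mate (GenIdx.hi i) = _ ↔
    E.mate (GenIdx.hi i) = _ at h2
  have h4 := h1.2 a
  have h5 := h2.2 a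
  have h6 : E.height (Sum.inl ⟨i.1 - 1, by have := i.2; omega⟩) = E.height (GenIdx.lo i) := rfl
  have h7 : E.height (Sum.inl ⟨i.1, i.2.2⟩) = E.height (GenIdx.hi i) := rfl
  have h8 : E.mate (Sum.inl ⟨i.1 - 1, by have := i.2; omega⟩) = E.mate (GenIdx.lo i) := rfl
  refine ⟨by grind, fun b => ?_⟩
  have h9 := h1.2 b
  have h10 := h2.2 b
  have h11 := h3.2 b
  grind

theorem weight_congr {K : Type*} [Field K] (X Y : ℕ → K) (i : GenIdx N) {D E : ArcDiagram N}
    (h : D.leftHalf = E.leftHalf) : weight X Y i D = weight X Y i E := by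
  rw [leftHalf_eq_iff] at h
  have h1 := h ⟨i.1 - 1, by have := i.2; omega⟩
  have h2 := (h ⟨i.1, i.2.2⟩).1
  change D.height (GenIdx.lo i) = E.height (GenIdx.lo i) ∧ ∀ b, D.mate (GenIdx.lo i) = _ ↔
    E.mate (GenIdx.lo i) = _ at h1
  change D.height (GenIdx.hi i) = E.height (GenIdx.hi i) at h2
  have h3 : D.mate (GenIdx.lo i) = GenIdx.hi i ↔ E.mate (GenIdx.lo i) = GenIdx.hi i :=
    h1.2 ⟨i.1, i.2.2⟩
  unfold weight
  rw [h1.1, h2]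
  simp only [h3]

/-- The composition with an elementary diagram does not increase the propagating arcs on the
right, and if it changes the right half, it decreases one of them. -/
theorem rightHalf_act (i : GenIdx N) (D : ArcDiagram N) :
    (∀ a, (act i D).rightHalf.mate a = a → D.rightHalf.mate a = a ∧
      (act i D).rightHalf.height a ≤ D.rightHalf.height a) ∧
    ((act i D).rightHalf = D.rightHalf ∨ ∃ a, D.rightHalf.mate a = a ∧
      ((act i D).rightHalf.mate a = a → (act i D).rightHalf.height a < D.rightHalf.height a)) := by
  -- A right node is affected only if it is the mate of i or i+1; it is then propagating, and its
  -- new label is a minimum involving its old one.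
  have hlo : ∀ a, Sum.inr a = D.mate (GenIdx.lo i) → D.rightHalf.mate a = a ∧
      D.height (Sum.inr a) = D.height (GenIdx.lo i) := fun a h => by
    rw [h, D.height_mate, rightHalf_mate_eq_self_iff, h, D.mate_mate]
    exact ⟨⟨_, rfl⟩, rfl⟩
  have hhi : ∀ a, Sum.inr a = D.mate (GenIdx.hi i) → D.rightHalf.mate a = a ∧
      D.height (Sum.inr a) = D.height (GenIdx.hi i) := fun a h => by
    rw [h, D.height_mate, rightHalf_mate_eq_self_iff, h, D.mate_mate]
    exact ⟨⟨_, rfl⟩, rfl⟩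
  have key : ∀ a, (D.rightHalf.mate a = a ∧
      (act i D).height (Sum.inr a) ≤ D.height (Sum.inr a)) ∨
      (act i D).mate (Sum.inr a) = D.mate (Sum.inr a) ∧
        (act i D).height (Sum.inr a) = D.height (Sum.inr a) := by
    intro a
    rcases act_cases i D (Sum.inr a) with ⟨h, _⟩ | ⟨h, _⟩ | ⟨h, _, _, _, h1⟩ |
      ⟨h, _, _, _, _, h1⟩ | ⟨_, _, _, _, h⟩
    · exact (Sum.inr_ne_inl h).elim
    · exact (Sum.inr_ne_inl h).elim
    · exact Or.inl ⟨(hlo a h).1, by rw [h1, (hlo a h).2]; exact min_le_left _ _⟩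
    · exact Or.inl ⟨(hhi a h).1, by rw [h1, (hhi a h).2]; exact min_le_right _ _⟩
    · exact Or.inr h
  have same : ∀ a, (act i D).mate (Sum.inr a) = D.mate (Sum.inr a) →
      (act i D).rightHalf.mate a = D.rightHalf.mate a := fun a h => by
    simp only [rightHalf, leftHalf, mirror, Sum.swap_inl, h]
  refine ⟨fun a ha => ?_, ?_⟩
  · rcases key a with h | ⟨h, h'⟩
    · exact h
    · exact ⟨(same a h).symm.trans ha, h'.le⟩
  · by_contra! hne
    refine hne.1 ?_
    apply HalfDiagram.ext <;> funext a <;> rcases key a with ⟨h, h'⟩ | ⟨h, h'⟩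
    · rw [(hne.2 a h).1, h]
    · exact same a h
    · exact le_antisymm h' (hne.2 a h).2
    · exact h'

theorem propLab_act (i : GenIdx N) (D : ArcDiagram N) :
    (act i D).rightHalf = D.rightHalf ∨
      Dominated (act i D).rightHalf.propLab D.rightHalf.propLab ∧
        (act i D).rightHalf.propLab ≠ D.rightHalf.propLab := by
  obtain ⟨h1, h2 | ⟨a, h2, h3⟩⟩ := rightHalf_act i D
  · exact Or.inl h2
  · exact Or.inr ⟨HalfDiagram.dominated_propLab h1, HalfDiagram.propLab_ne h1 h2 h3⟩

end ArcDiagram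

end ActHalves

/-! ### Cellularity -/

section Cellular

variable {K : Type*} [Field K] {N : ℕ} (X Y : ℕ → K)

instance : Finite (ArcDiagram N) :=
  Finite.of_surjective (fun σ : Equiv.Perm (Fin N) => ofWord (permWord σ)) exists_ofWord_permWord

instance : Finite (HalfDiagram N) :=
  Finite.of_surjective leftHalf fun L => ⟨glue L L rfl, leftHalf_glue rfl⟩

instance (S : FibSet N) : Finite (HalfDiagramWith S) := Subtype.finite

/-- The diagram `L ⋈ R`, for half diagrams with propagating label set `S`. -/
noncomputable def join {S : FibSet N} (L R : HalfDiagramWith S) : ArcDiagram N :=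
  glue L.1 R.1 (L.2.trans R.2.symm)

theorem leftHalf_join {S : FibSet N} (L R : HalfDiagramWith S) : (join L R).leftHalf = L.1 :=
  leftHalf_glue _

theorem rightHalf_join {S : FibSet N} (L R : HalfDiagramWith S) : (join L R).rightHalf = R.1 :=
  rightHalf_glue _

theorem join_injective : Function.Injective
    fun p : (Σ S : FibSet N, HalfDiagramWith S × HalfDiagramWith S) => join p.2.1 p.2.2 := by
  rintro ⟨⟨S, hS⟩, ⟨L, hL⟩, ⟨R, hR⟩⟩ ⟨⟨T, hT⟩, ⟨L', hL'⟩, ⟨R', hR'⟩⟩ h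
  have h1 := (leftHalf_join (S := ⟨S, hS⟩) ⟨L, hL⟩ ⟨R, hR⟩).symm.trans
    ((congrArg leftHalf h).trans (leftHalf_join _ _))
  have h2 := (rightHalf_join (S := ⟨S, hS⟩) ⟨L, hL⟩ ⟨R, hR⟩).symm.trans
    ((congrArg rightHalf h).trans (rightHalf_join _ _))
  dsimp only at h1 h2
  subst h1 h2
  dsimp only at hL hL'
  subst hL hL'
  rfl

/-- The Fibonacci set of a diagram. -/
def fibSet (D : ArcDiagram N) : FibSet N :=
  ⟨D.rightHalf.propLab, D.rightHalf.isFibonacciSet_propLab⟩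

theorem join_halves (D : ArcDiagram N) {S : FibSet N} (hL : D.leftHalf.propLab = S.1)
    (hR : D.rightHalf.propLab = S.1) :
    join (S := S) ⟨D.leftHalf, hL⟩ ⟨D.rightHalf, hR⟩ = D :=
  glue_leftHalf_rightHalf D

theorem join_surjective : Function.Surjective
    fun p : (Σ S : FibSet N, HalfDiagramWith S × HalfDiagramWith S) => join p.2.1 p.2.2 :=
  fun D => ⟨⟨fibSet D, ⟨D.leftHalf, D.propLab_rightHalf.symm⟩, ⟨D.rightHalf, rfl⟩⟩,
    join_halves D _ _⟩

/-- The span of the diagrams with a propagating label set smaller than `S`. -/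
def lowerSpan (S : FibSet N) : Submodule K (OkadaAlgebra K N X Y) :=
  Submodule.span K {c | ∃ T : FibSet N, T < S ∧ ∃ P Q : HalfDiagramWith T,
    c = diagramElt X Y (join P Q)}

variable {X Y}

theorem diagramElt_mem_lowerSpan {S : FibSet N} {D : ArcDiagram N} (h : fibSet D < S) :
    diagramElt X Y D ∈ lowerSpan X Y S :=
  Submodule.subset_span ⟨fibSet D, h, ⟨D.leftHalf, D.propLab_rightHalf.symm⟩,
    ⟨D.rightHalf, rfl⟩, (congrArg (diagramElt X Y) (join_halves D _ _)).symm⟩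

theorem fibSet_act (i : GenIdx N) (D : ArcDiagram N) :
    (act i D).rightHalf = D.rightHalf ∨ fibSet (act i D) < fibSet D := by
  rcases propLab_act i D with h | ⟨h1, h2⟩
  · exact Or.inl h
  · exact Or.inr (lt_of_le_of_ne (α := FibSet N) h1 fun e => h2 (congrArg Subtype.val e))

theorem fibSet_act_le (i : GenIdx N) (D : ArcDiagram N) : fibSet (act i D) ≤ fibSet D := by
  rcases fibSet_act i D with h | h
  · exact le_of_eq (Subtype.ext (congrArg HalfDiagram.propLab h))
  · exact h.le

theorem fibSet_join {S : FibSet N} (L R : HalfDiagramWith S) : fibSet (join L R) = S :=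
  Subtype.ext ((congrArg HalfDiagram.propLab (rightHalf_join L R)).trans R.2)

theorem mul_mem_lowerSpan {S : FibSet N} (a : OkadaAlgebra K N X Y) {b : OkadaAlgebra K N X Y}
    (hb : b ∈ lowerSpan X Y S) : a * b ∈ lowerSpan X Y S := by
  have ha : a ∈ Algebra.adjoin K (Set.range (gen (N := N) X Y)) := by
    rw [adjoin_range_gen]
    trivial
  induction ha using Algebra.adjoin_induction generalizing b with
  | mem a ha =>
    obtain ⟨i, rfl⟩ := ha
    induction hb using Submodule.span_induction with
    | mem b hb =>
      obtain ⟨T, hT, P, Q, rfl⟩ := hb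
      rw [gen_mul_diagramElt]
      refine Submodule.smul_mem _ _ (diagramElt_mem_lowerSpan ?_)
      refine (fibSet_act_le i _).trans_lt ?_
      rwa [fibSet_join]
    | zero => rw [mul_zero]; exact zero_mem _
    | add x y _ _ hx hy => rw [mul_add]; exact add_mem hx hy
    | smul r x _ hx => rw [mul_smul_comm]; exact Submodule.smul_mem _ _ hx
  | algebraMap r => rw [← Algebra.smul_def]; exact Submodule.smul_mem _ _ hb
  | add x y _ _ hx hy => rw [add_mul]; exact add_mem (hx hb) (hy hb)
  | mul x y _ _ hx hy => rw [mul_assoc]; exact hx (hy hb)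

/-- The generators act on the diagrams `L ⋈ R` by changing `L`, up to smaller diagrams. -/
theorem exists_gen_mul_join (S : FibSet N) (i : GenIdx N) :
    ∃ r : HalfDiagramWith S → HalfDiagramWith S → K, ∀ L R : HalfDiagramWith S,
      gen X Y i * diagramElt X Y (join L R) - ∑ᶠ L', r L' L • diagramElt X Y (join L' R) ∈
        lowerSpan X Y S := by
  classical
  have := Fintype.ofFinite (HalfDiagramWith S)
  -- The scalars may not depend on `R`, so they are read off from the diagram `join L L`, which has
  -- the same left half as every `join L R`.
  refine ⟨fun L' L => if L'.1 = (act i (join L L)).leftHalf then weight X Y i (join L L) else 0,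
    fun L R => ?_⟩
  have h1 : (act i (join L L)).leftHalf = (act i (join L R)).leftHalf :=
    leftHalf_act_congr i (by rw [leftHalf_join, leftHalf_join])
  have h2 : weight X Y i (join L L) = weight X Y i (join L R) :=
    weight_congr X Y i (by rw [leftHalf_join, leftHalf_join])
  rw [gen_mul_diagramElt, finsum_eq_sum_of_fintype]
  simp only [h1, h2, ite_smul, zero_smul]
  rcases fibSet_act i (join L R) with h | h
  · have h3 : (act i (join L R)).rightHalf.propLab = S.1 := by rw [h, rightHalf_join, R.2]
    have h4 : (act i (join L R)).leftHalf.propLab = S.1 := by rw [← propLab_rightHalf, h3]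
    rw [Finset.sum_eq_single ⟨_, h4⟩]
    · have h5 : join (S := S) ⟨(act i (join L R)).leftHalf, h4⟩ R = act i (join L R) := by
        have h6 : R = ⟨(act i (join L R)).rightHalf, h3⟩ :=
          Subtype.ext ((rightHalf_join L R).symm.trans h.symm)
        exact (congrArg (join _) h6).trans (join_halves _ h4 h3)
      rw [if_pos rfl, h5, sub_self]
      exact zero_mem _
    · intro L' _ hne
      exact if_neg fun e => hne (Subtype.ext e)
    · exact fun hn => (hn (Finset.mem_univ _)).elim
  · rw [fibSet_join] at h
    rw [Finset.sum_eq_zero, sub_zero]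
    · exact Submodule.smul_mem _ _ (diagramElt_mem_lowerSpan h)
    · intro L' _
      -- In the dropping case no `L'` matches, since the new left half has a propagating label set
      -- different from `S`.
      refine if_neg fun e => h.ne (Subtype.ext ?_)
      change (act i (join L R)).rightHalf.propLab = S.1
      rw [propLab_rightHalf, ← e, L'.2]

theorem exists_mul_join (S : FibSet N) (a : OkadaAlgebra K N X Y) :
    ∃ r : HalfDiagramWith S → HalfDiagramWith S → K, ∀ L R : HalfDiagramWith S,
      a * diagramElt X Y (join L R) - ∑ᶠ L', r L' L • diagramElt X Y (join L' R) ∈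
        lowerSpan X Y S := by
  classical
  have := Fintype.ofFinite (HalfDiagramWith S)
  have ha : a ∈ Algebra.adjoin K (Set.range (gen (N := N) X Y)) := by
    rw [adjoin_range_gen]
    trivial
  induction ha using Algebra.adjoin_induction with
  | mem a ha =>
    obtain ⟨i, rfl⟩ := ha
    exact exists_gen_mul_join S i
  | algebraMap k =>
    refine ⟨fun L' L => if L' = L then k else 0, fun L R => ?_⟩
    rw [finsum_eq_sum_of_fintype]
    simp only [ite_smul, zero_smul, Finset.sum_ite_eq', Finset.mem_univ, if_true]
    rw [← Algebra.smul_def, sub_self]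
    exact zero_mem _
  | add a b _ _ ha hb =>
    obtain ⟨r, hr⟩ := ha
    obtain ⟨s, hs⟩ := hb
    refine ⟨fun L' L => r L' L + s L' L, fun L R => ?_⟩
    have := add_mem (hr L R) (hs L R)
    simp only [finsum_eq_sum_of_fintype, add_smul, Finset.sum_add_distrib] at this ⊢
    rwa [add_mul, add_sub_add_comm]
  | mul a b _ _ ha hb =>
    obtain ⟨r, hr⟩ := ha
    obtain ⟨s, hs⟩ := hb
    -- The matrix product of the coefficients of `a` and `b`; the error terms stay small because
    -- `lowerSpan` is a left ideal.
    refine ⟨fun L' L => ∑ M, s M L * r L' M, fun L R => ?_⟩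
    have h1 := mul_mem_lowerSpan a (hs L R)
    have h2 := Submodule.sum_mem (lowerSpan X Y S) (t := Finset.univ)
      fun M _ => Submodule.smul_mem _ (s M L) (hr M R)
    have h3 := add_mem h1 h2
    simp only [finsum_eq_sum_of_fintype] at h3 ⊢
    convert h3 using 1
    simp only [mul_sub, smul_sub, Finset.sum_sub_distrib, Finset.mul_sum, mul_smul_comm,
      Finset.smul_sum, Finset.sum_smul, mul_smul, mul_assoc]
    rw [Finset.sum_comm]
    abel

theorem isCellDatum_diagramElt : IsCellDatum (Λ := FibSet N) (fun S => HalfDiagramWith S)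
    (fun _ L R => diagramElt X Y (join L R)) (mirrorMap X Y) where
  finite_dimensional :=
    ⟨by
      rw [← span_range_diagramElt X Y]
      exact Submodule.fg_span (Set.finite_range _)⟩
  finite_index _ := inferInstance
  injective := (linearIndependent_diagramElt X Y).injective.comp join_injective
  linearIndependent := (linearIndependent_diagramElt X Y).comp _ join_injective
  span_eq_top := by
    rw [← span_range_diagramElt, ← join_surjective.range_comp (diagramElt X Y)]
    rfl
  star_mul := mirrorMap_mul X Y
  star_star := mirrorMap_mirrorMap X Y
  star_basis S L R := by
    rw [mirrorMap_diagramElt, join, mirror_glue]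
    rfl
  mul_basis := exists_mul_join

end Cellular

end Okada

theorem mainTheorem5 {K : Type*} [Field K] (N : ℕ) (X Y : ℕ → K) :
    (∀ D : Okada.ArcDiagram N,
      ∃! σ : Equiv.Perm (Fin N), Okada.IsWordDiagram (Okada.permWord σ) D) ∧
    ∃ star : Okada.OkadaAlgebra K N X Y →ₗ[K] Okada.OkadaAlgebra K N X Y,
      (∀ D : Okada.ArcDiagram N,
        star (Okada.diagramElt X Y D) = Okada.diagramElt X Y D.mirror) ∧
      Okada.IsCellDatum (Λ := Okada.FibSet N)
        (fun S => Okada.HalfDiagramWith S)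
        (fun S L R => Okada.diagramElt X Y (Okada.glue L.1 R.1 (L.2.trans R.2.symm)))
        star :=
  ⟨Okada.existsUnique_isWordDiagram, Okada.mirrorMap X Y, Okada.mirrorMap_diagramElt X Y,
    Okada.isCellDatum_diagramElt⟩
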